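/- **Definitions.** Let $v_1,\dots,v_n\in\mathbb R^d$. A directed matching on $[n]$ is a set of ordered pairs $(x,y)$, $x\ne y$, no two of which share a vertex. Let $\sigma,\delta>0$. A $(\sigma,\delta)$-matching-cover of $(v_x)$ is a (measurable) family $M=\{M(u)\}_{u\in\mathbb R^d}$ of directed matchings on $[n]$ such that (stretch) $(v_y-v_x)\cdot u\ge\sigma$ whenever $(x,y)\in M(u)$; (skew-symmetry) $(x,y)\in M(u)$ iff $(y,x)\in M(-u)$; (largeness) $\mathbf E_u|M(u)|\ge\delta n$ for a standard Gaussian $u$ in $\mathbb R^d$. For a list $u_1,\dots,u_r$ of vectors, $M(u_1,\dots,u_r)$ is the directed graph with an edge $(x,y)$ iff there are $x=x_0,x_1,\dots,x_r=y$ with $(x_{i-1},x_i)\in M(u_i)$ for all $i\le r$; for a distribution $\mathcal D$ over lists, $M(\mathcal D)$ is the random graph $M(u_1,\dots,u_r)$ with $(u_1,\dots,u_r)\sim\mathcal D$. For $0\le\rho\le 1$ let $\mathcal N^R_\rho$ be the law of $u_1,\dots,u_R$, where $u_1$ is a standard Gaussian in $\mathbb R^d$ and $u_{i+1}=\rho u_i+\sqrt{1-\rho^2}\,g_{i+1}$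 with independent standard Gaussians $g_{i+1}$. Let $\mathrm{Sample}(R,\rho)$ be the law of the following list: draw $(u_1,\dots,u_R)\sim\mathcal N^R_\rho$ and independently $(w_1,\dots,w_R)\sim\mathcal N^R_0$, draw a uniformly random shuffle (order-preserving interleaving) of the two lists and a uniformly random $r\in\{1,\dots,R\}$, and output the first $r$ entries of the shuffled list. **Theorem.** There are integers $1\le K(R)\le R$ such that the distributions $\mathcal D=\mathcal D_{d,R}=\mathrm{Sample}(R,1-1/K(R))$, $d\ge 0$, $R\ge 1$, over lists of at most $R$ vectors of $\mathbb R^d$ have the following properties. 1. They are efficiently samplable: a single randomized program on a real-number machine (unit-cost register operations, real arithmetic and square roots, draws of standard Gaussian numbers and of uniform integers), given $d$ and $R$, outputs a list with law exactly $\mathcal D_{d,R}$ in a number of steps that is always bounded by a fixed polynomial in $d$ and $R$. 2. For all $\sigma,\delta>0$ there are constants $c_1,c_2,C>0$, depending only on $\sigma$ and $\delta$, such that for all $n$, $d$ and all integers $R$ with $1\le R\le c_1\sqrt{\log n}$ there is $L\ge c_2R^2/\log n$ with the following property: for all vectors $v_1,\dots,v_n\in\mathbb R^d$ and every $(\sigma,\delta)$-matching-cover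 $M$ of $(v_x)$, the expected number of edges $(x,y)$ of $M(\mathcal D_{d,R})$ with $\|v_x-v_y\|^2\ge L$ is at least $e^{-CR^2}n$. -/

import Mathlib

open MeasureTheory ProbabilityTheory
open scoped ENNReal

noncomputable section

/-! ### Lists of vectors and Gaussian chains -/

/-- `ℝ^d` with its Euclidean norm and inner product. -/
abbrev Vec (d : ℕ) : Type := EuclideanSpace ℝ (Fin d)

/-- Finite lists of vectors of `ℝ^d`: a length together with that many vectors. -/
abbrev VecList (d : ℕ) : Type := Σ r : ℕ, (Fin r → Vec d)

/-- The chain `u₀ = g₀`, `u_{k+1} = ρ u_k + √(1 - ρ²) g_{k+1}`; when the `g_k` are independent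
standard Gaussians, `u_{k+1}` is a `ρ`-correlated copy of `u_k`. -/
def corrChain {d : ℕ} (ρ : ℝ) (g : ℕ → Vec d) : ℕ → Vec d
  | 0 => g 0
  | k + 1 => ρ • corrChain ρ g k + Real.sqrt (1 - ρ ^ 2) • g (k + 1)

/-- The law of a list of `R` standard Gaussian vectors of `ℝ^d` in which each one is a
`ρ`-correlated copy of the one before it. For `ρ = 0` the vectors are independent. -/
def corrGaussian (d R : ℕ) (ρ : ℝ) : Measure (Fin R → Vec d) :=
  (Measure.infinitePi (fun _ : ℕ => stdGaussian (Vec d))).map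
    (fun g (i : Fin R) => corrChain ρ g i)

open Classical in
/-- The shuffles of two lists of length `R`: the bijections onto the `R + R` positions which keep
the internal order of each of the two lists. -/
def shuffles (R : ℕ) : Finset (Fin R ⊕ Fin R ≃ Fin (R + R)) :=
  Finset.univ.filter fun e =>
    StrictMono (fun i : Fin R => e (Sum.inl i)) ∧ StrictMono (fun i : Fin R => e (Sum.inr i))

/-- The first `r + 1` entries of the shuffle `e` of the two lists `u` and `w`. -/
def shufflePrefix {d R : ℕ} (e : Fin R ⊕ Fin R ≃ Fin (R + R)) (r : Fin R)
    (u w : Fin R → Vec d) : VecList d :=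
  ⟨r + 1, fun i => Sum.elim u w (e.symm ⟨i, by omega⟩)⟩

/-- The law of the following random list: draw a `ρ`-correlated Gaussian list and an independent
list of independent Gaussians, both of length `R`, draw a uniformly random shuffle of the two and
a uniformly random `r ∈ {1, …, R}`, and return the first `r` entries of the shuffled list. -/
def sampleDist (d R : ℕ) (ρ : ℝ) : Measure (VecList d) :=
  ((R * (shuffles R).card : ℕ) : ℝ≥0∞)⁻¹ •
    ∑ e ∈ shuffles R, ∑ r : Fin R,
      ((corrGaussian d R ρ).prod (corrGaussian d R 0)).map
        (fun p => shufflePrefix e r p.1 p.2)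

/-! ### Matching covers -/

/-- A directed matching: an orientation of a set of vertex-disjoint edges. -/
def IsDirectedMatching {n : ℕ} (E : Set (Fin n × Fin n)) : Prop :=
  (∀ e ∈ E, e.1 ≠ e.2) ∧
    ∀ e ∈ E, ∀ f ∈ E, e ≠ f → e.1 ≠ f.1 ∧ e.1 ≠ f.2 ∧ e.2 ≠ f.1 ∧ e.2 ≠ f.2

/-- A `(σ, δ)`-matching-cover for the embedding `v`. -/
structure IsMatchingCover {n d : ℕ} (σ δ : ℝ) (v : Fin n → Vec d)
    (M : Vec d → Set (Fin n × Fin n)) : Prop where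
  measurable : ∀ x y, MeasurableSet {u | (x, y) ∈ M u}
  matching : ∀ u, IsDirectedMatching (M u)
  stretch : ∀ u x y, (x, y) ∈ M u → σ ≤ inner ℝ (v y - v x) u
  skew : ∀ u x y, (x, y) ∈ M u ↔ (y, x) ∈ M (-u)
  large : δ * n ≤ ∫ u, ((M u).ncard : ℝ) ∂(stdGaussian (Vec d))

/-- The chained graph `M(u₁, …, u_R)`: there is an edge `(x, y)` if there are
`x = x₀, x₁, …, x_R = y` with `(x_{r-1}, x_r) ∈ M(u_r)` for all `r`. -/
def chained {n d : ℕ} (M : Vec d → Set (Fin n × Fin n)) (l : VecList d) :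
    Set (Fin n × Fin n) :=
  {p | ∃ z : Fin (l.1 + 1) → Fin n, z 0 = p.1 ∧ z (Fin.last l.1) = p.2 ∧
    ∀ i : Fin l.1, (z i.castSucc, z i.succ) ∈ M (l.2 i)}

/-! ### Efficient sampling: a randomized real-number machine with a step count

Programs act on natural-number registers and on an array of real cells. A cell is addressed by the
contents of two registers (row and column). Every instruction costs one step. The machine can draw
standard Gaussian numbers and uniformly random integers. -/

/-- The name of a real cell: the registers that hold its row and its column. -/
structure CellRef where
  row : ℕ
  col : ℕ

/-- Programs. -/
inductive Prog where
  /-- register `dst` becomes the constant `c` -/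
  | natConst (dst c : ℕ)
  /-- register `dst` becomes the sum of registers `a`, `b` -/
  | natAdd (dst a b : ℕ)
  /-- register `dst` becomes the truncated difference of registers `a`, `b` -/
  | natSub (dst a b : ℕ)
  /-- register `dst` becomes the integer quotient of registers `a`, `b` -/
  | natDiv (dst a b : ℕ)
  /-- register `dst` becomes uniformly random among the numbers below the contents of `a` -/
  | natUniform (dst a : ℕ)
  /-- cell `dst` becomes the contents of register `a`, as a real number -/
  | realOfNat (dst : CellRef) (a : ℕ)
  | realAdd (dst a b : CellRef)
  | realSub (dst a b : CellRef)
  | realMul (dst a b : CellRef)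
  | realDiv (dst a b : CellRef)
  | realSqrt (dst a : CellRef)
  /-- cell `dst` becomes a fresh standard Gaussian number -/
  | realGaussian (dst : CellRef)
  | skip
  | seq (p q : Prog)
  /-- run `p` if register `a` is less than register `b`, otherwise run `q` -/
  | ifLt (a b : ℕ) (p q : Prog)
  /-- run `p` as many times as register `a` says on entry -/
  | loop (a : ℕ) (p : Prog)

/-- A machine state: registers, cells, numbers of Gaussian and of uniform draws made so far, and
number of steps made so far. -/
structure MachineState where
  reg : ℕ → ℕ
  cell : ℕ → ℕ → ℝ
  gaussPos : ℕ
  unifPos : ℕ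
  steps : ℕ

namespace MachineState

/-- Count one step. -/
def tick (s : MachineState) : MachineState := { s with steps := s.steps + 1 }

/-- Write register `a`. -/
def setReg (s : MachineState) (a x : ℕ) : MachineState :=
  { s with reg := Function.update s.reg a x }

/-- Read a cell. -/
def get (s : MachineState) (c : CellRef) : ℝ := s.cell (s.reg c.row) (s.reg c.col)

/-- Write a cell. -/
def set (s : MachineState) (c : CellRef) (x : ℝ) : MachineState :=
  let newRow := Function.update (s.cell (s.reg c.row)) (s.reg c.col) x
  { s with cell := Function.update s.cell (s.reg c.row) newRow }

end MachineState

/-- The random source: a sequence of Gaussian numbers and a sequence of numbers in `[0, 1]`. -/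
abbrev Tape : Type := (ℕ → ℝ) × (ℕ → unitInterval)

/-- The law of the random source: independent standard Gaussian numbers, and independent uniform
numbers in `[0, 1]`. -/
def tapeLaw : Measure Tape :=
  (Measure.infinitePi (fun _ : ℕ => gaussianReal 0 1)).prod
    (Measure.infinitePi (fun _ : ℕ => (volume : Measure unitInterval)))

/-- Run a program. -/
def Prog.run (ω : Tape) : Prog → MachineState → MachineState
  | natConst dst c, s => (s.setReg dst c).tick
  | natAdd dst a b, s => (s.setReg dst (s.reg a + s.reg b)).tick
  | natSub dst a b, s => (s.setReg dst (s.reg a - s.reg b)).tick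
  | natDiv dst a b, s => (s.setReg dst (s.reg a / s.reg b)).tick
  | natUniform dst a, s =>
      { (s.setReg dst ⌊(s.reg a : ℝ) * (ω.2 s.unifPos : ℝ)⌋₊).tick with
        unifPos := s.unifPos + 1 }
  | realOfNat dst a, s => (s.set dst (s.reg a : ℝ)).tick
  | realAdd dst a b, s => (s.set dst (s.get a + s.get b)).tick
  | realSub dst a b, s => (s.set dst (s.get a - s.get b)).tick
  | realMul dst a b, s => (s.set dst (s.get a * s.get b)).tick
  | realDiv dst a b, s => (s.set dst (s.get a / s.get b)).tick
  | realSqrt dst a, s => (s.set dst (Real.sqrt (s.get a))).tick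
  | realGaussian dst, s =>
      { (s.set dst (ω.1 s.gaussPos)).tick with gaussPos := s.gaussPos + 1 }
  | skip, s => s.tick
  | seq p q, s => q.run ω (p.run ω s)
  | ifLt a b p q, s => if s.reg a < s.reg b then p.run ω s.tick else q.run ω s.tick
  | loop a p, s => (fun t => (p.run ω t).tick)^[s.reg a] s.tick

/-- The initial state on input `d`, `R`: these two numbers in registers `0` and `1`. -/
def initState (d R : ℕ) : MachineState where
  reg := fun a => if a = 0 then d else if a = 1 then R else 0
  cell := fun _ _ => 0
  gaussPos := 0
  unifPos := 0
  steps := 0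

/-- The list of vectors of `ℝ^d` that a state represents: its length is in register `2`, and the
`i`-th vector is in row `i`, columns `0, …, d - 1`. -/
def MachineState.output (d : ℕ) (s : MachineState) : VecList d :=
  ⟨s.reg 2, fun i => WithLp.toLp 2 (fun j : Fin d => s.cell i j)⟩

/-- A family of distributions over lists of vectors of `ℝ^d`, with a parameter `R ≥ 1`, is
efficiently samplable if one program samples from each of them exactly, on input `d` and `R`, in a
number of steps that is always bounded by a fixed polynomial in `d` and `R`. -/
def EfficientlySamplable (D : (d : ℕ) → ℕ → Measure (VecList d)) : Prop :=
  ∃ (P : Prog) (A k : ℕ), ∀ d R : ℕ, 1 ≤ R →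
    D d R = tapeLaw.map (fun ω => (P.run ω (initState d R)).output d) ∧
    ∀ ω : Tape, (P.run ω (initState d R)).steps ≤ A * (d + R) ^ k

end

noncomputable section

/-! ### Standard Gaussian vectors -/

/-! Take `K R = R`, so `ρ = 1 - 1/R`. A sampled list carries a word in two letters, `true` for a
correlated vector and `false` for an independent one. Each word of length between `1` and `R` is the
sampled word with probability at least `1 / (R * (2R choose R)) ≥ exp (-3R²)`. It therefore suffices
to find, for given `v` and `M`, a single word along which far pairs are joined `exp (-C R²) n` times
in expectation; this is `exists_word_farMass`.

Suppose there is no such word. Discard the vertices that end too many far chains for some word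
(`card_filter_farMass_le`), and pass to a set `V` inside which all degrees stay bounded below
(`exists_subset_degree_ge`). On subsets `S` of `V` one grows a `ChainState`: into each `y ∈ S` lead
short chains (squared length below `L`) with stretch at least `τ` along the last correlated vector
`u`, whose total weight is at most `lam` for every `u` and at least `θ * lam` on average. A round
consists of two moves.

Spreading (`exists_spread_card_le`, `ChainState.spread`): independent steps do not touch `u`, and
each costs a factor `h₀` of weight. While the current set fails to cover enough vertices well, one
such step enlarges it by a factor `1/β`. A short chain prolonged to a short chain has moved its end
by at most `2√L`, so the stretch rarely drops by `σ/4`.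

Extending (`ChainState.extend`): `u` is replaced by a `ρ`-correlated copy and an edge of the
matching is appended. By concentration and a Harnack inequality (`exists_noiseOp_lower_bound`),
noise turns "substantial weight with probability `θ/2`" into "weight `exp (-C₀ R) * lam` for almost
all directions". Hence the edges leaving the set nearly always continue a chain, and the probability
recovers to `θ`. The noise has variance about `2/R`, so it spoils a stretch by `σ/4` only with
probability `exp (-c R)`, which beats the Harnack loss once `L` is below a suitable constant. The
new edge adds `σ`.

An extension shrinks the set by at most a factor `β` and each spreading step gains `1/β`, so
independent letters do not outnumber correlated ones. Thus about `R/2` rounds fit into length `R`,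
and each gains stretch `σ/4`. In the end pairs at squared distance below `L = c₂ R² / log n` have
stretch at least `Rσ/8` with substantial probability, whereas the Gaussian tail and a union bound
over `n` starting points allow only probability `1/n` (`ChainState.le_card_mul_exp`). At most `R`
letters cost a factor `exp (-O(R))` each, whence the bound `exp (-C R²)`.

For samplability, the shuffle is drawn letter by letter without replacement, with one fresh Gaussian
vector per position (`drawnList`, `sampleDist_eq_map`). A program doing this is verified through the
invariant `DrawInv`. -/

theorem integral_cexp_stdGaussian {d : ℕ} (c : Fin d → ℂ) :
    ∫ z, Complex.exp (∑ i, c i * (z i : ℂ)) ∂(stdGaussian (Vec d)) =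
      Complex.exp (∑ i, c i ^ 2 / 2) := by
  rw [← map_pi_eq_stdGaussian, integral_map (by fun_prop)
    (Measurable.aestronglyMeasurable (by fun_prop))]
  simp only [Complex.exp_sum]
  rw [integral_fintype_prod_eq_prod (f := fun i (x : ℝ) => Complex.exp (c i * (x : ℂ)))]
  refine Finset.prod_congr rfl fun i _ => ?_
  have h := complexMGF_gaussianReal (p := gaussianReal 0 1) (X := id) (μ := 0) (v := 1)
    Measure.map_id (c i)
  simpa [complexMGF] using h

theorem stdGaussian_map_inner {d : ℕ} (a : Vec d) :
    (stdGaussian (Vec d)).map (fun z => inner ℝ a z) = gaussianReal 0 (‖a‖₊ ^ 2) := by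
  have h := IsGaussian.map_eq_gaussianReal (μ := stdGaussian (Vec d)) (innerSL ℝ a)
  rw [integral_strongDual_stdGaussian, variance_dual_stdGaussian, innerSL_apply_norm] at h
  rw [Real.toNNReal_pow (norm_nonneg _), norm_toNNReal] at h
  exact h

theorem integrable_exp_inner_stdGaussian {d : ℕ} (a : Vec d) :
    Integrable (fun z => Real.exp (inner ℝ a z)) (stdGaussian (Vec d)) := by
  have h := integrable_exp_mul_gaussianReal (μ := 0) (v := ‖a‖₊ ^ 2) 1
  rw [← stdGaussian_map_inner a] at h
  simpa [Function.comp_def] using h.comp_measurable (by fun_prop)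

theorem integral_exp_inner_stdGaussian {d : ℕ} (a : Vec d) :
    ∫ z, Real.exp (inner ℝ a z) ∂(stdGaussian (Vec d)) = Real.exp (‖a‖ ^ 2 / 2) := by
  have h := mgf_gaussianReal (p := stdGaussian (Vec d)) (stdGaussian_map_inner a) 1
  simpa [mgf] using h

theorem lintegral_exp_inner_stdGaussian {d : ℕ} (a : Vec d) :
    ∫⁻ z, ENNReal.ofReal (Real.exp (inner ℝ a z)) ∂(stdGaussian (Vec d)) =
      ENNReal.ofReal (Real.exp (‖a‖ ^ 2 / 2)) := by
  rw [← integral_exp_inner_stdGaussian,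
    ofReal_integral_eq_lintegral_ofReal (integrable_exp_inner_stdGaussian a)
      (ae_of_all _ fun _ => (Real.exp_pos _).le)]

/-- The Cameron–Martin formula. -/
theorem stdGaussian_map_add {d : ℕ} (m : Vec d) :
    (stdGaussian (Vec d)).map (fun z => z + m) = (stdGaussian (Vec d)).withDensity
      (fun z => ENNReal.ofReal (Real.exp (inner ℝ m z - ‖m‖ ^ 2 / 2))) := by
  have hint : Integrable (fun z => Real.exp (inner ℝ m z - ‖m‖ ^ 2 / 2))
      (stdGaussian (Vec d)) := by
    simp only [Real.exp_sub]
    exact (integrable_exp_inner_stdGaussian m).div_const _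
  have : IsFiniteMeasure ((stdGaussian (Vec d)).withDensity
      (fun z => ENNReal.ofReal (Real.exp (inner ℝ m z - ‖m‖ ^ 2 / 2)))) :=
    isFiniteMeasure_withDensity_ofReal hint.2
  apply Measure.ext_of_charFun
  ext t
  rw [charFun_map_add_const, charFun_stdGaussian, charFun_apply,
    integral_withDensity_eq_integral_toReal_smul (by fun_prop) (by simp)]
  -- The characteristic function of the tilted measure is the Laplace transform at the complex point
  -- `m + i t`.
  have h := integral_cexp_stdGaussian (fun i => (m i : ℂ) + (t i : ℂ) * Complex.I)
  have hmm : ‖m‖ ^ 2 = ∑ i, m i * m i := by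
    rw [← real_inner_self_eq_norm_sq, PiLp.inner_apply]
    simp [sq]
  have htt : ‖t‖ ^ 2 = ∑ i, t i * t i := by
    rw [← real_inner_self_eq_norm_sq, PiLp.inner_apply]
    simp [sq]
  have hmt : ∀ a b : Vec d, inner ℝ a b = ∑ i, a i * b i := fun a b => by
    rw [PiLp.inner_apply]; simp [mul_comm]
  calc _ = Complex.exp (- (‖m‖ ^ 2 / 2 : ℝ)) *
        Complex.exp (∑ i, ((m i : ℂ) + (t i : ℂ) * Complex.I) ^ 2 / 2) := by
        rw [← Complex.exp_add, ← Complex.exp_add]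
        congr 1
        simp only [← Complex.ofReal_pow, hmm, htt, hmt]
        push_cast
        simp only [Finset.sum_div, ← Finset.sum_neg_distrib, Finset.sum_mul,
          ← Finset.sum_add_distrib]
        refine Finset.sum_congr rfl fun i _ => ?_
        ring_nf
        simp
        ring
    _ = _ := by
        rw [← h, ← integral_const_mul]
        refine integral_congr_ae (ae_of_all _ fun z => ?_)
        simp only [ENNReal.toReal_ofReal (Real.exp_pos _).le, hmt, Complex.real_smul,
          Complex.ofReal_exp, ← Complex.exp_add]
        congr 1
        push_cast
        rw [Finset.sum_mul, sub_eq_neg_add, add_assoc, ← Finset.sum_add_distrib]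
        congr 1
        refine Finset.sum_congr rfl fun i _ => ?_
        ring

theorem lintegral_stdGaussian_add {d : ℕ} (m : Vec d) {F : Vec d → ℝ≥0∞} (hF : Measurable F) :
    ∫⁻ z, F (z + m) ∂(stdGaussian (Vec d)) =
      ∫⁻ z, ENNReal.ofReal (Real.exp (inner ℝ m z - ‖m‖ ^ 2 / 2)) * F z
        ∂(stdGaussian (Vec d)) := by
  rw [← lintegral_map (f := F) hF (by fun_prop : Measurable fun z => z + m), stdGaussian_map_add,
    lintegral_withDensity_eq_lintegral_mul _ (by fun_prop) hF]
  rfl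

/-- Integrating the Gaussian measure of `N - m` over all `m` gives zero for a Lebesgue-null `N`, so
some translate of the Gaussian measure ignores `N`; Cameron–Martin moves this back to the
untranslated measure. It lets Rademacher's theorem be used almost surely. -/
theorem stdGaussian_absolutelyContinuous (d : ℕ) :
    stdGaussian (Vec d) ≪ (volume : Measure (Vec d)) := by
  have hac : ∀ m : Vec d, (stdGaussian (Vec d)).map (fun z => z + m) ≪ stdGaussian (Vec d) :=
    fun m => by rw [stdGaussian_map_add]; exact withDensity_absolutelyContinuous _ _
  refine Measure.AbsolutelyContinuous.mk fun N hN hN0 => ?_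
  have h0 : ∫⁻ m : Vec d, ∫⁻ z, N.indicator 1 (z + m) ∂(stdGaussian (Vec d)) = 0 := by
    rw [lintegral_lintegral_swap]
    · have : ∀ z : Vec d, ∫⁻ m : Vec d, N.indicator (1 : Vec d → ℝ≥0∞) (z + m) = 0 := fun z => by
        rw [lintegral_add_left_eq_self (fun m => N.indicator (1 : Vec d → ℝ≥0∞) m) z,
          lintegral_indicator_one hN, hN0]
      simp [this]
    · refine Measurable.aemeasurable ?_
      exact (measurable_one.indicator hN).comp (by fun_prop)
  rw [lintegral_eq_zero_iff (Measurable.lintegral_prod_right'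
    (f := fun p : Vec d × Vec d => N.indicator 1 (p.2 + p.1))
    ((measurable_one.indicator hN).comp (by fun_prop)))] at h0
  obtain ⟨m, hm⟩ := h0.exists
  have h1 : stdGaussian (Vec d) ((fun z => z + m) ⁻¹' N) = 0 := by
    have hmeas : Measurable fun z : Vec d => z + m := by fun_prop
    rw [← lintegral_indicator_one (hmeas hN)]
    exact hm
  have h2 := hac (-m) h1
  rw [Measure.map_apply (by fun_prop) ((by fun_prop : Measurable fun z : Vec d => z + m) hN)] at h2
  convert h2 using 2
  ext z
  simp

/-- Rotations of a pair of independent standard Gaussian vectors. -/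
theorem measurePreserving_rotation {d : ℕ} {c s : ℝ} (h : c ^ 2 + s ^ 2 = 1) :
    MeasurePreserving (fun p : Vec d × Vec d => (c • p.1 + s • p.2, -s • p.1 + c • p.2))
      ((stdGaussian (Vec d)).prod (stdGaussian (Vec d)))
      ((stdGaussian (Vec d)).prod (stdGaussian (Vec d))) := by
  obtain ⟨t, ht⟩ : ∃ t : ℝ, c = Real.cos t ∧ s = Real.sin t := by
    obtain ⟨t, ht⟩ : ∃ t : ℝ, Complex.exp (t * Complex.I) = (c : ℂ) + s * Complex.I := by
      have hn : ‖(c : ℂ) + s * Complex.I‖ = 1 := by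
        rw [Complex.norm_add_mul_I, h, Real.sqrt_one]
      exact ⟨Complex.arg ((c : ℂ) + s * Complex.I), by
        have := Complex.norm_mul_exp_arg_mul_I ((c : ℂ) + s * Complex.I)
        rwa [hn, Complex.ofReal_one, one_mul] at this⟩
    refine ⟨t, ?_, ?_⟩
    · have := congrArg Complex.re ht
      simpa [Complex.exp_ofReal_mul_I_re] using this.symm
    · have := congrArg Complex.im ht
      simpa [Complex.exp_ofReal_mul_I_im] using this.symm
  refine ⟨by fun_prop, ?_⟩
  have := IsGaussian.map_rotation_eq_self_of_forall_strongDual_eq_zero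
    (μ := stdGaussian (Vec d)) (fun L => integral_strongDual_stdGaussian L) t
  rw [ht.1, ht.2]
  exact this

theorem measurePreserving_neg_stdGaussian (d : ℕ) :
    MeasurePreserving (fun z : Vec d => -z) (stdGaussian (Vec d)) (stdGaussian (Vec d)) :=
  ⟨by fun_prop, stdGaussian_map (LinearIsometryEquiv.neg ℝ (E := Vec d))⟩

/-- A pair of `c`-correlated standard Gaussian vectors is exchangeable. -/
theorem measurePreserving_reflection {d : ℕ} {c s : ℝ} (h : c ^ 2 + s ^ 2 = 1) :
    MeasurePreserving (fun p : Vec d × Vec d => (c • p.1 + s • p.2, s • p.1 - c • p.2))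
      ((stdGaussian (Vec d)).prod (stdGaussian (Vec d)))
      ((stdGaussian (Vec d)).prod (stdGaussian (Vec d))) := by
  have h1 := ((MeasurePreserving.id (stdGaussian (Vec d))).prod
    (measurePreserving_neg_stdGaussian d)).comp (measurePreserving_rotation (d := d) h)
  convert h1 using 1
  ext p <;> simp [sub_eq_add_neg, add_comm]

/-- The Gaussian tail bound. -/
theorem stdGaussian_tail {d : ℕ} (a : Vec d) {V t : ℝ} (hV : 0 < V) (ha : ‖a‖ ^ 2 ≤ V)
    (ht : 0 ≤ t) : stdGaussian (Vec d) {z | inner ℝ a z ≤ -t} ≤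
      ENNReal.ofReal (Real.exp (-t ^ 2 / (2 * V))) := by
  have hsub : HasSubgaussianMGF (fun z => inner ℝ (-a) z) ⟨V, hV.le⟩ (stdGaussian (Vec d)) := by
    constructor
    · intro u
      have := integrable_exp_inner_stdGaussian (u • (-a))
      simpa only [real_inner_smul_left] using this
    · intro u
      have := integral_exp_inner_stdGaussian (u • (-a))
      simp only [real_inner_smul_left] at this
      rw [mgf, this, norm_smul, norm_neg, mul_pow, Real.norm_eq_abs, sq_abs]
      refine Real.exp_le_exp.2 ?_
      change u ^ 2 * ‖a‖ ^ 2 / 2 ≤ V * u ^ 2 / 2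
      nlinarith [sq_nonneg u]
  have h := hsub.measure_ge_le ht
  have hset : {z : Vec d | inner ℝ a z ≤ -t} = {z | t ≤ inner ℝ (-a) z} := by
    ext z
    simp only [Set.mem_ofPred_eq, inner_neg_left]
    constructor <;> intro h <;> linarith
  rw [hset]
  refine (ENNReal.le_ofReal_iff_toReal_le (measure_ne_top _ _) (Real.exp_pos _).le).2 ?_
  exact h

/-! ### Gaussian concentration -/

theorem sq_lintegral_mul_le {α : Type*} [MeasurableSpace α] (μ : Measure α) {f g : α → ℝ≥0∞}
    (hf : AEMeasurable f μ) (hg : AEMeasurable g μ) :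
    (∫⁻ a, f a * g a ∂μ) ^ 2 ≤ (∫⁻ a, f a ^ 2 ∂μ) * ∫⁻ a, g a ^ 2 ∂μ := by
  have h := ENNReal.lintegral_mul_le_Lp_mul_Lq μ (p := 2) (q := 2)
    ⟨by norm_num, by norm_num, by norm_num⟩ hf hg
  simp only [Pi.mul_apply, ENNReal.rpow_ofNat] at h
  calc _ ≤ ((∫⁻ a, f a ^ 2 ∂μ) ^ (1 / 2 : ℝ) * (∫⁻ a, g a ^ 2 ∂μ) ^ (1 / 2 : ℝ)) ^ 2 :=
        pow_le_pow_left' h 2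
    _ = _ := by
        rw [mul_pow, ← ENNReal.rpow_natCast, ← ENNReal.rpow_natCast, ← ENNReal.rpow_mul,
          ← ENNReal.rpow_mul]
        norm_num

theorem lintegral_const_mul_lintegral_swap {α β : Type*} [MeasurableSpace α] [MeasurableSpace β]
    (μ : Measure α) (ν : Measure β) [SFinite μ] [SFinite ν] (c : ℝ≥0∞) (f : α → β → ℝ≥0∞)
    (hf : Measurable (Function.uncurry f)) :
    ∫⁻ a, (c * ∫⁻ b, f a b ∂ν) ∂μ = c * ∫⁻ b, ∫⁻ a, f a b ∂μ ∂ν := by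
  have h : Measurable fun a => ∫⁻ b, f a b ∂ν := hf.lintegral_prod_right'
  rw [lintegral_const_mul _ h, lintegral_lintegral_swap hf.aemeasurable]

theorem lintegral_sq_dual_stdGaussian {d : ℕ} (L : StrongDual ℝ (Vec d)) :
    ∫⁻ y, ‖L y‖ₑ ^ 2 ∂(stdGaussian (Vec d)) = ENNReal.ofReal (‖L‖ ^ 2) := by
  rw [← variance_dual_stdGaussian L,
    variance_of_integral_eq_zero L.continuous.aemeasurable (integral_strongDual_stdGaussian L),
    ofReal_integral_eq_lintegral_ofReal _ (ae_of_all _ fun _ => sq_nonneg _)]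
  · refine lintegral_congr fun y => ?_
    rw [← ofReal_norm, ← ENNReal.ofReal_pow (norm_nonneg _), Real.norm_eq_abs, sq_abs]
  · have h : MemLp L 2 (stdGaussian (Vec d)) := IsGaussian.memLp_dual _ L 2 (by simp)
    exact h.integrable_sq

/-- The difference of a Lipschitz function at the ends of a quarter circle, in terms of its
derivative along the circle. -/
theorem sq_enorm_sub_le_lintegral_circle {d : ℕ} {H : Vec d → ℝ} (hH : LipschitzWith 1 H)
    (x y : Vec d)
    (hd : ∀ᵐ t : ℝ, DifferentiableAt ℝ H (Real.cos t • x + Real.sin t • y)) :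
    ‖H x - H y‖ₑ ^ 2 ≤ ENNReal.ofReal (Real.pi / 2) * ∫⁻ t in Set.Ioc 0 (Real.pi / 2),
      ‖fderiv ℝ H (Real.cos t • x + Real.sin t • y) (-Real.sin t • x + Real.cos t • y)‖ₑ ^ 2 := by
  set X : ℝ → Vec d := fun t => Real.cos t • x + Real.sin t • y with hX
  have hXd : ∀ t, HasDerivAt X (-Real.sin t • x + Real.cos t • y) t := fun t =>
    ((Real.hasDerivAt_cos t).smul_const x).add ((Real.hasDerivAt_sin t).smul_const y)
  have hXc : ContDiff ℝ 1 X := by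
    rw [hX]; fun_prop
  -- The Lipschitz bound on the compact interval makes `H ∘ X` absolutely continuous, so the
  -- fundamental theorem of calculus holds although `H` is differentiable only at almost every point
  -- of the arc.
  obtain ⟨K, hK⟩ := hXc.contDiffOn.exists_lipschitzOnWith (s := Set.uIcc 0 (Real.pi / 2))
    (by simp) (convex_uIcc _ _) isCompact_uIcc
  have hlip : LipschitzOnWith (1 * K) (H ∘ X) (Set.uIcc 0 (Real.pi / 2)) :=
    hH.comp_lipschitzOnWith hK
  have hftc := hlip.absolutelyContinuousOnInterval.integral_deriv_eq_sub
  have hpi : (0 : ℝ) ≤ Real.pi / 2 := by positivity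
  have hends : H y - H x = ∫ t in Set.Ioc 0 (Real.pi / 2), deriv (H ∘ X) t := by
    rw [← intervalIntegral.integral_of_le hpi, hftc]
    simp [hX]
  have hderiv : ∀ᵐ t : ℝ, deriv (H ∘ X) t = fderiv ℝ H (X t) (-Real.sin t • x + Real.cos t • y) := by
    filter_upwards [hd] with t ht
    exact (ht.hasFDerivAt.comp_hasDerivAt t (hXd t)).deriv
  have h1 : ‖H x - H y‖ₑ ≤ ∫⁻ t in Set.Ioc 0 (Real.pi / 2), ‖deriv (H ∘ X) t‖ₑ := by
    rw [← enorm_neg, neg_sub, hends]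
    exact enorm_integral_le_lintegral_enorm _
  have hm : Measurable fun t => ‖deriv (H ∘ X) t‖ₑ := (measurable_deriv _).enorm
  calc _ ≤ (∫⁻ t in Set.Ioc 0 (Real.pi / 2), 1 * ‖deriv (H ∘ X) t‖ₑ) ^ 2 := by
        simpa using pow_le_pow_left' h1 2
    _ ≤ (∫⁻ t in Set.Ioc 0 (Real.pi / 2), 1 ^ 2) *
          ∫⁻ t in Set.Ioc 0 (Real.pi / 2), ‖deriv (H ∘ X) t‖ₑ ^ 2 :=
        sq_lintegral_mul_le _ aemeasurable_const hm.aemeasurable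
    _ = _ := by
        congr 1
        · simp
        · refine lintegral_congr_ae ?_
          filter_upwards [ae_restrict_of_ae hderiv] with t ht
          rw [ht]

/-- The Maurey–Pisier argument: join two independent Gaussian points by a quarter circle. At each
time position and velocity are again independent standard Gaussians, so the squared derivative has
mean `‖fderiv ℝ H x‖²` averaged over `x`, at most one. Cauchy–Schwarz in time gives `(π/2)²`, with
no dependence on the dimension. -/
theorem lintegral_sq_sub_stdGaussian_le {d : ℕ} {H : Vec d → ℝ} (hH : LipschitzWith 1 H) :
    ∫⁻ p, ‖H p.1 - H p.2‖ₑ ^ 2 ∂((stdGaussian (Vec d)).prod (stdGaussian (Vec d))) ≤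
      ENNReal.ofReal (Real.pi ^ 2 / 4) := by
  set γ := stdGaussian (Vec d)
  set rot : ℝ → Vec d × Vec d → Vec d × Vec d := fun t p =>
    (Real.cos t • p.1 + Real.sin t • p.2, -Real.sin t • p.1 + Real.cos t • p.2) with hrot
  have hrotp : ∀ t, MeasurePreserving (rot t) (γ.prod γ) (γ.prod γ) := fun t =>
    measurePreserving_rotation (Real.cos_sq_add_sin_sq t)
  have hrotm : Measurable fun q : ℝ × (Vec d × Vec d) => rot q.1 q.2 := by
    rw [hrot]; fun_prop
  have hfst : ∀ t p, (rot t p).1 = Real.cos t • p.1 + Real.sin t • p.2 := fun _ _ => rfl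
  have hsnd : ∀ t p, (rot t p).2 = -Real.sin t • p.1 + Real.cos t • p.2 := fun _ _ => rfl
  clear_value rot
  have hdiffm : MeasurableSet {x | DifferentiableAt ℝ H x} := measurableSet_of_differentiableAt ℝ H
  have hdiff : ∀ᵐ x ∂γ, DifferentiableAt ℝ H x :=
    (stdGaussian_absolutelyContinuous d).ae_le hH.ae_differentiableAt
  -- At each fixed time the position is Gaussian, so differentiability holds almost surely; Fubini
  -- exchanges the two quantifiers.
  have hdiff2 : ∀ᵐ p ∂(γ.prod γ), ∀ᵐ t : ℝ, DifferentiableAt ℝ H (rot t p).1 := by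
    have hms : MeasurableSet {q : (Vec d × Vec d) × ℝ | DifferentiableAt ℝ H (rot q.2 q.1).1} :=
      hdiffm.preimage ((hrotm.comp measurable_swap).fst)
    have hms' : MeasurableSet {q : ℝ × (Vec d × Vec d) | DifferentiableAt ℝ H (rot q.1 q.2).1} :=
      hdiffm.preimage hrotm.fst
    refine Measure.ae_ae_of_ae_prod (p := fun q : (Vec d × Vec d) × ℝ =>
      DifferentiableAt ℝ H (rot q.2 q.1).1) (μ := γ.prod γ) (ν := volume) ?_
    rw [Measure.ae_prod_iff_ae_ae hms, ← Measure.ae_ae_comm hms']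
    refine ae_of_all _ fun t => ?_
    have : MeasurePreserving (fun p => (rot t p).1) (γ.prod γ) γ :=
      measurePreserving_fst.comp (hrotp t)
    exact this.quasiMeasurePreserving.ae hdiff
  have hfd : Measurable fun p : Vec d × Vec d => ‖fderiv ℝ H p.1 p.2‖ₑ ^ 2 := by
    have h := measurable_fderiv ℝ H
    have h2 : Measurable fun p : Vec d × Vec d => fderiv ℝ H p.1 p.2 :=
      (isBoundedBilinearMap_apply (𝕜 := ℝ) (E := Vec d) (F := ℝ)).continuous.measurable.comp
        ((h.comp measurable_fst).prodMk measurable_snd)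
    exact h2.enorm.pow_const 2
  have hone : ∫⁻ p, ‖fderiv ℝ H p.1 p.2‖ₑ ^ 2 ∂(γ.prod γ) ≤ 1 := by
    rw [lintegral_prod _ hfd.aemeasurable]
    calc _ ≤ ∫⁻ _, 1 ∂γ := by
          refine lintegral_mono fun x => ?_
          simp only
          rw [lintegral_sq_dual_stdGaussian, ← ENNReal.ofReal_one]
          refine ENNReal.ofReal_le_ofReal ?_
          have : ‖fderiv ℝ H x‖ ≤ 1 := by
            simpa using norm_fderiv_le_of_lipschitz ℝ hH (x₀ := x)
          exact pow_le_one₀ (norm_nonneg _) this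
      _ = 1 := by simp
  calc _ ≤ ∫⁻ p, (ENNReal.ofReal (Real.pi / 2) * ∫⁻ t in Set.Ioc 0 (Real.pi / 2),
        ‖fderiv ℝ H (rot t p).1 (rot t p).2‖ₑ ^ 2) ∂(γ.prod γ) := by
        refine lintegral_mono_ae ?_
        filter_upwards [hdiff2] with p hp
        simp only [hfst, hsnd] at hp ⊢
        exact sq_enorm_sub_le_lintegral_circle hH p.1 p.2 hp
    _ = ENNReal.ofReal (Real.pi / 2) * ∫⁻ t in Set.Ioc 0 (Real.pi / 2), ∫⁻ p,
        ‖fderiv ℝ H (rot t p).1 (rot t p).2‖ₑ ^ 2 ∂(γ.prod γ) := by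
        have hmm : Measurable fun q : (Vec d × Vec d) × ℝ =>
          ‖fderiv ℝ H (rot q.2 q.1).1 (rot q.2 q.1).2‖ₑ ^ 2 :=
          hfd.comp (hrotm.comp measurable_swap)
        exact lintegral_const_mul_lintegral_swap (γ.prod γ)
          (volume.restrict (Set.Ioc 0 (Real.pi / 2))) _
          (fun p t => ‖fderiv ℝ H (rot t p).1 (rot t p).2‖ₑ ^ 2) hmm
    _ ≤ ENNReal.ofReal (Real.pi / 2) * ∫⁻ t in Set.Ioc 0 (Real.pi / 2), 1 := by
        gcongr with t
        rw [(hrotp t).lintegral_comp hfd]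
        exact hone
    _ = _ := by
        simp only [lintegral_const, Measure.restrict_apply_univ, Real.volume_Ioc, one_mul, sub_zero]
        rw [← ENNReal.ofReal_mul (by positivity)]
        congr 1
        ring

/-- Points far from a set of substantial Gaussian measure are rare. -/
theorem stdGaussian_far_le {d : ℕ} {B : Set (Vec d)} (hB : MeasurableSet B)
    {t : ℝ} (ht : 0 ≤ t) :
    ENNReal.ofReal (t ^ 2) * (stdGaussian (Vec d) {x | t ≤ Metric.infDist x B} *
      stdGaussian (Vec d) B) ≤ ENNReal.ofReal (Real.pi ^ 2 / 4) := by
  set γ := stdGaussian (Vec d)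
  have hm : MeasurableSet {x : Vec d | t ≤ Metric.infDist x B} :=
    measurableSet_le measurable_const (Metric.continuous_infDist_pt B).measurable
  -- The distance to `B` is 1-Lipschitz. For two independent points, one far and one in `B`, its
  -- values differ by at least `t`.
  refine le_trans ?_ (lintegral_sq_sub_stdGaussian_le (Metric.lipschitz_infDist_pt B))
  rw [← Measure.prod_prod, ← lintegral_indicator_const (hm.prod hB)]
  refine lintegral_mono fun p => ?_
  by_cases hp : p ∈ {x : Vec d | t ≤ Metric.infDist x B} ×ˢ B
  · rw [Set.indicator_of_mem hp]
    have h1 : t ≤ Metric.infDist p.1 B := hp.1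
    have h2 : Metric.infDist p.2 B = 0 := Metric.infDist_zero_of_mem hp.2
    rw [h2, sub_zero, ← ofReal_norm, ← ENNReal.ofReal_pow (norm_nonneg _)]
    refine ENNReal.ofReal_le_ofReal (pow_le_pow_left₀ ht (h1.trans (le_abs_self _)) 2)
  · rw [Set.indicator_of_notMem hp]
    exact zero_le

/-! ### The noise operator -/

/-- The conditional expectation of `F` at a `ρ`-correlated copy of a given vector. -/
def noiseOp {d : ℕ} (ρ : ℝ) (F : Vec d → ℝ≥0∞) (u : Vec d) : ℝ≥0∞ :=
  ∫⁻ z, F (ρ • u + Real.sqrt (1 - ρ ^ 2) • z) ∂(stdGaussian (Vec d))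

theorem measurable_noiseOp {d : ℕ} (ρ : ℝ) {F : Vec d → ℝ≥0∞} (hF : Measurable F) :
    Measurable (noiseOp ρ F) := by
  have h : Measurable fun p : Vec d × Vec d => F (ρ • p.1 + Real.sqrt (1 - ρ ^ 2) • p.2) :=
    hF.comp (by fun_prop)
  exact h.lintegral_prod_right'

/-- Correlated pairs are exchangeable. -/
theorem lintegral_mul_noiseOp {d : ℕ} {ρ : ℝ} (hρ : ρ ^ 2 ≤ 1) {F : Vec d → ℝ≥0∞}
    {φ : Vec d → ℝ≥0∞} (hF : Measurable F) (hφ : Measurable φ) :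
    ∫⁻ u, φ u * noiseOp ρ F u ∂(stdGaussian (Vec d)) =
      ∫⁻ u, F u * noiseOp ρ φ u ∂(stdGaussian (Vec d)) := by
  set s := Real.sqrt (1 - ρ ^ 2) with hs
  have hs2 : ρ ^ 2 + s ^ 2 = 1 := by rw [hs, Real.sq_sqrt (by linarith)]; ring
  have key : ∀ φ F : Vec d → ℝ≥0∞, Measurable φ → Measurable F →
      ∫⁻ u, φ u * noiseOp ρ F u ∂(stdGaussian (Vec d)) =
      ∫⁻ p, φ p.1 * F (ρ • p.1 + s • p.2) ∂((stdGaussian (Vec d)).prod (stdGaussian (Vec d))) := by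
    intro φ F hφ hF
    have hm : Measurable fun p : Vec d × Vec d => F (ρ • p.1 + s • p.2) := hF.comp (by fun_prop)
    have hm' : Measurable fun p : Vec d × Vec d => φ p.1 * F (ρ • p.1 + s • p.2) :=
      (hφ.comp measurable_fst).mul hm
    rw [lintegral_prod _ hm'.aemeasurable]
    refine lintegral_congr fun u => ?_
    simp only
    have hmu : Measurable fun z => F (ρ • u + s • z) := hF.comp (by fun_prop)
    rw [lintegral_const_mul _ hmu]
    rfl
  have hm : Measurable fun p : Vec d × Vec d => φ p.1 * F (ρ • p.1 + s • p.2) :=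
    (hφ.comp measurable_fst).mul (hF.comp (by fun_prop))
  -- The reflection is an involution which exchanges `u` with its correlated copy `ρ u + s z`.
  rw [key φ F hφ hF, key F φ hF hφ, ← (measurePreserving_reflection hs2).lintegral_comp hm]
  refine lintegral_congr fun p => ?_
  have : ρ • (ρ • p.1 + s • p.2) + s • (s • p.1 - ρ • p.2) = p.1 := by
    have : ρ • (ρ • p.1 + s • p.2) + s • (s • p.1 - ρ • p.2) = (ρ ^ 2 + s ^ 2) • p.1 := by
      module
    rw [this, hs2, one_smul]
  simp only [this, mul_comm]

theorem noiseOp_const {d : ℕ} (ρ : ℝ) (c : ℝ≥0∞) (u : Vec d) : noiseOp ρ (fun _ => c) u = c := by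
  simp [noiseOp]

theorem noiseOp_mono {d : ℕ} {ρ : ℝ} {F G : Vec d → ℝ≥0∞} (h : ∀ u, F u ≤ G u) (u : Vec d) :
    noiseOp ρ F u ≤ noiseOp ρ G u :=
  lintegral_mono fun _ => h _

theorem noiseOp_sum {d : ℕ} {ι : Type*} (s : Finset ι) {ρ : ℝ} {F : ι → Vec d → ℝ≥0∞}
    (h : ∀ i ∈ s, Measurable (F i)) (u : Vec d) :
    noiseOp ρ (fun z => ∑ i ∈ s, F i z) u = ∑ i ∈ s, noiseOp ρ (F i) u :=
  lintegral_finsetSum' s fun i hi => ((h i hi).comp (by fun_prop)).aemeasurable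

theorem noiseOp_const_mul {d : ℕ} {ρ : ℝ} {F : Vec d → ℝ≥0∞} (c : ℝ≥0∞)
    (h : Measurable F) (u : Vec d) :
    noiseOp ρ (fun z => c * F z) u = c * noiseOp ρ F u :=
  lintegral_const_mul _ (h.comp (by fun_prop))

theorem lintegral_noiseOp {d : ℕ} {ρ : ℝ} (hρ : ρ ^ 2 ≤ 1) {F : Vec d → ℝ≥0∞}
    (hF : Measurable F) :
    ∫⁻ u, noiseOp ρ F u ∂(stdGaussian (Vec d)) = ∫⁻ u, F u ∂(stdGaussian (Vec d)) := by
  have := lintegral_mul_noiseOp hρ hF (φ := fun _ => 1) measurable_const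
  simpa [noiseOp_const] using this

/-- A dimension-free Harnack inequality. -/
theorem sq_noiseOp_le {d : ℕ} {ρ : ℝ} (hρ : ρ ^ 2 < 1) {F : Vec d → ℝ≥0∞} (hF : Measurable F)
    (hF1 : ∀ u, F u ≤ 1) (a u : Vec d) :
    noiseOp ρ F a ^ 2 ≤
      ENNReal.ofReal (Real.exp (ρ ^ 2 / (1 - ρ ^ 2) * dist u a ^ 2)) * noiseOp ρ F u := by
  set s := Real.sqrt (1 - ρ ^ 2) with hs
  have hs0 : 0 < s := Real.sqrt_pos.2 (by linarith)
  have hs2 : s ^ 2 = 1 - ρ ^ 2 := Real.sq_sqrt (by linarith)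
  -- Translating the noise by `m` moves the centre of the average from `u` to `a`.
  set m : Vec d := (ρ / s) • (a - u) with hm
  set G : Vec d → ℝ≥0∞ := fun z => F (ρ • u + s • z) with hG
  have hGm : Measurable G := hF.comp (by fun_prop)
  have h1 : noiseOp ρ F a = ∫⁻ z, G (z + m) ∂(stdGaussian (Vec d)) := by
    refine lintegral_congr fun z => ?_
    simp only [hG, hm]
    congr 1
    rw [smul_add, smul_smul, mul_div_cancel₀ _ hs0.ne']
    module
  have hmn : ‖m‖ ^ 2 = ρ ^ 2 / (1 - ρ ^ 2) * dist u a ^ 2 := by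
    rw [hm, norm_smul, mul_pow, Real.norm_eq_abs, sq_abs, div_pow, hs2, dist_comm, dist_eq_norm]
  clear_value m
  rw [h1, lintegral_stdGaussian_add m hGm]
  -- Cauchy–Schwarz separates the Cameron–Martin density, whose second moment is `exp (‖m‖²)`, from
  -- `F`, whose square is at most `F`.
  refine (sq_lintegral_mul_le _ (by fun_prop) hGm.aemeasurable).trans ?_
  gcongr ?_ * ?_
  · refine le_of_eq ?_
    calc _ = ∫⁻ z, ENNReal.ofReal (Real.exp (-‖m‖ ^ 2)) *
          ENNReal.ofReal (Real.exp (inner ℝ ((2 : ℝ) • m) z)) ∂(stdGaussian (Vec d)) := by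
          refine lintegral_congr fun z => ?_
          rw [← ENNReal.ofReal_pow (Real.exp_pos _).le, ← ENNReal.ofReal_mul (Real.exp_pos _).le,
            ← Real.exp_add, ← Real.exp_nat_mul, real_inner_smul_left]
          congr 2
          push_cast
          ring
      _ = _ := by
          rw [lintegral_const_mul _ (by fun_prop), lintegral_exp_inner_stdGaussian,
            ← ENNReal.ofReal_mul (Real.exp_pos _).le, ← Real.exp_add, ← hmn, norm_smul]
          congr 2
          rw [Real.norm_ofNat]
          ring
  · refine lintegral_mono fun z => ?_
    simp only [hG]
    exact pow_le_of_le_one (zero_le) (hF1 _) two_ne_zero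

/-- Noise turns a function with substantial mean into one which is rarely tiny. -/
theorem exists_noiseOp_lower_bound {θ ε : ℝ} (hθ : 0 < θ) (hε : 0 < ε) :
    ∃ C : ℝ, 0 < C ∧ ∀ (d : ℕ) (R ρ : ℝ), 1 ≤ R → ρ ^ 2 < 1 → ρ ^ 2 ≤ R * (1 - ρ ^ 2) →
      ∀ F : Vec d → ℝ≥0∞, Measurable F → (∀ u, F u ≤ 1) →
        ENNReal.ofReal θ ≤ ∫⁻ u, F u ∂(stdGaussian (Vec d)) →
        stdGaussian (Vec d) {u | noiseOp ρ F u < ENNReal.ofReal (Real.exp (-(C * R)))} ≤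
          ENNReal.ofReal ε := by
  -- Chosen so that `t² * (θ/2) * ε = π²/4`: all but `ε` of the space lies within `t` of a set of
  -- measure `θ/2`.
  set t : ℝ := Real.sqrt (Real.pi ^ 2 / (2 * θ * ε)) with ht
  have ht2 : t ^ 2 = Real.pi ^ 2 / (2 * θ * ε) := Real.sq_sqrt (by positivity)
  have htpos : 0 < t := Real.sqrt_pos.2 (by positivity)
  -- The term `t ^ 2` pays for the Harnack factor over distance `t`, and the logarithm pays for the
  -- value `(θ/2)²`.
  refine ⟨t ^ 2 + |2 * Real.log (θ / 2)| , by positivity, fun d R ρ hR hρ hρR F hF hF1 hFθ => ?_⟩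
  set γ := stdGaussian (Vec d)
  have hGm := measurable_noiseOp ρ hF
  set B : Set (Vec d) := {u | ENNReal.ofReal (θ / 2) ≤ noiseOp ρ F u} with hB
  have hBm : MeasurableSet B := measurableSet_le measurable_const hGm
  have hG1 : ∀ u, noiseOp ρ F u ≤ 1 := fun u =>
    (noiseOp_mono hF1 u).trans_eq (noiseOp_const ρ 1 u)
  -- The smoothed function has mean at least `θ` and is at most one, so it exceeds half its mean on
  -- a set of measure at least `θ/2`.
  have hBθ : ENNReal.ofReal (θ / 2) ≤ γ B := by
    rw [← lintegral_noiseOp hρ.le hF] at hFθ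
    have h1 : ∫⁻ u, noiseOp ρ F u ∂γ ≤ γ B + ENNReal.ofReal (θ / 2) := by
      calc _ ≤ ∫⁻ u, (B.indicator 1 u + ENNReal.ofReal (θ / 2)) ∂γ := by
            refine lintegral_mono fun u => ?_
            by_cases hu : u ∈ B
            · simp only [Set.indicator_of_mem hu, Pi.one_apply]
              exact (hG1 u).trans le_self_add
            · simp only [Set.indicator_of_notMem hu, zero_add]
              exact (not_le.1 hu).le
        _ = _ := by
            rw [lintegral_add_right _ measurable_const, lintegral_indicator_one hBm]
            simp
    have h2 : ENNReal.ofReal (θ / 2) + ENNReal.ofReal (θ / 2) ≤ γ B + ENNReal.ofReal (θ / 2) := by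
      rw [← ENNReal.ofReal_add (by positivity) (by positivity), add_halves]
      exact hFθ.trans h1
    exact (ENNReal.add_le_add_iff_right ENNReal.ofReal_ne_top).1 h2
  have hBne : B.Nonempty := by
    by_contra h
    rw [Set.not_nonempty_iff_eq_empty.1 h, measure_empty] at hBθ
    simp only [nonpos_iff_eq_zero, ENNReal.ofReal_eq_zero] at hBθ
    linarith
  have hfar := stdGaussian_far_le hBm htpos.le
  have hfar2 : γ {x | t ≤ Metric.infDist x B} ≤ ENNReal.ofReal ε := by
    have h1 : ENNReal.ofReal (t ^ 2 * (θ / 2)) * γ {x | t ≤ Metric.infDist x B} ≤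
        ENNReal.ofReal (t ^ 2 * (θ / 2)) * ENNReal.ofReal ε := by
      rw [← ENNReal.ofReal_mul (by positivity)]
      have : t ^ 2 * (θ / 2) * ε = Real.pi ^ 2 / 4 := by rw [ht2]; field_simp; ring
      rw [this]
      refine le_trans ?_ hfar
      rw [ENNReal.ofReal_mul (by positivity), mul_assoc, mul_comm (ENNReal.ofReal (θ / 2))]
      gcongr
    refine (ENNReal.mul_le_mul_iff_right ?_ ENNReal.ofReal_ne_top).1 h1
    rw [Ne, ENNReal.ofReal_eq_zero, not_le]
    positivity
  refine (measure_mono fun u hu => ?_).trans hfar2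
  by_contra hut
  obtain ⟨a, haB, hau⟩ := (Metric.infDist_lt_iff hBne).1 (not_le.1 hut)
  have h1 := sq_noiseOp_le hρ hF hF1 a u
  have h2 : ENNReal.ofReal ((θ / 2) ^ 2) ≤ ENNReal.ofReal (Real.exp (R * t ^ 2)) *
      noiseOp ρ F u := by
    refine le_trans ?_ (h1.trans ?_)
    · rw [ENNReal.ofReal_pow (by positivity)]
      exact pow_le_pow_left' haB 2
    · gcongr
      rw [div_le_iff₀ (by linarith)]
      exact hρR
  have h3 : ENNReal.ofReal (Real.exp (R * t ^ 2)) * noiseOp ρ F u <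
      ENNReal.ofReal (Real.exp (R * t ^ 2)) *
        ENNReal.ofReal (Real.exp (-((t ^ 2 + |2 * Real.log (θ / 2)|) * R))) :=
    (ENNReal.mul_lt_mul_iff_right (by simp [Real.exp_pos]) ENNReal.ofReal_ne_top).2 hu
  rw [← ENNReal.ofReal_mul (Real.exp_pos _).le, ← Real.exp_add] at h3
  have h4 := (ENNReal.ofReal_lt_ofReal_iff (Real.exp_pos _)).1 (h2.trans_lt h3)
  have h5 : (θ / 2) ^ 2 = Real.exp (2 * Real.log (θ / 2)) := by
    rw [two_mul, Real.exp_add, Real.exp_log (by positivity), sq]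
  rw [h5, Real.exp_lt_exp] at h4
  have h6 := neg_abs_le (2 * Real.log (θ / 2))
  nlinarith [abs_nonneg (2 * Real.log (θ / 2))]

/-! ### Edge probabilities and chain weights -/

section Weights

variable {n d : ℕ}

/-- The indicator of the event that `(x, y)` is an edge. -/
def edgeInd (M : Vec d → Set (Fin n × Fin n)) (x y : Fin n) : Vec d → ℝ≥0∞ :=
  Set.indicator {u | (x, y) ∈ M u} 1

/-- The probability that `(x, y)` is an edge. -/
def edgeProb (M : Vec d → Set (Fin n × Fin n)) (x y : Fin n) : ℝ≥0∞ :=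
  stdGaussian (Vec d) {u | (x, y) ∈ M u}

/-- The probability that `(x, y)` is an edge of the chained graph, given that the last correlated
vector is `u`. The word lists the kinds of the vectors, the last one first: `true` stands for a
`ρ`-correlated copy of the previous correlated vector, `false` for an independent vector. -/
def chainWeight (M : Vec d → Set (Fin n × Fin n)) (ρ : ℝ) :
    List Bool → Fin n → Fin n → Vec d → ℝ≥0∞
  | [], x, y, _ => if x = y then 1 else 0
  | true :: s, x, y, u => ∑ z, edgeInd M z y u * noiseOp ρ (chainWeight M ρ s x z) u
  | false :: s, x, y, u => ∑ z, edgeProb M z y * chainWeight M ρ s x z u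

variable {M : Vec d → Set (Fin n × Fin n)} {v : Fin n → Vec d} {σ δ : ℝ}

theorem edgeInd_of_mem {x y : Fin n} {u : Vec d} (h : (x, y) ∈ M u) : edgeInd M x y u = 1 :=
  Set.indicator_of_mem (s := {u | (x, y) ∈ M u}) h 1

theorem edgeInd_of_notMem {x y : Fin n} {u : Vec d} (h : (x, y) ∉ M u) : edgeInd M x y u = 0 :=
  Set.indicator_of_notMem (s := {u | (x, y) ∈ M u}) h 1

theorem measurable_edgeInd (hM : ∀ x y, MeasurableSet {u | (x, y) ∈ M u}) (x y : Fin n) :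
    Measurable (edgeInd M x y) :=
  measurable_one.indicator (hM x y)

theorem measurable_chainWeight (hM : ∀ x y, MeasurableSet {u | (x, y) ∈ M u}) (ρ : ℝ)
    (s : List Bool) (x y : Fin n) : Measurable (chainWeight M ρ s x y) := by
  induction s generalizing x y with
  | nil => exact measurable_const
  | cons b s ih =>
    cases b
    · exact Finset.measurable_sum _ fun z _ => (ih x z).const_mul _
    · exact Finset.measurable_sum _ fun z _ =>
        (measurable_edgeInd hM z y).mul (measurable_noiseOp ρ (ih x z))

theorem lintegral_edgeInd (hM : ∀ x y, MeasurableSet {u | (x, y) ∈ M u}) (x y : Fin n) :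
    ∫⁻ u, edgeInd M x y u ∂(stdGaussian (Vec d)) = edgeProb M x y :=
  lintegral_indicator_one (hM x y)

theorem edgeProb_ne_top (x y : Fin n) : edgeProb M x y ≠ ∞ := measure_ne_top _ _

theorem matching_left_unique {E : Set (Fin n × Fin n)} (h : IsDirectedMatching E)
    {x x' y : Fin n} (h1 : (x, y) ∈ E) (h2 : (x', y) ∈ E) : x = x' := by
  by_contra hne
  exact (h.2 _ h1 _ h2 (by simpa using hne)).2.2.2 rfl

theorem matching_right_unique {E : Set (Fin n × Fin n)} (h : IsDirectedMatching E)
    {x y y' : Fin n} (h1 : (x, y) ∈ E) (h2 : (x, y') ∈ E) : y = y' := by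
  by_contra hne
  exact (h.2 _ h1 _ h2 (by simpa using hne)).1 rfl

/-- A matching has at most one edge into `y`, so at most one term survives. -/
theorem sum_edgeInd_mul_le (hM : ∀ u, IsDirectedMatching (M u)) (y : Fin n) (u : Vec d)
    (s : Finset (Fin n)) (g : Fin n → ℝ≥0∞) {c : ℝ≥0∞} (hg : ∀ z ∈ s, (z, y) ∈ M u → g z ≤ c) :
    ∑ z ∈ s, edgeInd M z y u * g z ≤ c := by
  by_cases h : ∃ z ∈ s, (z, y) ∈ M u
  · obtain ⟨z, hz, hzy⟩ := h
    rw [Finset.sum_eq_single_of_mem z hz, edgeInd_of_mem hzy, one_mul]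
    · exact hg z hz hzy
    · intro z' _ hne
      rw [edgeInd_of_notMem fun h' => hne (matching_left_unique (hM u) h' hzy), zero_mul]
  · push Not at h
    rw [Finset.sum_eq_zero fun z hz => by rw [edgeInd_of_notMem (h z hz), zero_mul]]
    exact zero_le

/-- Skew-symmetry of the cover combined with the symmetry of the Gaussian measure. -/
theorem IsMatchingCover.edgeProb_comm (h : IsMatchingCover σ δ v M) (x y : Fin n) :
    edgeProb M x y = edgeProb M y x := by
  have h1 := (measurePreserving_neg_stdGaussian d).measure_preimage
    (h.measurable y x).nullMeasurableSet
  rw [edgeProb, edgeProb, ← h1]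
  congr 1
  ext u
  exact h.skew u x y

theorem IsMatchingCover.sum_edgeProb_left_le (h : IsMatchingCover σ δ v M) (y : Fin n)
    (s : Finset (Fin n)) : ∑ x ∈ s, edgeProb M x y ≤ 1 := by
  simp only [← lintegral_edgeInd h.measurable]
  rw [← lintegral_finsetSum _ fun x _ => measurable_edgeInd h.measurable x y]
  calc _ ≤ ∫⁻ _, 1 ∂(stdGaussian (Vec d)) := by
        refine lintegral_mono fun u => ?_
        simpa using sum_edgeInd_mul_le h.matching y u s (fun _ => 1) (c := 1) (by simp)
    _ = 1 := by simp

theorem IsMatchingCover.sum_edgeProb_right_le (h : IsMatchingCover σ δ v M) (x : Fin n)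
    (s : Finset (Fin n)) : ∑ y ∈ s, edgeProb M x y ≤ 1 := by
  simp only [h.edgeProb_comm x]
  exact h.sum_edgeProb_left_le x s

theorem edgeProb_self (hM : ∀ u, IsDirectedMatching (M u)) (x : Fin n) : edgeProb M x x = 0 := by
  have : {u | (x, x) ∈ M u} = ∅ := by
    ext u
    simp only [Set.mem_ofPred_eq, Set.mem_empty_iff_false, iff_false]
    exact fun h => (hM u).1 _ h rfl
  rw [edgeProb, this, measure_empty]

open Classical in
theorem ncard_eq_sum_ite {α : Type*} [Fintype α] (E : Set α) :
    (E.ncard : ℝ) = ∑ p, if p ∈ E then 1 else 0 := by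
  rw [Set.ncard_eq_toFinset_card', Finset.sum_boole]
  congr 2
  ext p
  simp

/-- The edge probabilities add up to the expected size of the matching. -/
theorem IsMatchingCover.le_sum_edgeProb (h : IsMatchingCover σ δ v M) :
    δ * n ≤ ∑ x, ∑ y, (edgeProb M x y).toReal := by
  classical
  refine h.large.trans (le_of_eq ?_)
  have h1 : ∀ u, ((M u).ncard : ℝ) = ∑ x, ∑ y, (edgeInd M x y u).toReal := by
    intro u
    rw [← Fintype.sum_prod_type', ncard_eq_sum_ite]
    refine Finset.sum_congr rfl fun p _ => ?_
    split_ifs with hp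
    · rw [edgeInd_of_mem hp, ENNReal.toReal_one]
    · rw [edgeInd_of_notMem hp, ENNReal.toReal_zero]
  have hint : ∀ x y, Integrable (fun u => (edgeInd M x y u).toReal) (stdGaussian (Vec d)) :=
    fun x y => integrable_toReal_of_lintegral_ne_top
      (measurable_edgeInd h.measurable x y).aemeasurable
      (by rw [lintegral_edgeInd h.measurable]; exact edgeProb_ne_top x y)
  simp only [h1]
  rw [integral_finsetSum _ fun x _ => integrable_finsetSum _ fun y _ => hint x y]
  refine Finset.sum_congr rfl fun x _ => ?_
  rw [integral_finsetSum _ fun y _ => hint x y]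
  refine Finset.sum_congr rfl fun y _ => ?_
  rw [integral_toReal (measurable_edgeInd h.measurable x y).aemeasurable,
    lintegral_edgeInd h.measurable]
  refine ae_of_all _ fun u => ?_
  by_cases hu : (x, y) ∈ M u
  · rw [edgeInd_of_mem hu]; exact ENNReal.one_lt_top
  · rw [edgeInd_of_notMem hu]; exact ENNReal.zero_lt_top

/-! ### Spreading a set of vertices by independent steps -/

/-- Every vertex of `T` is reached from `S` by `j` independent steps with weight `h₀ ^ j`. -/
def Spread (M : Vec d → Set (Fin n × Fin n)) (ρ : ℝ) (S : Finset (Fin n)) (h₀ : ℝ≥0∞) (j : ℕ)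
    (T : Finset (Fin n)) : Prop :=
  ∃ c : Fin n → Fin n → ℝ≥0∞, (∀ y ∈ T, ∑ z ∈ S, c y z = h₀ ^ j) ∧
    ∀ s x u, ∀ y ∈ T, ∑ z ∈ S, c y z * chainWeight M ρ s x z u ≤
      chainWeight M ρ (List.replicate j false ++ s) x y u

theorem Spread.refl (ρ : ℝ) (S : Finset (Fin n)) (h₀ : ℝ≥0∞) : Spread M ρ S h₀ 0 S := by
  refine ⟨fun y z => if y = z then 1 else 0, fun y hy => ?_, fun s x u y hy => ?_⟩ <;>
    simp [hy]

/-- The edge probabilities into `y` are scaled by `h₀ / H y ≤ 1`, which discards any excess. The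
coefficients then sum to exactly `h₀ ^ (j + 1)`, so that upper and lower bounds on chain weights are
rescaled by the same factor. -/
theorem Spread.succ {ρ : ℝ} {S T T' : Finset (Fin n)} {h₀ : ℝ≥0∞} {j : ℕ} (h0 : h₀ ≠ 0)
    (h : Spread M ρ S h₀ j T) (hsum : ∀ y, ∑ z ∈ T, edgeProb M z y ≤ 1)
    (hT' : ∀ y ∈ T', h₀ ≤ ∑ z ∈ T, edgeProb M z y) : Spread M ρ S h₀ (j + 1) T' := by
  obtain ⟨c, hc, hcs⟩ := h
  set H : Fin n → ℝ≥0∞ := fun y => ∑ z ∈ T, edgeProb M z y with hH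
  have hHt : ∀ y, H y ≠ ∞ := fun y => ((hsum y).trans_lt ENNReal.one_lt_top).ne
  have hH0 : ∀ y ∈ T', H y ≠ 0 := fun y hy h' => h0 (by
    have := (hT' y hy).trans_eq h'
    simpa using this)
  refine ⟨fun y z => h₀ / H y * ∑ w ∈ T, edgeProb M w y * c w z, fun y hy => ?_,
    fun s x u y hy => ?_⟩
  · rw [← Finset.mul_sum, Finset.sum_comm]
    have : ∑ w ∈ T, ∑ z ∈ S, edgeProb M w y * c w z = H y * h₀ ^ j := by
      rw [hH, Finset.sum_mul]
      refine Finset.sum_congr rfl fun w hw => ?_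
      rw [← Finset.mul_sum, hc w hw]
    rw [this, ← mul_assoc, ENNReal.div_mul_cancel (hH0 y hy) (hHt y), pow_succ']
  · calc _ = h₀ / H y * ∑ w ∈ T, edgeProb M w y * ∑ z ∈ S, c w z * chainWeight M ρ s x z u := by
          simp only [mul_assoc, ← Finset.mul_sum, Finset.sum_mul]
          rw [Finset.sum_comm]
          simp only [← Finset.mul_sum]
      _ ≤ 1 * ∑ w ∈ T, edgeProb M w y *
            chainWeight M ρ (List.replicate j false ++ s) x w u := by
          gcongr with w hw
          · exact ENNReal.div_le_of_le_mul (by simpa using hT' y hy)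
          · exact hcs s x u w hw
      _ ≤ ∑ w, edgeProb M w y * chainWeight M ρ (List.replicate j false ++ s) x w u := by
          rw [one_mul]
          exact Finset.sum_le_sum_of_subset (Finset.subset_univ _)
      _ = _ := by rw [List.replicate_succ]; rfl

/-- Either many vertices are well covered by `T`, or many more vertices are slightly covered. -/
theorem card_covered_or_card_reached {V T : Finset (Fin n)} {p : Fin n → Fin n → ℝ}
    {η β θ h₀ : ℝ} (hp : ∀ x y, 0 ≤ p x y) (hp1 : ∀ y, ∑ z ∈ T, p z y ≤ 1)
    (hη : ∀ z ∈ T, η ≤ ∑ y ∈ V, p z y) (hη0 : 0 ≤ η) (hθ : 0 < θ) (hβη : 8 * β ≤ η)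
    (hθη : 8 * θ ≤ η * β) (hh : h₀ * V.card ≤ η / 4 * T.card) (hh0 : 0 ≤ h₀) :
    2 * β * T.card ≤ (V.filter fun y => 4 * θ ≤ ∑ z ∈ T, p z y).card ∨
      (T.card : ℝ) ≤ β * (V.filter fun y => h₀ ≤ ∑ z ∈ T, p z y).card := by
  by_contra hcon
  push Not at hcon
  obtain ⟨h1, h2⟩ := hcon
  set H : Fin n → ℝ := fun y => ∑ z ∈ T, p z y with hH
  set A := V.filter fun y => 4 * θ ≤ H y
  set B := V.filter fun y => h₀ ≤ H y
  have hH0 : ∀ y, 0 ≤ H y := fun y => Finset.sum_nonneg fun z _ => hp z y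
  have hsum : η * T.card ≤ ∑ y ∈ V, H y := by
    rw [hH, Finset.sum_comm, mul_comm, ← nsmul_eq_mul]
    exact Finset.card_nsmul_le_sum _ _ _ hη
  -- Use `H ≤ 1` on `A`, `H < 4θ` on `B` outside `A`, and `H < h₀` elsewhere. If both alternatives
  -- fail, the three terms are below `η/4`, `η/2` and `η/4` times `T.card` in turn (the last one
  -- weakly), less in all than the total mass leaving `T`.
  have hbound : ∑ y ∈ V, H y ≤ A.card + 4 * θ * B.card + h₀ * V.card := by
    have hA : (A.card : ℝ) = ∑ y ∈ V, if 4 * θ ≤ H y then (1 : ℝ) else 0 := by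
      simp [A]
    have hB : (B.card : ℝ) = ∑ y ∈ V, if h₀ ≤ H y then (1 : ℝ) else 0 := by
      simp [B]
    have hV : (V.card : ℝ) = ∑ y ∈ V, (1 : ℝ) := by simp
    rw [hA, hB, hV, Finset.mul_sum, Finset.mul_sum, ← Finset.sum_add_distrib,
      ← Finset.sum_add_distrib]
    refine Finset.sum_le_sum fun y _ => ?_
    have := hp1 y
    split_ifs with ha hb hb
    · change H y ≤ _; have : H y ≤ 1 := hp1 y; nlinarith
    · change H y ≤ _; have : H y ≤ 1 := hp1 y; nlinarith
    · nlinarith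
    · nlinarith
  have hT : (0 : ℝ) ≤ T.card := Nat.cast_nonneg _
  have hB0 : (0 : ℝ) ≤ B.card := Nat.cast_nonneg _
  have h3 : 4 * θ * B.card ≤ η / 2 * T.card := by
    have : 8 * θ * B.card ≤ η * β * B.card := by gcongr
    nlinarith
  nlinarith

/-- After a suitable number of independent steps, many vertices are well covered. -/
theorem exists_spread_card_le {ρ : ℝ} {V S : Finset (Fin n)} {η β θ : ℝ} {h₀ : NNReal}
    (hsum : ∀ y (T : Finset (Fin n)), ∑ z ∈ T, edgeProb M z y ≤ 1)
    (hη : ∀ z ∈ V, η ≤ ∑ y ∈ V, (edgeProb M z y).toReal) (hη0 : 0 ≤ η) (hβ : 0 < β)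
    (hβ1 : β < 1) (hθ : 0 < θ) (hβη : 8 * β ≤ η) (hθη : 8 * θ ≤ η * β)
    (hh : h₀ * V.card ≤ η / 4 * S.card) (hh0 : 0 < h₀) (hSV : S ⊆ V) (hS : S.Nonempty) :
    ∃ j T, T ⊆ V ∧ Spread M ρ S h₀ j T ∧ (S.card : ℝ) ≤ β ^ j * T.card ∧
      2 * β * T.card ≤
        (V.filter fun y => 4 * θ ≤ ∑ z ∈ T, (edgeProb M z y).toReal).card := by
  by_contra hcon
  push Not at hcon
  -- If no set reached ended the process, each step would multiply the size by `1/β`, which cannot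
  -- continue inside `V`.
  have key : ∀ j, ∃ T ⊆ V, Spread M ρ S h₀ j T ∧ (S.card : ℝ) ≤ β ^ j * T.card := by
    intro j
    induction j with
    | zero => exact ⟨S, hSV, Spread.refl ρ S _, by simp⟩
    | succ j ih =>
      obtain ⟨T, hTV, hT, hcard⟩ := ih
      have hST : (S.card : ℝ) ≤ T.card :=
        hcard.trans (mul_le_of_le_one_left (Nat.cast_nonneg _) (pow_le_one₀ hβ.le hβ1.le))
      have hreal : ∀ y, (∑ z ∈ T, edgeProb M z y).toReal = ∑ z ∈ T, (edgeProb M z y).toReal :=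
        fun y => ENNReal.toReal_sum fun z _ => edgeProb_ne_top z y
      have h1 := card_covered_or_card_reached (V := V) (T := T)
        (p := fun x y => (edgeProb M x y).toReal) (η := η) (β := β) (θ := θ) (h₀ := h₀)
        (fun _ _ => ENNReal.toReal_nonneg)
        (fun y => by
          rw [← hreal]; exact ENNReal.toReal_le_of_le_ofReal zero_le_one (by simpa using hsum y T))
        (fun z hz => hη z (hTV hz)) hη0 hθ hβη hθη
        (hh.trans (by gcongr)) h₀.2
      rcases h1 with h1 | h1
      · exact absurd h1 (not_le.2 (hcon j T hTV hT hcard))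
      · refine ⟨_, Finset.filter_subset _ _, hT.succ (T' := V.filter fun y =>
          (h₀ : ℝ) ≤ ∑ z ∈ T, (edgeProb M z y).toReal) (by simpa using hh0.ne')
          (fun y => hsum y T) fun y hy => ?_, ?_⟩
        · have := (Finset.mem_filter.1 hy).2
          rw [← hreal] at this
          have h2 := ENNReal.ofReal_le_of_le_toReal this
          simpa using h2
        · calc (S.card : ℝ) ≤ β ^ j * T.card := hcard
            _ ≤ β ^ j * (β * _) := by gcongr
            _ = _ := by rw [pow_succ, mul_assoc]
  obtain ⟨j, hj⟩ := exists_pow_lt_of_lt_one (y := β) (x := (1 : ℝ) / (V.card + 1))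
    (by positivity) hβ1
  obtain ⟨T, hTV, -, hcard⟩ := key j
  have h1 : (1 : ℝ) ≤ S.card := by exact_mod_cast hS.card_pos
  have h2 : (T.card : ℝ) ≤ V.card := by exact_mod_cast Finset.card_le_card hTV
  have h3 : β ^ j * (V.card + 1) < 1 := by
    rwa [lt_div_iff₀ (by positivity)] at hj
  have h4 : 0 ≤ β ^ j := by positivity
  nlinarith

end Weights

/-! ### Extending a family of short, stretched chains -/

section Chains

variable {n d : ℕ} {M : Vec d → Set (Fin n × Fin n)} {v : Fin n → Vec d} {σ δ ρ L τ : ℝ}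
  {θ lam : ℝ≥0∞} {s : List Bool} {S T V : Finset (Fin n)}

/-- Each vertex of `S` is, with substantial probability over the last correlated vector, the end
of short chains of weight `lam` which have stretch `τ` along that vector. -/
def ChainState (M : Vec d → Set (Fin n × Fin n)) (v : Fin n → Vec d) (ρ L : ℝ) (θ : ℝ≥0∞)
    (s : List Bool) (S : Finset (Fin n)) (lam : ℝ≥0∞) (τ : ℝ) : Prop :=
  ∃ f : Fin n → Fin n → Vec d → ℝ≥0∞, (∀ x y, Measurable (f x y)) ∧
    (∀ x y u, f x y u ≤ chainWeight M ρ s x y u) ∧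
    (∀ x, ∀ y ∈ S, ∀ u, f x y u ≠ 0 → ‖v y - v x‖ ^ 2 < L ∧ τ ≤ inner ℝ (v y - v x) u) ∧
    (∀ y ∈ S, ∀ u, ∑ x, f x y u ≤ lam) ∧
    ∀ y ∈ S, θ * lam ≤ ∫⁻ u, ∑ x, f x y u ∂(stdGaussian (Vec d))

/-- The expected number of long chains that end at `y`. -/
def farMass (M : Vec d → Set (Fin n × Fin n)) (v : Fin n → Vec d) (ρ L : ℝ) (s : List Bool)
    (y : Fin n) : ℝ≥0∞ :=
  ∫⁻ u, ∑ x, (if L ≤ ‖v y - v x‖ ^ 2 then chainWeight M ρ s x y u else 0) ∂(stdGaussian (Vec d))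

theorem ENNReal.half_le_of_le_add_quarter {a X b c : ℝ≥0∞} (ha : a ≠ ∞) (hb : b ≤ a / 4)
    (hc : c ≤ a / 4) (h : a ≤ X + b + c) : a / 2 ≤ X := by
  have h1 : a / 4 + a / 4 = a / 2 := by
    rw [← two_mul, ← mul_div_assoc, mul_comm, mul_div_assoc, ENNReal.div_eq_inv_mul (b := 2)]
    rw [mul_comm a]
    congr 1
    rw [ENNReal.div_eq_inv_mul, show (4 : ℝ≥0∞) = 2 * 2 by norm_num,
      ENNReal.mul_inv (by simp) (by simp), mul_assoc, ENNReal.inv_mul_cancel (by simp) (by simp),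
      mul_one]
  have h2 : a / 2 + a / 2 ≤ X + a / 2 := by
    rw [ENNReal.add_halves]
    calc a ≤ X + b + c := h
      _ ≤ X + a / 4 + a / 4 := by gcongr
      _ = X + a / 2 := by rw [add_assoc, h1]
  exact (ENNReal.add_le_add_iff_right (ENNReal.div_ne_top ha (by simp))).1 h2

/-- The empty word has only the trivial chain at each vertex; this starts the iteration. -/
theorem ChainState.refl (hL : 0 < L) (hθ : θ ≤ 1) : ChainState M v ρ L θ [] S 1 0 := by
  refine ⟨chainWeight M ρ [], fun x y => measurable_const, fun _ _ _ => le_rfl, ?_, ?_, ?_⟩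
  · intro x y _ u h
    have : x = y := by
      by_contra hne
      exact h (by simp [chainWeight, hne])
    subst this
    simpa using hL
  · intro y _ u
    simp [chainWeight]
  · intro y _
    simpa [chainWeight] using hθ

theorem norm_sub_sq_le_four_mul {a b c : Vec d} (h1 : ‖a - c‖ ^ 2 < L) (h2 : ‖b - c‖ ^ 2 < L) :
    ‖a - b‖ ^ 2 ≤ 4 * L := by
  have h3 : ‖a - b‖ ≤ ‖a - c‖ + ‖b - c‖ := by
    have := norm_sub_le (a - c) (b - c)
    simpa using this
  have h4 := norm_nonneg (a - b)
  nlinarith [sq_nonneg (‖a - c‖ - ‖b - c‖)]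

/-- Independent steps leave `u` alone, so the old stretch survives unless the displacement from `z`
to `y` points backwards along `u`. If the chains from `x` to `z` and from `x` to `y` are both short,
then `‖v y - v z‖² ≤ 4L`, and the tail bound applies whatever `x` is. Chains that become long are
charged to `farMass`. Each of the two losses is at most a quarter of the mass. -/
theorem ChainState.spread (hM : ∀ x y, MeasurableSet {u | (x, y) ∈ M u}) {ℓ : ℝ} {h₀ κ : ℝ≥0∞}
    {j : ℕ} (hθ : θ ≤ 1) (hlam : lam ≠ ∞) (hh₀ : h₀ ≠ ∞)
    (htail : ∀ w : Vec d, ‖w‖ ^ 2 ≤ 4 * L →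
      stdGaussian (Vec d) {u | inner ℝ w u < -ℓ} ≤ θ / 4)
    (hκ : κ ≤ θ / 4 * (h₀ ^ j * lam))
    (hfar : ∀ y ∈ T, farMass M v ρ L (List.replicate j false ++ s) y ≤ κ)
    (h : ChainState M v ρ L θ s S lam τ) (hST : Spread M ρ S h₀ j T) :
    ChainState M v ρ L (θ / 2) (List.replicate j false ++ s) T (h₀ ^ j * lam) (τ - ℓ) := by
  obtain ⟨f, hfm, hfq, hfs, hfl, hfi⟩ := h
  obtain ⟨c, hc, hcs⟩ := hST
  set s' := List.replicate j false ++ s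
  have hθt : θ ≠ ∞ := (hθ.trans_lt ENNReal.one_lt_top).ne
  have hlt : h₀ ^ j * lam ≠ ∞ := ENNReal.mul_ne_top (ENNReal.pow_ne_top hh₀) hlam
  let near : Fin n → Fin n → Prop := fun x y => ‖v y - v x‖ ^ 2 < L
  let bad : Fin n → Fin n → Set (Vec d) := fun z y => {u | inner ℝ (v y - v z) u < -ℓ}
  have hbadm : ∀ z y, MeasurableSet (bad z y) := fun z y =>
    measurableSet_lt (by fun_prop) measurable_const
  classical
  let g : Fin n → Fin n → Vec d → ℝ≥0∞ := fun x y u =>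
    if y ∈ T ∧ near x y then ∑ z ∈ S, c y z * (bad z y)ᶜ.indicator (f x z) u else 0
  have hgf : ∀ x y u, g x y u ≤ ∑ z ∈ S, c y z * f x z u := by
    intro x y u
    simp only [g]
    split_ifs
    · gcongr
      exact Set.indicator_le_self _ _ _
    · exact zero_le
  refine ⟨g, ?_, ?_, ?_, ?_, ?_⟩
  · intro x y
    simp only [g]
    split_ifs
    · exact Finset.measurable_sum _ fun z _ => ((hfm x z).indicator (hbadm z y).compl).const_mul _
    · exact measurable_const
  · intro x y u
    by_cases hy : y ∈ T
    · refine (hgf x y u).trans ((Finset.sum_le_sum fun z _ => ?_).trans (hcs s x u y hy))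
      gcongr
      exact hfq x z u
    · simp [g, hy]
  · intro x y hy u hne
    have hnear : near x y := by
      by_contra hn
      exact hne (by simp [g, hn])
    refine ⟨hnear, ?_⟩
    simp only [g, hy, hnear, and_self, if_true] at hne
    obtain ⟨z, hz, hzne⟩ := Finset.exists_ne_zero_of_sum_ne_zero hne
    have hzb : u ∈ (bad z y)ᶜ := by
      by_contra hb
      exact hzne (by rw [Set.indicator_of_notMem hb, mul_zero])
    rw [Set.indicator_of_mem hzb] at hzne
    have h1 := (hfs x z hz u (right_ne_zero_of_mul hzne)).2
    have h2 : -ℓ ≤ inner ℝ (v y - v z) u := not_lt.1 hzb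
    have h3 : v y - v x = (v y - v z) + (v z - v x) := by abel
    rw [h3, inner_add_left]
    linarith
  · intro y hy u
    calc ∑ x, g x y u ≤ ∑ x, ∑ z ∈ S, c y z * f x z u := Finset.sum_le_sum fun x _ => hgf x y u
      _ = ∑ z ∈ S, c y z * ∑ x, f x z u := by
          rw [Finset.sum_comm]; simp only [Finset.mul_sum]
      _ ≤ ∑ z ∈ S, c y z * lam := by
          gcongr with z hz
          exact hfl z hz u
      _ = h₀ ^ j * lam := by rw [← Finset.sum_mul, hc y hy]
  · intro y hy
    -- Kept chains, chains that became long, and short chains whose added displacement points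
    -- backwards. In the last group the sum over `x` is bounded by `lam`, so no union bound over
    -- starting points is paid.
    have hsplit : ∀ u, ∑ x, ∑ z ∈ S, c y z * f x z u ≤ ∑ x, g x y u +
        ∑ x, (if L ≤ ‖v y - v x‖ ^ 2 then chainWeight M ρ s' x y u else 0) +
        ∑ z ∈ S, c y z * (if ‖v y - v z‖ ^ 2 ≤ 4 * L then lam * (bad z y).indicator 1 u else 0) := by
      intro u
      have h1 : ∀ x, ∑ z ∈ S, c y z * f x z u ≤ g x y u +
          (if L ≤ ‖v y - v x‖ ^ 2 then chainWeight M ρ s' x y u else 0) +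
          ∑ z ∈ S, c y z *
            (if ‖v y - v x‖ ^ 2 < L then (bad z y).indicator (f x z) u else 0) := by
        intro x
        by_cases hx : ‖v y - v x‖ ^ 2 < L
        · simp only [g, near, hx, hy, and_self, if_true, not_le.2 hx, if_false, add_zero]
          rw [← Finset.sum_add_distrib]
          refine Finset.sum_le_sum fun z _ => ?_
          rw [← mul_add]
          gcongr
          rw [← Pi.add_apply (f := (bad z y)ᶜ.indicator (f x z)),
            Set.indicator_compl_add_self]
        · refine le_trans ?_ le_self_add
          refine le_trans ?_ le_add_self
          rw [if_pos (not_lt.1 hx)]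
          refine (Finset.sum_le_sum fun z _ => ?_).trans (hcs s x u y hy)
          gcongr
          exact hfq x z u
      refine (Finset.sum_le_sum fun x _ => h1 x).trans ?_
      rw [Finset.sum_add_distrib, Finset.sum_add_distrib]
      refine add_le_add le_rfl ?_
      rw [Finset.sum_comm]
      refine Finset.sum_le_sum fun z hz => ?_
      rw [← Finset.mul_sum]
      gcongr
      by_cases hb : u ∈ bad z y
      · simp only [Set.indicator_of_mem hb, Pi.one_apply, mul_one]
        split_ifs with hzy
        · refine (Finset.sum_le_sum fun x _ => ?_).trans (hfl z hz u)
          split_ifs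
          · exact le_rfl
          · exact zero_le
        · refine (Finset.sum_eq_zero fun x _ => ?_).le
          split_ifs with hx
          · by_contra hne
            exact hzy (norm_sub_sq_le_four_mul hx (hfs x z hz u hne).1)
          · rfl
      · simp [Set.indicator_of_notMem hb]
    have hint : θ * (h₀ ^ j * lam) ≤
        ∫⁻ u, ∑ x, ∑ z ∈ S, c y z * f x z u ∂(stdGaussian (Vec d)) := by
      have h1 : ∀ u, ∑ x, ∑ z ∈ S, c y z * f x z u = ∑ z ∈ S, c y z * ∑ x, f x z u := by
        intro u; rw [Finset.sum_comm]; simp only [Finset.mul_sum]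
      have h2 : ∀ z, Measurable fun u => ∑ x, f x z u := fun z =>
        Finset.measurable_sum _ fun x _ => hfm x z
      simp only [h1]
      rw [lintegral_finsetSum _ fun z _ => (h2 z).const_mul _]
      calc _ = ∑ z ∈ S, c y z * (θ * lam) := by rw [← Finset.sum_mul, hc y hy]; ring
        _ ≤ _ := by
          refine Finset.sum_le_sum fun z hz => ?_
          rw [lintegral_const_mul _ (h2 z)]
          gcongr
          exact hfi z hz
    have hgm : ∀ x, Measurable (g x y) := by
      intro x
      simp only [g]
      split_ifs
      · exact Finset.measurable_sum _ fun z _ =>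
          ((hfm x z).indicator (hbadm z y).compl).const_mul _
      · exact measurable_const
    have hm1 : Measurable fun u => ∑ x, g x y u := Finset.measurable_sum _ fun x _ => hgm x
    have hm2 : Measurable fun u =>
        ∑ x, (if L ≤ ‖v y - v x‖ ^ 2 then chainWeight M ρ s' x y u else 0) := by
      refine Finset.measurable_sum _ fun x _ => ?_
      split_ifs
      · exact measurable_chainWeight hM ρ s' x y
      · exact measurable_const
    have hloss : ∫⁻ u, ∑ z ∈ S, c y z *
        (if ‖v y - v z‖ ^ 2 ≤ 4 * L then lam * (bad z y).indicator 1 u else 0)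
          ∂(stdGaussian (Vec d)) ≤ θ * (h₀ ^ j * lam) / 4 := by
      have hm3 : ∀ z, Measurable fun u =>
          (if ‖v y - v z‖ ^ 2 ≤ 4 * L then lam * (bad z y).indicator (1 : Vec d → ℝ≥0∞) u else 0) := by
        intro z
        split_ifs
        · exact (measurable_one.indicator (hbadm z y)).const_mul _
        · exact measurable_const
      rw [lintegral_finsetSum _ fun z _ => (hm3 z).const_mul _]
      calc _ ≤ ∑ z ∈ S, c y z * (lam * (θ / 4)) := by
            refine Finset.sum_le_sum fun z _ => ?_
            rw [lintegral_const_mul _ (hm3 z)]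
            gcongr
            split_ifs with hz
            · rw [lintegral_const_mul _ (measurable_one.indicator (hbadm z y)),
                lintegral_indicator_one (hbadm z y)]
              gcongr
              exact htail _ hz
            · simp
        _ = _ := by
            rw [← Finset.sum_mul, hc y hy]
            simp only [div_eq_mul_inv]
            ring
    have htot := hint.trans (lintegral_mono hsplit)
    have hm12 : Measurable fun u => ∑ x, g x y u +
        ∑ x, (if L ≤ ‖v y - v x‖ ^ 2 then chainWeight M ρ s' x y u else 0) := hm1.add hm2
    rw [lintegral_add_left hm12, lintegral_add_left hm1] at htot
    have := ENNReal.half_le_of_le_add_quarter (ENNReal.mul_ne_top hθt hlt)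
      (b := ∫⁻ u, ∑ x, (if L ≤ ‖v y - v x‖ ^ 2 then chainWeight M ρ s' x y u else 0)
        ∂(stdGaussian (Vec d))) ?_ hloss htot
    · refine le_trans (le_of_eq ?_) this
      simp only [div_eq_mul_inv]
      ring
    · refine (hfar y hy).trans (hκ.trans (le_of_eq ?_))
      simp only [div_eq_mul_inv]
      ring

/-- Off a rare set of correlated copies `u` of the last vector, substantially many chains keep
their stretch along `u`. -/
theorem exists_bad_set {y : Fin n} {f : Fin n → Vec d → ℝ≥0∞} {a ε : ℝ≥0∞} {ℓ : ℝ}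
    (hρ0 : 0 ≤ ρ) (hρ : ρ ^ 2 ≤ 1) (ha0 : a ≠ 0) (hat : a ≠ ∞)
    (hlam0 : lam ≠ 0) (hlam : lam ≠ ∞)
    (hboost : ∀ F : Vec d → ℝ≥0∞, Measurable F → (∀ u, F u ≤ 1) →
      θ ≤ ∫⁻ u, F u ∂(stdGaussian (Vec d)) → stdGaussian (Vec d) {u | noiseOp ρ F u < a} ≤ ε)
    (htail : ∀ w : Vec d, ‖w‖ ^ 2 ≤ L →
      stdGaussian (Vec d) {g | Real.sqrt (1 - ρ ^ 2) * inner ℝ w g < -ℓ} ≤ a / 2 * ε)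
    (hfm : ∀ x, Measurable (f x))
    (hfs : ∀ x u, f x u ≠ 0 → ‖v y - v x‖ ^ 2 < L ∧ τ ≤ inner ℝ (v y - v x) u)
    (hfl : ∀ u, ∑ x, f x u ≤ lam)
    (hfi : θ * lam ≤ ∫⁻ u, ∑ x, f x u ∂(stdGaussian (Vec d))) :
    ∃ B : Set (Vec d), MeasurableSet B ∧ stdGaussian (Vec d) B ≤ 2 * ε ∧ ∀ u ∉ B,
      lam * (a / 2) ≤ ∑ x, Set.indicator {u | ρ * τ - ℓ ≤ inner ℝ (v y - v x) u}
        (noiseOp ρ (f x)) u := by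
  set good : Fin n → Set (Vec d) := fun x => {u | ρ * τ - ℓ ≤ inner ℝ (v y - v x) u} with hgood
  have hgm : ∀ x, MeasurableSet (good x) := fun x =>
    measurableSet_le measurable_const (by fun_prop)
  have hTm : ∀ x, Measurable (noiseOp ρ (f x)) := fun x => measurable_noiseOp ρ (hfm x)
  set F : Vec d → ℝ≥0∞ := fun u => ∑ x, f x u with hF
  have hFm : Measurable F := Finset.measurable_sum _ fun x _ => hfm x
  set b : Vec d → ℝ≥0∞ := fun u => ∑ x, (good x)ᶜ.indicator (noiseOp ρ (f x)) u with hb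
  have hbm : Measurable b := Finset.measurable_sum _ fun x _ => (hTm x).indicator (hgm x).compl
  have hla0 : lam * (a / 2) ≠ 0 := mul_ne_zero hlam0 (by simp [ha0])
  have hlat : lam * (a / 2) ≠ ∞ := ENNReal.mul_ne_top hlam (ENNReal.div_ne_top hat (by simp))
  -- The first set consists of directions where noise failed to deliver weight `lam * a`; in the
  -- second, half that amount has lost its stretch.
  refine ⟨{u | noiseOp ρ F u < lam * a} ∪ {u | lam * (a / 2) ≤ b u}, ?_, ?_, ?_⟩
  · exact (measurableSet_lt (measurable_noiseOp ρ hFm) measurable_const).union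
      (measurableSet_le measurable_const hbm)
  · rw [two_mul]
    refine (measure_union_le _ _).trans (add_le_add ?_ ?_)
    · have h1 := hboost (fun u => lam⁻¹ * F u) (hFm.const_mul _) (fun u => ?_) ?_
      · refine (measure_mono fun u hu => ?_).trans h1
        simp only [Set.mem_ofPred_eq] at hu ⊢
        rw [noiseOp_const_mul _ hFm, mul_comm, ← div_eq_mul_inv]
        exact ENNReal.div_lt_of_lt_mul' hu
      · rw [mul_comm, ← div_eq_mul_inv]
        exact ENNReal.div_le_of_le_mul (by simpa using hfl u)
      · rw [lintegral_const_mul _ hFm, mul_comm, ← div_eq_mul_inv]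
        exact (ENNReal.le_div_iff_mul_le (Or.inl hlam0) (Or.inl hlam)).2 hfi
    · have h2 : ∫⁻ u, b u ∂(stdGaussian (Vec d)) ≤ lam * (a / 2) * ε := by
        calc _ = ∑ x, ∫⁻ u, (good x)ᶜ.indicator 1 u * noiseOp ρ (f x) u
              ∂(stdGaussian (Vec d)) := by
              rw [hb, lintegral_finsetSum _ fun x _ => (hTm x).indicator (hgm x).compl]
              refine Finset.sum_congr rfl fun x _ => lintegral_congr fun u => ?_
              by_cases hu : u ∈ (good x)ᶜ
              · simp only [Set.indicator_of_mem hu, Pi.one_apply, one_mul]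
              · simp only [Set.indicator_of_notMem hu, zero_mul]
          -- Exchangeability moves the noise onto the failure event. The chain now starts from a
          -- direction with stretch at least `τ`, and failure requires the noise term alone to fall
          -- below `-ℓ`.
          _ = ∑ x, ∫⁻ u, f x u * noiseOp ρ ((good x)ᶜ.indicator 1) u ∂(stdGaussian (Vec d)) :=
              Finset.sum_congr rfl fun x _ =>
                lintegral_mul_noiseOp hρ (hfm x) (measurable_one.indicator (hgm x).compl)
          _ ≤ ∑ x, ∫⁻ u, f x u * (a / 2 * ε) ∂(stdGaussian (Vec d)) := by
              refine Finset.sum_le_sum fun x _ => lintegral_mono fun u => ?_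
              by_cases h0 : f x u = 0
              · simp [h0]
              · simp only
                gcongr
                obtain ⟨hx1, hx2⟩ := hfs x u h0
                refine le_trans ?_ (htail _ hx1.le)
                have hm : MeasurableSet
                    {g : Vec d | Real.sqrt (1 - ρ ^ 2) * inner ℝ (v y - v x) g < -ℓ} :=
                  measurableSet_lt (by fun_prop) measurable_const
                rw [← lintegral_indicator_one hm]
                refine lintegral_mono fun g => ?_
                by_cases hg : ρ • u + Real.sqrt (1 - ρ ^ 2) • g ∈ (good x)ᶜ
                · have hg' : g ∈ {g : Vec d |
                      Real.sqrt (1 - ρ ^ 2) * inner ℝ (v y - v x) g < -ℓ} := by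
                    simp only [hgood, Set.mem_compl_iff, Set.mem_ofPred_eq, not_le, inner_add_right,
                      real_inner_smul_right] at hg ⊢
                    have := mul_le_mul_of_nonneg_left hx2 hρ0
                    linarith
                  rw [Set.indicator_of_mem hg, Set.indicator_of_mem hg']
                  exact le_rfl
                · rw [Set.indicator_of_notMem hg]
                  exact zero_le
          _ = (∫⁻ u, F u ∂(stdGaussian (Vec d))) * (a / 2 * ε) := by
              rw [hF, lintegral_finsetSum _ fun x _ => hfm x, Finset.sum_mul]
              exact Finset.sum_congr rfl fun x _ => lintegral_mul_const _ (hfm x)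
          _ ≤ lam * (a / 2 * ε) := by
              gcongr
              calc _ ≤ ∫⁻ _, lam ∂(stdGaussian (Vec d)) := lintegral_mono hfl
                _ = lam := by simp
          _ = _ := by rw [mul_assoc]
      have h3 := mul_meas_ge_le_lintegral hbm (μ := stdGaussian (Vec d)) (lam * (a / 2))
      exact (ENNReal.mul_le_mul_iff_right hla0 hlat).1 (h3.trans h2)
  · intro u hu
    simp only [Set.mem_union, Set.mem_ofPred_eq, not_or, not_lt, not_le] at hu
    obtain ⟨hu1, hu2⟩ := hu
    have h1 : noiseOp ρ F u = ∑ x, (good x).indicator (noiseOp ρ (f x)) u + b u := by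
      rw [hF, noiseOp_sum _ fun x _ => hfm x, hb, ← Finset.sum_add_distrib]
      refine Finset.sum_congr rfl fun x _ => ?_
      rw [← Pi.add_apply, Set.indicator_self_add_compl]
    by_contra hlt
    have h2 := ENNReal.add_lt_add (not_le.1 hlt) hu2
    rw [← h1, ← mul_add, ENNReal.add_halves] at h2
    exact absurd h2 (not_lt.2 hu1)

end Chains

/-! ### Appending a correlated edge -/

section Extend

variable {n d : ℕ} {M : Vec d → Set (Fin n × Fin n)} {v : Fin n → Vec d} {σ ρ L τ : ℝ}
  {lam : ℝ≥0∞} {s : List Bool} {T V : Finset (Fin n)}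

/-- Chopping a family of functions to the level `c` where its sum reaches `c`. -/
theorem exists_level_family {n d : ℕ} (f : Fin n → Vec d → ℝ≥0∞) (hf : ∀ x, Measurable (f x))
    {c : ℝ≥0∞} (hc : c ≠ 0) (hfin : ∀ u, ∑ x, f x u ≠ ∞) :
    ∃ g : Fin n → Vec d → ℝ≥0∞, (∀ x, Measurable (g x)) ∧ (∀ x u, g x u ≤ f x u) ∧
      (∀ u, ∑ x, g x u ≤ c) ∧
      c * stdGaussian (Vec d) {u | c ≤ ∑ x, f x u} ≤ ∫⁻ u, ∑ x, g x u ∂(stdGaussian (Vec d)) := by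
  set F : Vec d → ℝ≥0∞ := fun u => ∑ x, f x u with hF
  have hFm : Measurable F := Finset.measurable_sum _ fun x _ => hf x
  set A : Set (Vec d) := {u | c ≤ F u} with hA
  have hAm : MeasurableSet A := measurableSet_le measurable_const hFm
  have hsum : ∀ u ∈ A, ∑ x, A.indicator (fun u => c / F u * f x u) u = c := by
    intro u hu
    simp only [Set.indicator_of_mem hu]
    rw [← Finset.mul_sum]
    refine ENNReal.div_mul_cancel ?_ (hfin u)
    exact fun h0 => hc (by simpa [h0] using (show c ≤ F u from hu))
  refine ⟨fun x => A.indicator fun u => c / F u * f x u, fun x => ?_, fun x u => ?_, fun u => ?_, ?_⟩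
  · exact (Measurable.mul (Measurable.div measurable_const hFm) (hf x)).indicator hAm
  · change A.indicator _ u ≤ f x u
    by_cases hu : u ∈ A
    · rw [Set.indicator_of_mem hu]
      have h1 : c / F u ≤ 1 := ENNReal.div_le_of_le_mul (by rw [one_mul]; exact hu)
      calc c / F u * f x u ≤ 1 * f x u := by gcongr
        _ = f x u := one_mul _
    · rw [Set.indicator_of_notMem hu]
      exact zero_le
  · by_cases hu : u ∈ A
    · exact (hsum u hu).le
    · simp [Set.indicator_of_notMem hu]
  · rw [← lintegral_indicator_const hAm]
    refine lintegral_mono fun u => ?_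
    by_cases hu : u ∈ A
    · rw [Set.indicator_of_mem hu]
      exact (hsum u hu).ge
    · rw [Set.indicator_of_notMem hu]
      exact zero_le

/-- Edges into `y` are sorted by whether their direction is bad for their source. The events for the
good ones are disjoint because only one edge enters `y`, so their probabilities add up to that of
one event. -/
theorem measure_edge_le (hM : ∀ x y, MeasurableSet {u | (x, y) ∈ M u})
    (hmatch : ∀ u, IsDirectedMatching (M u)) {B : Fin n → Set (Vec d)}
    (hB : ∀ y ∈ T, MeasurableSet (B y)) (y : Fin n) :
    ∑ z ∈ T, edgeProb M z y ≤ ∑ z ∈ T, stdGaussian (Vec d) ({u | (z, y) ∈ M u} ∩ B z) +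
      stdGaussian (Vec d) {u | ∃ z ∈ T, (z, y) ∈ M u ∧ u ∉ B z} := by
  have h1 : ∑ z ∈ T, edgeProb M z y ≤ ∑ z ∈ T, (stdGaussian (Vec d) ({u | (z, y) ∈ M u} ∩ B z) +
      stdGaussian (Vec d) ({u | (z, y) ∈ M u} \ B z)) := by
    refine Finset.sum_le_sum fun z hz => ?_
    rw [measure_inter_add_sdiff _ (hB z hz)]
    exact le_rfl
  refine h1.trans ?_
  rw [Finset.sum_add_distrib]
  gcongr
  rw [← measure_biUnion_finset]
  · refine measure_mono fun u hu => ?_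
    simp only [Set.mem_iUnion, Set.mem_sdiff, Set.mem_ofPred_eq, exists_prop] at hu ⊢
    exact hu
  · intro z _ z' _ hne
    rw [Function.onFun, Set.disjoint_left]
    rintro u ⟨hu, -⟩ ⟨hu', -⟩
    exact hne (matching_left_unique (hmatch u) hu hu')
  · intro z hz
    exact (hM z y).diff (hB z hz)

/-- Double counting: for fixed `z` the edges to different `y` are disjoint events, so those with
direction in `B z` have total probability at most that of `B z`. -/
theorem card_le_of_sum_measure_le (hM : ∀ x y, MeasurableSet {u | (x, y) ∈ M u})
    (hmatch : ∀ u, IsDirectedMatching (M u)) {B : Fin n → Set (Vec d)} {θ ε β : NNReal}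
    (hθ : θ ≠ 0) (hB : ∀ y ∈ T, MeasurableSet (B y))
    (hBε : ∀ y ∈ T, stdGaussian (Vec d) (B y) ≤ 2 * ε) (hε : 2 * ε ≤ β * θ) :
    ((V.filter fun y => (θ : ℝ≥0∞) <
      ∑ z ∈ T, stdGaussian (Vec d) ({u | (z, y) ∈ M u} ∩ B z)).card : ℝ) ≤ β * T.card := by
  classical
  set W := V.filter fun y => (θ : ℝ≥0∞) <
      ∑ z ∈ T, stdGaussian (Vec d) ({u | (z, y) ∈ M u} ∩ B z) with hW
  have h1 : (W.card : ℝ≥0∞) * θ ≤ ∑ y ∈ W, ∑ z ∈ T,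
      stdGaussian (Vec d) ({u | (z, y) ∈ M u} ∩ B z) := by
    rw [← nsmul_eq_mul]
    exact Finset.card_nsmul_le_sum _ _ _ fun y hy => (Finset.mem_filter.1 hy).2.le
  have h2 : ∀ z ∈ T, ∑ y ∈ W, stdGaussian (Vec d) ({u | (z, y) ∈ M u} ∩ B z) ≤ 2 * ε := by
    intro z hz
    refine le_trans ?_ (hBε z hz)
    rw [← measure_biUnion_finset]
    · refine measure_mono ?_
      simp only [Set.iUnion_subset_iff]
      exact fun y _ => Set.inter_subset_right
    · intro y _ y' _ hne
      rw [Function.onFun, Set.disjoint_left]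
      rintro u ⟨hu, -⟩ ⟨hu', -⟩
      exact hne (matching_right_unique (hmatch u) hu hu')
    · exact fun y _ => (hM z y).inter (hB z hz)
  rw [Finset.sum_comm] at h1
  have h3 := h1.trans (Finset.sum_le_card_nsmul _ _ _ h2)
  rw [nsmul_eq_mul] at h3
  have h4 : (W.card : NNReal) * θ ≤ T.card * (2 * ε) := by exact_mod_cast h3
  have h5 : (W.card : NNReal) * θ ≤ (β * T.card) * θ := by
    refine h4.trans ?_
    calc (T.card : NNReal) * (2 * ε) ≤ T.card * (β * θ) := by gcongr
      _ = _ := by ring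
  have h6 := le_of_mul_le_mul_right h5 (pos_iff_ne_zero.2 hθ)
  exact_mod_cast h6

/-- Outside a rare bad set for each `z ∈ T`, the noise delivers weight `lam * a / 2` of stretched
chains at `z`, and an edge from `z` to `y` transports all of it. The gain is that the probability at
`y` is governed by how often `T` covers `y`, no longer by the initial probability `θ/2`; this is why
it returns to `θ` and rounds can be repeated. -/
theorem ChainState.extend (hM : ∀ x y, MeasurableSet {u | (x, y) ∈ M u})
    (hmatch : ∀ u, IsDirectedMatching (M u))
    (hstretch : ∀ u x y, (x, y) ∈ M u → σ ≤ inner ℝ (v y - v x) u)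
    {θ ε β : NNReal} {a κ : ℝ≥0∞} {ℓ : ℝ} (hρ0 : 0 ≤ ρ) (hρ : ρ ^ 2 ≤ 1)
    (ha0 : a ≠ 0) (hat : a ≠ ∞) (hlam0 : lam ≠ 0) (hlam : lam ≠ ∞) (hθ : θ ≠ 0)
    (hε : 2 * ε ≤ β * θ)
    (hboost : ∀ F : Vec d → ℝ≥0∞, Measurable F → (∀ u, F u ≤ 1) →
      (θ : ℝ≥0∞) / 2 ≤ ∫⁻ u, F u ∂(stdGaussian (Vec d)) →
      stdGaussian (Vec d) {u | noiseOp ρ F u < a} ≤ ε)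
    (htail : ∀ w : Vec d, ‖w‖ ^ 2 ≤ L →
      stdGaussian (Vec d) {g | Real.sqrt (1 - ρ ^ 2) * inner ℝ w g < -ℓ} ≤ a / 2 * ε)
    (hκ : κ ≤ θ * (lam * (a / 4)))
    (hfar : ∀ y ∈ V, farMass M v ρ L (true :: s) y ≤ κ)
    (hcov : 2 * β * (T.card : ℝ) ≤
      (V.filter fun y => 4 * (θ : ℝ) ≤ ∑ z ∈ T, (edgeProb M z y).toReal).card)
    (h : ChainState M v ρ L (θ / 2) s T lam τ) :
    ∃ S ⊆ V, β * (T.card : ℝ) ≤ S.card ∧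
      ChainState M v ρ L θ (true :: s) S (lam * (a / 4)) (ρ * τ - ℓ + σ) := by
  classical
  obtain ⟨f, hfm, hfq, hfs, hfl, hfi⟩ := h
  have hB : ∀ y, ∃ B : Set (Vec d), y ∈ T → MeasurableSet B ∧ stdGaussian (Vec d) B ≤ 2 * ε ∧
      ∀ u ∉ B, lam * (a / 2) ≤ ∑ x, Set.indicator {u | ρ * τ - ℓ ≤ inner ℝ (v y - v x) u}
        (noiseOp ρ (f x y)) u := by
    intro y
    by_cases hy : y ∈ T
    · obtain ⟨B, hB⟩ := exists_bad_set (f := fun x => f x y) hρ0 hρ ha0 hat hlam0 hlam hboost htail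
        (fun x => hfm x y) (fun x u => hfs x y hy u) (hfl y hy) (hfi y hy)
      exact ⟨B, fun _ => hB⟩
    · exact ⟨∅, fun h => absurd h hy⟩
  choose B hB using hB
  set good : Fin n → Fin n → Set (Vec d) := fun x y =>
    {u | ρ * τ - ℓ ≤ inner ℝ (v y - v x) u} with hgood
  have hgm : ∀ x y, MeasurableSet (good x y) := fun x y =>
    measurableSet_le measurable_const (by fun_prop)
  set lam' := lam * (a / 4) with hlam'
  have hlam'0 : lam' ≠ 0 := mul_ne_zero hlam0 (by simp [ha0])
  have hlam't : lam' ≠ ∞ := ENNReal.mul_ne_top hlam (ENNReal.div_ne_top hat (by simp))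
  have hlam2 : lam * (a / 2) = lam' + lam' := by
    rw [hlam', ← mul_add, ← two_mul]
    congr 1
    rw [div_eq_mul_inv, div_eq_mul_inv, show (4 : ℝ≥0∞) = 2 * 2 by norm_num,
      ENNReal.mul_inv (by simp) (by simp), mul_comm 2, mul_assoc, mul_assoc,
      ENNReal.inv_mul_cancel (by simp) (by simp), mul_one]
  -- the weights of all extended chains
  let e : Fin n → Fin n → Vec d → ℝ≥0∞ := fun x y u =>
    ∑ z ∈ T, edgeInd M z y u * (good x z).indicator (noiseOp ρ (f x z)) u
  have hem : ∀ x y, Measurable (e x y) := fun x y => Finset.measurable_sum _ fun z _ =>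
    (measurable_edgeInd hM z y).mul ((measurable_noiseOp ρ (hfm x z)).indicator (hgm x z))
  have heq : ∀ x y u, e x y u ≤ chainWeight M ρ (true :: s) x y u := by
    intro x y u
    refine le_trans ?_ (Finset.sum_le_sum_of_subset (Finset.subset_univ T))
    refine Finset.sum_le_sum fun z _ => ?_
    gcongr
    refine (Set.indicator_le_self _ _ _).trans (noiseOp_mono (hfq x z) u)
  have hesum : ∀ y u, ∑ x, e x y u = ∑ z ∈ T, edgeInd M z y u *
      ∑ x, (good x z).indicator (noiseOp ρ (f x z)) u := by
    intro y u
    rw [Finset.sum_comm]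
    simp only [Finset.mul_sum]
  have hel : ∀ y u, ∑ x, e x y u ≤ lam := by
    intro y u
    rw [hesum]
    refine sum_edgeInd_mul_le hmatch y u T _ fun z hz _ => ?_
    calc _ ≤ ∑ x, noiseOp ρ (f x z) u :=
          Finset.sum_le_sum fun x _ => Set.indicator_le_self _ _ _
      _ = noiseOp ρ (fun u => ∑ x, f x z u) u := (noiseOp_sum _ (fun x _ => hfm x z) u).symm
      _ ≤ noiseOp ρ (fun _ => lam) u := noiseOp_mono (hfl z hz) u
      _ = lam := noiseOp_const _ _ _
  let near : Fin n → Fin n → Vec d → ℝ≥0∞ := fun x y u =>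
    if ‖v y - v x‖ ^ 2 < L then e x y u else 0
  let far : Fin n → Fin n → Vec d → ℝ≥0∞ := fun x y u =>
    if L ≤ ‖v y - v x‖ ^ 2 then e x y u else 0
  have hnm : ∀ x y, Measurable (near x y) := by
    intro x y
    simp only [near]
    split_ifs
    · exact hem x y
    · exact measurable_const
  have hfarm : ∀ x y, Measurable (far x y) := by
    intro x y
    simp only [far]
    split_ifs
    · exact hem x y
    · exact measurable_const
  have hne : ∀ x y u, near x y u ≤ e x y u := by
    intro x y u
    simp only [near]
    split_ifs
    · exact le_rfl
    · exact zero_le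
  have hnf : ∀ y u, ∑ x, e x y u = ∑ x, near x y u + ∑ x, far x y u := by
    intro y u
    rw [← Finset.sum_add_distrib]
    refine Finset.sum_congr rfl fun x _ => ?_
    simp only [near, far]
    by_cases hx : ‖v y - v x‖ ^ 2 < L
    · simp [hx, not_le.2 hx]
    · simp [hx, not_lt.1 hx]
  -- Markov's inequality at level `lam'`, half of the weight that a good edge carries.
  have hfarκ : ∀ y ∈ V, stdGaussian (Vec d) {u | lam' ≤ ∑ x, far x y u} ≤ θ := by
    intro y hy
    have hm : Measurable fun u => ∑ x, far x y u := Finset.measurable_sum _ fun x _ => hfarm x y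
    have h1 := mul_meas_ge_le_lintegral hm (μ := stdGaussian (Vec d)) lam'
    have h2 : ∫⁻ u, ∑ x, far x y u ∂(stdGaussian (Vec d)) ≤ lam' * θ := by
      rw [mul_comm]
      refine le_trans ?_ ((hfar y hy).trans hκ)
      refine lintegral_mono fun u => Finset.sum_le_sum fun x _ => ?_
      simp only [far]
      split_ifs
      · exact heq x y u
      · exact le_rfl
    exact (ENNReal.mul_le_mul_iff_right hlam'0 hlam't).1 (h1.trans h2)
  -- Capping the total at `lam'` provides the uniform upper bound that a `ChainState` demands, at
  -- the level that is also reached from below.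
  have hlev := fun y => exists_level_family (fun x => near x y) (fun x => hnm x y) hlam'0
    (fun u => ((Finset.sum_le_sum fun x _ => hne x y u).trans_lt
      ((hel y u).trans_lt hlam.lt_top)).ne)
  choose g hgmeas hgle hgl hgi using hlev
  set A := V.filter fun y => 4 * (θ : ℝ) ≤ ∑ z ∈ T, (edgeProb M z y).toReal with hA
  set W := V.filter fun y => (θ : ℝ≥0∞) <
    ∑ z ∈ T, stdGaussian (Vec d) ({u | (z, y) ∈ M u} ∩ B z) with hW
  have hWcard := card_le_of_sum_measure_le (V := V) hM hmatch hθ (fun y hy => (hB y hy).1)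
    (fun y hy => (hB y hy).2.1) hε
  -- Keep the well-covered vertices, except those often entered along bad directions: at least `2β -
  -- β` times `T.card` remain.
  refine ⟨A \ W, Finset.sdiff_subset.trans (Finset.filter_subset _ _), ?_,
    fun x y => g y x, fun x y => hgmeas y x, ?_, ?_, fun y _ => hgl y, ?_⟩
  · have h1 : A.card ≤ (A \ W).card + W.card := by
      rw [← Nat.sub_le_iff_le_add]
      exact Finset.le_card_sdiff W A
    have h2 : (A.card : ℝ) ≤ (A \ W).card + W.card := by exact_mod_cast h1
    linarith
  · exact fun x y u => (hgle y x u).trans ((hne x y u).trans (heq x y u))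
  · intro x y _ u hu
    have hn0 : near x y u ≠ 0 := fun h0 => hu (le_antisymm ((hgle y x u).trans_eq h0) zero_le)
    have hL : ‖v y - v x‖ ^ 2 < L := by
      by_contra hL
      exact hn0 (by simp [near, hL])
    refine ⟨hL, ?_⟩
    simp only [near, hL, if_true, e] at hn0
    obtain ⟨z, -, hz⟩ := Finset.exists_ne_zero_of_sum_ne_zero hn0
    have h1 : (z, y) ∈ M u := by
      by_contra h1
      exact hz (by rw [edgeInd_of_notMem h1, zero_mul])
    have h2 : u ∈ good x z := by
      by_contra h2
      exact hz (by rw [Set.indicator_of_notMem h2, mul_zero])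
    have h3 : ρ * τ - ℓ ≤ inner ℝ (v z - v x) u := h2
    have h4 := hstretch u z y h1
    have h5 : v y - v x = (v z - v x) + (v y - v z) := by abel
    rw [h5, inner_add_left]
    linarith
  · intro y hy
    obtain ⟨hyA, hyW⟩ := Finset.mem_sdiff.1 hy
    obtain ⟨hyV, hyθ⟩ := Finset.mem_filter.1 hyA
    have hyB : ∑ z ∈ T, stdGaussian (Vec d) ({u | (z, y) ∈ M u} ∩ B z) ≤ θ := by
      by_contra hlt
      exact hyW (Finset.mem_filter.2 ⟨hyV, not_le.1 hlt⟩)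
    refine le_trans ?_ (hgi y)
    rw [mul_comm]
    gcongr
    have h1 : 4 * (θ : ℝ≥0∞) ≤ ∑ z ∈ T, edgeProb M z y := by
      rw [← ENNReal.toReal_sum fun z _ => edgeProb_ne_top z y] at hyθ
      have := ENNReal.ofReal_le_of_le_toReal hyθ
      rwa [ENNReal.ofReal_mul (by norm_num), ENNReal.ofReal_coe_nnreal,
        ENNReal.ofReal_ofNat] at this
    have h2 := h1.trans (measure_edge_le hM hmatch (fun y hy => (hB y hy).1) y)
    have h3 : stdGaussian (Vec d) {u | ∃ z ∈ T, (z, y) ∈ M u ∧ u ∉ B z} ≤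
        stdGaussian (Vec d) {u | lam' ≤ ∑ x, near x y u} + θ := by
      refine le_trans ?_ (add_le_add le_rfl (hfarκ y hyV))
      refine le_trans (measure_mono ?_) (measure_union_le _ _)
      rintro u ⟨z, hz, hzy, hzB⟩
      -- A good edge brings weight `2 * lam'`, so the short chains or the long ones account for at
      -- least `lam'`.
      have h4 : lam' + lam' ≤ ∑ x, near x y u + ∑ x, far x y u := by
        rw [← hnf, hesum, ← hlam2]
        refine le_trans ((hB z hz).2.2 u hzB) ?_
        refine le_trans (le_of_eq ?_) (Finset.single_le_sum (f := fun z => edgeInd M z y u *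
          ∑ x, (good x z).indicator (noiseOp ρ (f x z)) u) (fun _ _ => zero_le) hz)
        simp only [edgeInd_of_mem hzy, one_mul, hgood]
      by_contra hu
      simp only [Set.mem_union, Set.mem_ofPred_eq, not_or, not_le] at hu
      exact absurd h4 (not_le.2 (ENNReal.add_lt_add hu.1 hu.2))
    -- Of the covering probability `4θ`, bad directions use up `θ` and long chains another `θ`.
    have h5 : 4 * (θ : ℝ≥0∞) ≤ 2 * θ + stdGaussian (Vec d) {u | lam' ≤ ∑ x, near x y u} := by
      calc 4 * (θ : ℝ≥0∞) ≤ θ + (stdGaussian (Vec d) {u | lam' ≤ ∑ x, near x y u} + θ) :=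
            h2.trans (add_le_add hyB h3)
        _ = _ := by ring
    have h6 : 4 * (θ : ℝ≥0∞) = 2 * θ + 2 * θ := by ring
    rw [h6] at h5
    have h7 := (ENNReal.add_le_add_iff_left
      (ENNReal.mul_ne_top (by simp) ENNReal.coe_ne_top)).1 h5
    refine le_trans ?_ h7
    calc (θ : ℝ≥0∞) = 1 * θ := (one_mul _).symm
      _ ≤ 2 * θ := by gcongr; norm_num

end Extend

/-! ### Iterating the rounds and bounding the attainable stretch -/

section Iterate

variable {n d : ℕ} {M : Vec d → Set (Fin n × Fin n)} {v : Fin n → Vec d} {σ ρ L τ : ℝ}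
  {lam : ℝ≥0∞} {s : List Bool} {S V : Finset (Fin n)}

theorem ChainState.anti_stretch {θ : ℝ≥0∞} {τ' : ℝ} (h : ChainState M v ρ L θ s S lam τ)
    (hτ : τ' ≤ τ) : ChainState M v ρ L θ s S lam τ' := by
  obtain ⟨f, hfm, hfq, hfs, hfl, hfi⟩ := h
  exact ⟨f, hfm, hfq, fun x y hy u hu => ⟨(hfs x y hy u hu).1, hτ.trans (hfs x y hy u hu).2⟩,
    hfl, hfi⟩

/-- Short chains cannot have a large stretch with substantial probability. -/
theorem ChainState.le_card_mul_exp {θ : ℝ≥0∞} {y : Fin n} (hL : 0 < L) (hτ : 0 ≤ τ)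
    (hlam0 : lam ≠ 0) (hlam : lam ≠ ∞) (hy : y ∈ S) (h : ChainState M v ρ L θ s S lam τ) :
    θ ≤ n * ENNReal.ofReal (Real.exp (-τ ^ 2 / (2 * L))) := by
  obtain ⟨f, hfm, hfq, hfs, hfl, hfi⟩ := h
  let A : Fin n → Set (Vec d) := fun x => {u | ‖v y - v x‖ ^ 2 < L ∧ τ ≤ inner ℝ (v y - v x) u}
  have hAm : ∀ x, MeasurableSet (A x) := fun x =>
    (MeasurableSet.const (‖v y - v x‖ ^ 2 < L)).inter (measurableSet_le measurable_const
      (by fun_prop : Measurable fun u : Vec d => inner ℝ (v y - v x) u))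
  have hA : ∀ x, stdGaussian (Vec d) (A x) ≤ ENNReal.ofReal (Real.exp (-τ ^ 2 / (2 * L))) := by
    intro x
    by_cases hx : ‖v y - v x‖ ^ 2 < L
    · refine (measure_mono fun u hu => ?_).trans
        (stdGaussian_tail (-(v y - v x)) hL (by rw [norm_neg]; exact hx.le) hτ)
      rw [Set.mem_ofPred_eq, inner_neg_left]
      exact neg_le_neg hu.2
    · have : A x = ∅ := by
        ext u
        simp [A, hx]
      rw [this, measure_empty]
      exact zero_le
  -- If any chain reaches `y` along `u`, then `u` lies in `A x` for its start `x`, and one indicator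
  -- already pays for the total weight `lam`. This is the union bound over `n` starting points.
  have h1 : ∀ u, ∑ x, f x y u ≤ ∑ x, lam * (A x).indicator 1 u := by
    intro u
    by_cases hu : ∃ x, f x y u ≠ 0
    · obtain ⟨x, hx⟩ := hu
      refine (hfl y hy u).trans ?_
      refine le_trans (le_of_eq ?_) (Finset.single_le_sum
        (f := fun x => lam * (A x).indicator (1 : Vec d → ℝ≥0∞) u) (fun _ _ => zero_le)
        (Finset.mem_univ x))
      have : u ∈ A x := hfs x y hy u hx
      simp only [Set.indicator_of_mem this, Pi.one_apply, mul_one]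
    · push Not at hu
      rw [Finset.sum_eq_zero fun x _ => hu x]
      exact zero_le
  have h2 : θ * lam ≤ lam * (n * ENNReal.ofReal (Real.exp (-τ ^ 2 / (2 * L)))) := by
    refine (hfi y hy).trans ((lintegral_mono h1).trans ?_)
    rw [lintegral_finsetSum _ fun x _ => (measurable_one.indicator (hAm x)).const_mul _]
    calc _ ≤ ∑ _x : Fin n, lam * ENNReal.ofReal (Real.exp (-τ ^ 2 / (2 * L))) := by
          refine Finset.sum_le_sum fun x _ => ?_
          rw [lintegral_const_mul _ (measurable_one.indicator (hAm x)),
            lintegral_indicator_one (hAm x)]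
          gcongr
          exact hA x
      _ = _ := by
          rw [Finset.sum_const, Finset.card_univ, Fintype.card_fin, nsmul_eq_mul]
          ring
  rw [mul_comm θ] at h2
  exact (ENNReal.mul_le_mul_iff_right hlam0 hlam).1 h2

/-- Alternating between spreading and extending. -/
theorem exists_chainState (hM : ∀ x y, MeasurableSet {u | (x, y) ∈ M u})
    (hmatch : ∀ u, IsDirectedMatching (M u))
    (hstretch : ∀ u x y, (x, y) ∈ M u → σ ≤ inner ℝ (v y - v x) u)
    {η : ℝ} {θ ε β h₀ : NNReal} {a b κ : ℝ≥0∞} {R : ℕ} (hR : 1 ≤ R)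
    (hρ : ρ = 1 - 1 / (R : ℝ)) (hσ : 0 < σ) (hL : 0 < L)
    (hsum : ∀ y (T : Finset (Fin n)), ∑ z ∈ T, edgeProb M z y ≤ 1)
    (hη : ∀ z ∈ V, η ≤ ∑ y ∈ V, (edgeProb M z y).toReal) (hη0 : 0 ≤ η) (hβ : 0 < β)
    (hβ1 : β < 1) (hθ : 0 < θ) (hθ1 : θ ≤ 1) (hβη : 8 * (β : ℝ) ≤ η) (hθη : 8 * (θ : ℝ) ≤ η * β)
    (hε : 2 * ε ≤ β * θ) (hh : (h₀ : ℝ) ≤ η / 4 * (β : ℝ) ^ R) (hh0 : 0 < h₀)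
    (hat : a ≠ ∞) (hb0 : b ≠ 0) (hb1 : b ≤ 1) (hbh : b ≤ h₀) (hba : b ≤ a / 4)
    (hboost : ∀ F : Vec d → ℝ≥0∞, Measurable F → (∀ u, F u ≤ 1) →
      (θ : ℝ≥0∞) / 2 ≤ ∫⁻ u, F u ∂(stdGaussian (Vec d)) →
      stdGaussian (Vec d) {u | noiseOp ρ F u < a} ≤ ε)
    (htail : ∀ w : Vec d, ‖w‖ ^ 2 ≤ 4 * L →
      stdGaussian (Vec d) {u | inner ℝ w u < -(σ / 4)} ≤ θ / 4)
    (htail' : ∀ w : Vec d, ‖w‖ ^ 2 ≤ L →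
      stdGaussian (Vec d) {g | Real.sqrt (1 - ρ ^ 2) * inner ℝ w g < -(σ / 4)} ≤ a / 2 * ε)
    (hκ : κ ≤ θ / 4 * b ^ R)
    (hfar : ∀ y ∈ V, ∀ t : List Bool, t.length ≤ R → farMass M v ρ L t y ≤ κ)
    (hV : V.Nonempty) (k : ℕ) (hk : 2 * k ≤ R + 1) :
    ∃ s S lam, S ⊆ V ∧ S.Nonempty ∧ s.count true = k ∧ s.length ≤ 2 * k ∧ b ^ s.length ≤ lam ∧
      lam ≠ ∞ ∧ (β : ℝ) ^ k * V.card ≤ (β : ℝ) ^ (s.count false) * S.card ∧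
      ChainState M v ρ L θ s S lam (k * σ / 4) := by
  have hR0 : (1 : ℝ) ≤ R := by exact_mod_cast hR
  have hRi : 1 / (R : ℝ) ≤ 1 := by rw [div_le_one (by linarith)]; exact hR0
  have hRi0 : 0 < 1 / (R : ℝ) := by positivity
  have hρ0 : 0 ≤ ρ := by rw [hρ]; linarith
  have hρ1 : ρ ≤ 1 := by rw [hρ]; linarith
  have hρ2 : ρ ^ 2 ≤ 1 := pow_le_one₀ hρ0 hρ1
  have ha0 : a ≠ 0 := by
    rintro rfl
    exact hb0 (by simpa using hba)
  have hVpos : (0 : ℝ) < V.card := by exact_mod_cast hV.card_pos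
  have hβpos : (0 : ℝ) < β := by exact_mod_cast hβ
  have hβlt : (β : ℝ) < 1 := by exact_mod_cast hβ1
  have hθE : (θ : ℝ≥0∞) ≤ 1 := by exact_mod_cast hθ1
  -- The cardinality inequality acts as a potential: an extension costs a factor `β`, an independent
  -- step earns `1/β`. Since `S ⊆ V`, this bounds the number of independent letters by the number of
  -- correlated ones.
  induction k with
  | zero =>
    refine ⟨[], V, 1, subset_rfl, hV, rfl, le_rfl, by simp, by simp, by simp, ?_⟩
    simpa using ChainState.refl (M := M) (v := v) (ρ := ρ) (S := V) hL hθE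
  | succ k ih =>
    obtain ⟨s, S, lam, hSV, hSne, hsk, hslen, hblam, hlamt, hcard, hst⟩ := ih (by omega)
    have hβW : (β : ℝ) ^ (s.count false) ≤ 1 := pow_le_one₀ hβpos.le hβlt.le
    have hSpos : (0 : ℝ) < S.card := by exact_mod_cast hSne.card_pos
    have hScard : (β : ℝ) ^ R * V.card ≤ S.card := by
      calc (β : ℝ) ^ R * V.card ≤ (β : ℝ) ^ k * V.card := by
            refine mul_le_mul_of_nonneg_right ?_ hVpos.le
            exact pow_le_pow_of_le_one hβpos.le hβlt.le (by omega)
        _ ≤ (β : ℝ) ^ (s.count false) * S.card := hcard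
        _ ≤ 1 * S.card := by gcongr
        _ = S.card := one_mul _
    obtain ⟨j, T, hTV, hT, hTS, hTcov⟩ := exists_spread_card_le (ρ := ρ) (V := V) (S := S) (η := η)
      (β := β) (θ := θ) (h₀ := h₀) hsum hη hη0 hβpos hβlt (by exact_mod_cast hθ) hβη hθη
      (by
        calc (h₀ : ℝ) * V.card ≤ η / 4 * (β : ℝ) ^ R * V.card := by gcongr
          _ = η / 4 * ((β : ℝ) ^ R * V.card) := by ring
          _ ≤ _ := by gcongr)
      hh0 hSV hSne
    have hTVc : (T.card : ℝ) ≤ V.card := by exact_mod_cast Finset.card_le_card hTV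
    have hchain : (β : ℝ) ^ k * V.card ≤ (β : ℝ) ^ (s.count false + j) * T.card := by
      refine hcard.trans ?_
      rw [pow_add, mul_assoc]
      gcongr
    -- Otherwise the potential would force `T` to be larger than `V`. The word before the new
    -- correlated letter thus has length at most `2k`, and after it at most `2k + 1 ≤ R`.
    have hWU : s.count false + j ≤ k := by
      by_contra hlt
      push Not at hlt
      have h1 : (β : ℝ) ^ (s.count false + j) < (β : ℝ) ^ k :=
        pow_lt_pow_right_of_lt_one₀ hβpos hβlt hlt
      have h2 : (β : ℝ) ^ (s.count false + j) * T.card ≤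
          (β : ℝ) ^ (s.count false + j) * V.card := by gcongr
      have h3 := mul_lt_mul_of_pos_right h1 hVpos
      linarith
    have hlen : s.length = k + s.count false := by
      rw [← hsk, List.count_true_add_count_false]
    set s' := List.replicate j false ++ s with hs'
    have hs'len : s'.length = j + s.length := by simp [hs']
    have hble : ∀ m, m ≤ R → b ^ R ≤ b ^ m := fun m hm => pow_le_pow_right_of_le_one' hb1 hm
    have hlam1 : b ^ s'.length ≤ (h₀ : ℝ≥0∞) ^ j * lam := by
      rw [hs'len, pow_add]
      gcongr
    have hlam1t : (h₀ : ℝ≥0∞) ^ j * lam ≠ ∞ :=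
      ENNReal.mul_ne_top (ENNReal.pow_ne_top ENNReal.coe_ne_top) hlamt
    have hlam10 : (h₀ : ℝ≥0∞) ^ j * lam ≠ 0 := fun h0 =>
      pow_ne_zero _ hb0 (le_antisymm (hlam1.trans_eq h0) zero_le)
    have hlam2 : b ^ (true :: s').length ≤ (h₀ : ℝ≥0∞) ^ j * lam * (a / 4) := by
      rw [List.length_cons, pow_succ]
      gcongr
    have hst1 : ChainState M v ρ L (θ / 2) s' T ((h₀ : ℝ≥0∞) ^ j * lam) (k * σ / 4 - σ / 4) := by
      refine hst.spread hM hθE hlamt ENNReal.coe_ne_top htail (κ := κ) ?_ ?_ hT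
      · refine hκ.trans ?_
        gcongr
        exact (hble _ (by omega)).trans hlam1
      -- The prolonged word still has length at most `R`, so the far-mass assumption covers it.
      · intro y hy
        exact hfar y (hTV hy) _ (by rw [← hs']; omega)
    obtain ⟨S', hS'V, hS'card, hst2⟩ := hst1.extend hM hmatch hstretch (V := V) (κ := κ) hρ0 hρ2 ha0
      hat hlam10 hlam1t hθ.ne' hε hboost htail'
      (by
        refine hκ.trans ?_
        gcongr
        · exact ENNReal.div_le_of_le_mul (by
            calc (θ : ℝ≥0∞) = θ * 1 := (mul_one _).symm
              _ ≤ θ * 4 := by gcongr; norm_num)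
        · refine (hble (true :: s').length ?_).trans hlam2
          rw [List.length_cons]
          omega)
      (fun y hy => hfar y hy _ (by rw [List.length_cons]; omega)) hTcov
    have hcard' : (β : ℝ) ^ (k + 1) * V.card ≤ (β : ℝ) ^ ((true :: s').count false) * S'.card := by
      have h1 : (true :: s').count false = s.count false + j := by
        simp [hs', add_comm]
      rw [h1]
      calc (β : ℝ) ^ (k + 1) * V.card = β * ((β : ℝ) ^ k * V.card) := by ring
        _ ≤ β * ((β : ℝ) ^ (s.count false + j) * T.card) := by gcongr
        _ = (β : ℝ) ^ (s.count false + j) * (β * T.card) := by ring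
        _ ≤ _ := by gcongr
    refine ⟨true :: s', S', (h₀ : ℝ≥0∞) ^ j * lam * (a / 4), hS'V, ?_, ?_, ?_, hlam2,
      ENNReal.mul_ne_top hlam1t (ENNReal.div_ne_top hat (by simp)), hcard',
      hst2.anti_stretch ?_⟩
    · rw [← Finset.card_pos]
      by_contra h0
      have h1 : S'.card = 0 := by omega
      rw [h1, Nat.cast_zero, mul_zero] at hcard'
      have : 0 < (β : ℝ) ^ (k + 1) * V.card := by positivity
      linarith
    · simp [hs', hsk, List.count_replicate]
    · rw [List.length_cons]
      omega
    -- The edge gains `σ`. Spreading, the fluctuation of the noise, and the factor `ρ` cost at most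
    -- `σ/4` each, the last because `k σ/4 * (1/R) ≤ σ/4`. The net gain is at least `σ/4`.
    · have hkR : (k : ℝ) ≤ R := by exact_mod_cast (by omega : k ≤ R)
      have hkRi : (k : ℝ) * (1 / R) ≤ 1 := by
        rw [mul_one_div, div_le_one (by linarith)]
        exact hkR
      have h1 : ρ * (σ / 4) ≤ 1 * (σ / 4) := by gcongr
      have h2 : ρ * (k * σ / 4) = k * σ / 4 - (k * (1 / R)) * (σ / 4) := by rw [hρ]; ring
      have h3 : (k * (1 / (R : ℝ))) * (σ / 4) ≤ 1 * (σ / 4) := by gcongr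
      push_cast
      linarith

end Iterate

/-! ### A subset of the vertices where all degrees are large -/

/-- Maximise the total weight inside `V` minus `(δ/4) * V.card` over `V ⊆ Wᶜ`. Removing a vertex
loses twice its degree and saves `δ/4`, so by maximality degrees are at least `δ/8`. Deleting `W`
costs at most `2 * W.card`, so the maximum is at least `δ n / 4`, which forces `V` to be large. -/
theorem exists_subset_degree_ge {n : ℕ} {p : Fin n → Fin n → ℝ} {δ : ℝ} {W : Finset (Fin n)}
    (hsymm : ∀ x y, p x y = p y x) (hdiag : ∀ x, p x x = 0)
    (hrow : ∀ x (T : Finset (Fin n)), ∑ y ∈ T, p x y ≤ 1)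
    (hδ : δ * n ≤ ∑ x, ∑ y, p x y) (hW : (W.card : ℝ) ≤ δ * n / 4) (hδ0 : 0 ≤ δ) :
    ∃ V : Finset (Fin n), Disjoint V W ∧ δ * n / 4 ≤ V.card ∧
      ∀ x ∈ V, δ / 8 ≤ ∑ y ∈ V, p x y := by
  classical
  let Φ : Finset (Fin n) → ℝ := fun V => ∑ x ∈ V, ∑ y ∈ V, p x y - δ / 4 * V.card
  obtain ⟨V, hV, hmax⟩ := (Wᶜ.powerset).exists_max_image Φ ⟨∅, by simp⟩
  have hVW : V ⊆ Wᶜ := Finset.mem_powerset.1 hV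
  have hstart : δ * n / 4 ≤ Φ Wᶜ := by
    have h1 : ∑ x, ∑ y, p x y ≤ ∑ x ∈ Wᶜ, ∑ y ∈ Wᶜ, p x y + 2 * W.card := by
      have h2 : ∑ x, ∑ y, p x y = ∑ x ∈ Wᶜ, ∑ y ∈ Wᶜ, p x y + ∑ y ∈ W, ∑ x ∈ Wᶜ, p x y +
          ∑ x ∈ W, ∑ y, p x y := by
        rw [← Finset.sum_compl_add_sum W, Finset.sum_comm (s := W) (t := Wᶜ),
          ← Finset.sum_add_distrib]
        congr 1
        exact Finset.sum_congr rfl fun x _ => (Finset.sum_compl_add_sum W _).symm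
      have h3 : ∑ y ∈ W, ∑ x ∈ Wᶜ, p x y ≤ W.card := by
        calc _ ≤ ∑ y ∈ W, (1 : ℝ) := by
              refine Finset.sum_le_sum fun y _ => ?_
              simp only [fun x => hsymm x y]
              exact hrow y _
          _ = _ := by simp
      have h4 : ∑ x ∈ W, ∑ y, p x y ≤ W.card := by
        calc _ ≤ ∑ x ∈ W, (1 : ℝ) := Finset.sum_le_sum fun x _ => hrow x _
          _ = _ := by simp
      linarith
    have h5 : ((Wᶜ).card : ℝ) ≤ n := by
      exact_mod_cast (Finset.card_le_univ _).trans_eq (Fintype.card_fin n)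
    have h6 : δ / 4 * ((Wᶜ).card : ℝ) ≤ δ / 4 * n := by gcongr
    change _ ≤ ∑ x ∈ Wᶜ, ∑ y ∈ Wᶜ, p x y - δ / 4 * ((Wᶜ).card : ℝ)
    linarith
  have hΦ := hstart.trans (hmax _ (Finset.mem_powerset.2 subset_rfl))
  refine ⟨V, ?_, ?_, ?_⟩
  · exact Finset.disjoint_left.2 fun x hx => Finset.mem_compl.1 (hVW hx)
  · have h1 : ∑ x ∈ V, ∑ y ∈ V, p x y ≤ V.card := by
      calc _ ≤ ∑ x ∈ V, (1 : ℝ) := Finset.sum_le_sum fun x _ => hrow x _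
        _ = _ := by simp
    have h2 : 0 ≤ δ / 4 * (V.card : ℝ) := by positivity
    change _ ≤ ∑ x ∈ V, ∑ y ∈ V, p x y - δ / 4 * (V.card : ℝ) at hΦ
    linarith
  · intro x hx
    have h1 := hmax (V.erase x) (Finset.mem_powerset.2 ((Finset.erase_subset _ _).trans hVW))
    have h2 : ((V.erase x).card : ℝ) = V.card - 1 := by
      rw [Finset.card_erase_of_mem hx, Nat.cast_sub (Finset.card_pos.2 ⟨x, hx⟩), Nat.cast_one]
    have h3 : ∑ z ∈ V, ∑ y ∈ V, p z y =
        ∑ z ∈ V.erase x, ∑ y ∈ V.erase x, p z y + 2 * ∑ y ∈ V, p x y := by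
      rw [← Finset.add_sum_erase V _ hx]
      have h4 : ∑ z ∈ V.erase x, ∑ y ∈ V, p z y =
          ∑ z ∈ V.erase x, p z x + ∑ z ∈ V.erase x, ∑ y ∈ V.erase x, p z y := by
        rw [← Finset.sum_add_distrib]
        exact Finset.sum_congr rfl fun z _ => (Finset.add_sum_erase V _ hx).symm
      have h5 : ∑ z ∈ V.erase x, p z x = ∑ y ∈ V, p x y := by
        rw [← Finset.add_sum_erase V _ hx, hdiag, zero_add]
        exact Finset.sum_congr rfl fun z _ => hsymm z x
      rw [h4, h5]
      ring
    change ∑ z ∈ V.erase x, ∑ y ∈ V.erase x, p z y - δ / 4 * ((V.erase x).card : ℝ) ≤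
      ∑ z ∈ V, ∑ y ∈ V, p z y - δ / 4 * (V.card : ℝ) at h1
    rw [h2, h3] at h1
    linarith

/-! ### Some word produces many long chains -/

/-- The words of length at most `R`. -/
def words (R : ℕ) : Finset (List Bool) :=
  (Finset.range (R + 1)).biUnion fun r => (Finset.univ : Finset (Fin r → Bool)).image List.ofFn

theorem mem_words {R : ℕ} {t : List Bool} (h : t.length ≤ R) : t ∈ words R := by
  refine Finset.mem_biUnion.2 ⟨t.length, Finset.mem_range.2 (by omega), Finset.mem_image.2
    ⟨fun i => t.get i, Finset.mem_univ _, List.ofFn_get t⟩⟩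

theorem length_le_of_mem_words {R : ℕ} {t : List Bool} (h : t ∈ words R) : t.length ≤ R := by
  obtain ⟨r, hr, ht⟩ := Finset.mem_biUnion.1 h
  obtain ⟨f, -, rfl⟩ := Finset.mem_image.1 ht
  rw [List.length_ofFn]
  exact Nat.lt_succ_iff.1 (Finset.mem_range.1 hr)

theorem card_words_le (R : ℕ) : (words R).card ≤ 4 ^ R := by
  calc (words R).card ≤ ∑ r ∈ Finset.range (R + 1), 2 ^ R := by
        refine Finset.card_biUnion_le.trans (Finset.sum_le_sum fun r hr => ?_)
        refine Finset.card_image_le.trans ?_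
        simpa using Nat.pow_le_pow_right (n := 2) (by norm_num)
          (Nat.lt_succ_iff.1 (Finset.mem_range.1 hr))
    _ = (R + 1) * 2 ^ R := by simp
    _ ≤ 2 ^ R * 2 ^ R := Nat.mul_le_mul_right _ Nat.lt_two_pow_self
    _ = 4 ^ R := by rw [← mul_pow]; norm_num

/-- Markov's inequality summed over at most `4 ^ R` words, so that the surviving vertices are
harmless for every word at once. -/
theorem card_filter_farMass_le {n d : ℕ} {M : Vec d → Set (Fin n × Fin n)} {v : Fin n → Vec d}
    {ρ L : ℝ} {R : ℕ} {κ m : ℝ} (hm : 0 ≤ m)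
    (h : ∀ s : List Bool, s.length ≤ R → ∑ y, farMass M v ρ L s y ≤ ENNReal.ofReal m) :
    ∃ W : Finset (Fin n), W.card * κ ≤ 4 ^ R * m ∧
      ∀ y ∉ W, ∀ t : List Bool, t.length ≤ R → farMass M v ρ L t y ≤ ENNReal.ofReal κ := by
  classical
  refine ⟨Finset.univ.filter fun y => ∃ t ∈ words R, ENNReal.ofReal κ < farMass M v ρ L t y, ?_, ?_⟩
  · set W := Finset.univ.filter fun y => ∃ t ∈ words R, ENNReal.ofReal κ < farMass M v ρ L t y
    have h1 : (W.card : ℝ≥0∞) * ENNReal.ofReal κ ≤ (4 : ℝ≥0∞) ^ R * ENNReal.ofReal m := by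
      calc (W.card : ℝ≥0∞) * ENNReal.ofReal κ ≤
            ∑ y ∈ W, ∑ t ∈ words R, farMass M v ρ L t y := by
            rw [← nsmul_eq_mul]
            refine Finset.card_nsmul_le_sum _ _ _ fun y hy => ?_
            obtain ⟨t, ht, hty⟩ := (Finset.mem_filter.1 hy).2
            exact hty.le.trans (Finset.single_le_sum (f := fun t => farMass M v ρ L t y)
              (fun _ _ => zero_le) ht)
        _ ≤ ∑ y, ∑ t ∈ words R, farMass M v ρ L t y :=
            Finset.sum_le_sum_of_subset (Finset.subset_univ _)
        _ = ∑ t ∈ words R, ∑ y, farMass M v ρ L t y := Finset.sum_comm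
        _ ≤ ∑ t ∈ words R, ENNReal.ofReal m :=
            Finset.sum_le_sum fun t ht => h t (length_le_of_mem_words ht)
        _ = ((words R).card : ℝ≥0∞) * ENNReal.ofReal m := by rw [Finset.sum_const, nsmul_eq_mul]
        _ ≤ _ := by
            gcongr
            exact_mod_cast card_words_le R
    rw [← ENNReal.ofReal_natCast, ← ENNReal.ofReal_mul (Nat.cast_nonneg _),
      ← ENNReal.ofReal_ofNat, ← ENNReal.ofReal_pow (by norm_num),
      ← ENNReal.ofReal_mul (by positivity)] at h1
    exact (ENNReal.ofReal_le_ofReal_iff (by positivity)).1 h1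
  · intro y hy t ht
    by_contra hlt
    exact hy (Finset.mem_filter.2 ⟨Finset.mem_univ _, t, mem_words ht, not_le.1 hlt⟩)

/-- The empty word is not a possible sample, so no assumption is made about it; it has no far chains
anyway. -/
theorem farMass_nil {n d : ℕ} {M : Vec d → Set (Fin n × Fin n)} {v : Fin n → Vec d}
    {ρ L : ℝ} (hL : 0 < L) (y : Fin n) : farMass M v ρ L [] y = 0 := by
  have : ∀ x : Fin n, ∀ u : Vec d,
      (if L ≤ ‖v y - v x‖ ^ 2 then chainWeight M ρ [] x y u else 0) = 0 := by
    intro x u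
    split_ifs with h
    · have hne : x ≠ y := by
        rintro rfl
        simp only [sub_self, norm_zero] at h
        norm_num at h
        linarith
      simp [chainWeight, hne]
    · rfl
  simp [farMass, this]

theorem exp_neg_abs_log_le {x : ℝ} (hx : 0 < x) : Real.exp (-|Real.log x|) ≤ x := by
  calc _ ≤ Real.exp (Real.log x) := Real.exp_le_exp.2 (neg_abs_le _)
    _ = x := Real.exp_log hx

theorem four_le_exp_two : (4 : ℝ) ≤ Real.exp 2 := by
  have := Real.exp_one_gt_d9
  rw [show (2 : ℝ) = 1 + 1 by norm_num, Real.exp_add]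
  nlinarith

set_option maxHeartbeats 2000000 in
-- By contradiction. If every word had little far mass, nearly all vertices would be usable, and
-- about `R/2` rounds would produce short chains with more stretch than a Gaussian direction
-- permits.
theorem exists_word_farMass {σ δ : ℝ} (hσ : 0 < σ) (hδ : 0 < δ) :
    ∃ c₁ c₂ C : ℝ, 0 < c₁ ∧ 0 < c₂ ∧ 0 < C ∧ ∀ n d R : ℕ, 1 ≤ R →
      (R : ℝ) ≤ c₁ * Real.sqrt (Real.log n) → ∀ (v : Fin n → Vec d) (M : Vec d → Set (Fin n × Fin n)),
        IsMatchingCover σ δ v M → ∃ s : List Bool, s ≠ [] ∧ s.length ≤ R ∧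
          ENNReal.ofReal (Real.exp (-(C * (R : ℝ) ^ 2)) * n) ≤
            ∑ y, farMass M v (1 - 1 / (R : ℝ)) (c₂ * ((R : ℝ) ^ 2 / Real.log n)) s y := by
  set δ' := min δ 1 with hδ'
  have hδ'0 : 0 < δ' := lt_min hδ one_pos
  have hδ'1 : δ' ≤ 1 := min_le_right _ _
  set η : ℝ := δ' / 8 with hη
  have hη0 : 0 < η := by positivity
  have hη1 : η ≤ 1 := by linarith
  set β : ℝ := η / 8 with hβ
  have hβ0 : 0 < β := by positivity
  have hβ1 : β < 1 := by linarith
  set θ : ℝ := η * β / 8 with hθ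
  have hθ0 : 0 < θ := by positivity
  have hθ1 : θ ≤ 1 := by
    have : η * β ≤ 1 * 1 := by gcongr
    linarith
  set ε : ℝ := β * θ / 2 with hε
  have hε0 : 0 < ε := by positivity
  obtain ⟨C₀, hC₀, hboost⟩ := exists_noiseOp_lower_bound (θ := θ / 2) (ε := ε) (by positivity) hε0
  -- The three entries serve the final contradiction, the tail bound in spreading (squared distance
  -- `4L`), and the tail bound in extending, which must beat `exp (-C₀ R)`.
  set c₂ : ℝ := min (σ ^ 2 / 256) (min (σ ^ 2 / (128 * (|Real.log (θ / 4)| + 1)))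
    (σ ^ 2 / (64 * (C₀ + |Real.log (ε / 2)|)))) with hc₂
  have hc₂0 : 0 < c₂ := by
    refine lt_min (by positivity) (lt_min (by positivity) (by positivity))
  -- This makes `log n ≥ (|log θ| + 1) R²`, hence both `L ≤ c₂` and `n > 1/θ`.
  set c₁ : ℝ := 1 / Real.sqrt (|Real.log θ| + 1) with hc₁
  have hc₁0 : 0 < c₁ := by positivity
  -- A letter costs at most a factor `exp (-C₃ R)`: an independent one costs `h₀ = (η/4) β ^ R`, a
  -- correlated one `exp (-C₀ R) / 4`.
  set C₃ : ℝ := |Real.log (η / 4)| + |Real.log β| + C₀ + 2 with hC₃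
  have hC₃0 : 0 < C₃ := by positivity
  -- Besides the weight of a whole word, this pays for the `4 ^ R` words and for the constant in
  -- Markov's inequality.
  set C : ℝ := C₃ + 2 + |Real.log (δ' * θ / 16)| with hC
  have hC0 : 0 < C := by positivity
  have hc₂1 : c₂ ≤ σ ^ 2 / 256 := min_le_left _ _
  have hc₂2 : c₂ ≤ σ ^ 2 / (128 * (|Real.log (θ / 4)| + 1)) :=
    (min_le_right _ _).trans (min_le_left _ _)
  have hc₂3 : c₂ ≤ σ ^ 2 / (64 * (C₀ + |Real.log (ε / 2)|)) :=
    (min_le_right _ _).trans (min_le_right _ _)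
  have hδ'δ : δ' ≤ δ := min_le_left _ _
  clear_value C C₃ c₁ c₂ ε θ β η δ'
  refine ⟨c₁, c₂, C, hc₁0, hc₂0, hC0, fun n d R hR hRn v M hcov => ?_⟩
  have hR1 : (1 : ℝ) ≤ R := by exact_mod_cast hR
  have hRpos : (0 : ℝ) < R := by linarith
  have hRsq : (R : ℝ) ≤ (R : ℝ) ^ 2 := le_self_pow₀ hR1 two_ne_zero
  have hRsq1 : (1 : ℝ) ≤ (R : ℝ) ^ 2 := one_le_pow₀ hR1
  -- `n` is large
  have hlog : (|Real.log θ| + 1) * (R : ℝ) ^ 2 ≤ Real.log n ∧ 0 < Real.log n := by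
    have h1 : 0 < Real.sqrt (Real.log n) := by
      by_contra h0
      have : Real.sqrt (Real.log n) = 0 := le_antisymm (not_lt.1 h0) (Real.sqrt_nonneg _)
      rw [this, mul_zero] at hRn
      linarith
    have h2 : 0 < Real.log n := Real.sqrt_pos.1 h1
    refine ⟨?_, h2⟩
    have h3 : (R : ℝ) ^ 2 ≤ c₁ ^ 2 * Real.log n := by
      calc (R : ℝ) ^ 2 ≤ (c₁ * Real.sqrt (Real.log n)) ^ 2 := pow_le_pow_left₀ hRpos.le hRn 2
        _ = _ := by rw [mul_pow, Real.sq_sqrt h2.le]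
    have h4 : c₁ ^ 2 = 1 / (|Real.log θ| + 1) := by
      rw [hc₁, div_pow, one_pow, Real.sq_sqrt (by positivity)]
    rw [h4, div_mul_eq_mul_div, one_mul, le_div_iff₀ (by positivity)] at h3
    linarith
  obtain ⟨hlogθ, hlog0⟩ := hlog
  have hlogR : (R : ℝ) ^ 2 ≤ Real.log n := by
    have := abs_nonneg (Real.log θ)
    exact (le_mul_of_one_le_left (sq_nonneg _) (by linarith)).trans hlogθ
  have hn0 : (0 : ℝ) < n := by
    rcases Nat.eq_zero_or_pos n with h0 | h0
    · rw [h0, Nat.cast_zero, Real.log_zero] at hlog0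
      exact absurd hlog0 (lt_irrefl _)
    · exact_mod_cast h0
  set L : ℝ := c₂ * ((R : ℝ) ^ 2 / Real.log n) with hL
  have hL0 : 0 < L := by positivity
  have hLc : L ≤ c₂ := by
    rw [hL]
    refine mul_le_of_le_one_right hc₂0.le ?_
    rw [div_le_one hlog0]
    exact hlogR
  set ρ : ℝ := 1 - 1 / (R : ℝ) with hρ
  have hRi : 1 / (R : ℝ) ≤ 1 := by rw [div_le_one hRpos]; exact hR1
  have hRi0 : 0 < 1 / (R : ℝ) := by positivity
  have hρ0 : 0 ≤ ρ := by rw [hρ]; linarith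
  have hρ1 : ρ < 1 := by rw [hρ]; linarith
  have hρ2 : ρ ^ 2 < 1 := pow_lt_one₀ hρ0 hρ1 two_ne_zero
  have hRR : (R : ℝ) * (1 / R) = 1 := mul_one_div_cancel hRpos.ne'
  -- Both sides of the trade-off: here enough noise that Harnack loses only `exp (O(R))`, and in
  -- `hρR2` little enough that fluctuations have variance at most `2L/R`.
  have hρR : ρ ^ 2 ≤ R * (1 - ρ ^ 2) := by
    have : (R : ℝ) * (1 - ρ ^ 2) = 2 - 1 / R := by
      rw [hρ]
      linear_combination (2 - 1 / (R : ℝ)) * hRR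
    rw [this]
    linarith
  have hρR2 : 1 - ρ ^ 2 ≤ 2 / R := by
    have : 1 - ρ ^ 2 = 2 / R - (1 / R) ^ 2 := by rw [hρ]; ring
    rw [this]
    linarith [sq_nonneg (1 / (R : ℝ))]
  clear_value ρ L
  by_contra hcon
  push Not at hcon
  have hall : ∀ s : List Bool, s.length ≤ R → ∑ y, farMass M v ρ L s y ≤
      ENNReal.ofReal (Real.exp (-(C * (R : ℝ) ^ 2)) * n) := by
    intro s hs
    by_cases h0 : s = []
    · subst h0
      rw [Finset.sum_eq_zero fun y _ => farMass_nil hL0 y]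
      exact zero_le
    · exact (hcon s h0 hs).le
  set b : ℝ := Real.exp (-(C₃ * R)) with hb
  have hb0 : 0 < b := Real.exp_pos _
  have hb1 : b ≤ 1 := Real.exp_le_one_iff.2 (neg_nonpos.2 (by positivity))
  clear_value b
  obtain ⟨W, hWcard, hW⟩ := card_filter_farMass_le (κ := θ / 4 * b ^ R)
    (by positivity) hall
  have hWδ : (W.card : ℝ) ≤ δ' * n / 4 := by
    have h1 : b ^ R = Real.exp (-(C₃ * (R : ℝ) ^ 2)) := by
      rw [hb, ← Real.exp_nat_mul]
      congr 1
      ring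
    have h2 : (4 : ℝ) ^ R ≤ Real.exp (2 * (R : ℝ) ^ 2) := by
      have h3 := four_le_exp_two
      calc (4 : ℝ) ^ R ≤ (Real.exp 2) ^ R := by gcongr
        _ = Real.exp (R * 2) := (Real.exp_nat_mul 2 R).symm
        _ ≤ _ := Real.exp_le_exp.2 (by linarith)
    have h3 : (4 : ℝ) ^ R * Real.exp (-(C * (R : ℝ) ^ 2)) ≤
        δ' * θ / 16 * Real.exp (-(C₃ * (R : ℝ) ^ 2)) := by
      calc _ ≤ Real.exp (2 * (R : ℝ) ^ 2) * Real.exp (-(C * (R : ℝ) ^ 2)) := by gcongr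
        _ = Real.exp (-(|Real.log (δ' * θ / 16)| * (R : ℝ) ^ 2)) *
            Real.exp (-(C₃ * (R : ℝ) ^ 2)) := by
            rw [← Real.exp_add, ← Real.exp_add, hC]
            congr 1
            ring
        _ ≤ _ := by
            gcongr
            refine le_trans (Real.exp_le_exp.2 ?_) (exp_neg_abs_log_le (by positivity))
            exact neg_le_neg (le_mul_of_one_le_right (abs_nonneg _) hRsq1)
    have h4 : (W.card : ℝ) * (θ / 4 * b ^ R) ≤ δ' * n / 4 * (θ / 4 * b ^ R) := by
      calc _ ≤ (4 : ℝ) ^ R * Real.exp (-(C * (R : ℝ) ^ 2)) * n := by linarith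
        _ ≤ δ' * θ / 16 * Real.exp (-(C₃ * (R : ℝ) ^ 2)) * n := by gcongr
        _ = _ := by rw [h1]; ring
    exact le_of_mul_le_mul_right h4 (by positivity)
  have hδsum : δ' * n ≤ ∑ x, ∑ y, (edgeProb M x y).toReal :=
    (mul_le_mul_of_nonneg_right hδ'δ hn0.le).trans hcov.le_sum_edgeProb
  have hreal : ∀ (f : Fin n → Fin n × Fin n) (T : Finset (Fin n)),
      ∑ z ∈ T, edgeProb M (f z).1 (f z).2 ≤ 1 →
      ∑ z ∈ T, (edgeProb M (f z).1 (f z).2).toReal ≤ 1 := by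
    intro f T h
    rw [← ENNReal.toReal_sum fun z _ => edgeProb_ne_top _ _]
    exact ENNReal.toReal_le_of_le_ofReal zero_le_one (by simpa using h)
  obtain ⟨V, hVW, hVcard, hVdeg⟩ := exists_subset_degree_ge
    (p := fun x y => (edgeProb M x y).toReal) (W := W)
    (fun x y => by rw [hcov.edgeProb_comm]) (fun x => by rw [edgeProb_self hcov.matching]; rfl)
    (fun x T => hreal (fun y => (x, y)) T (hcov.sum_edgeProb_right_le x T)) hδsum hWδ hδ'0.le
  rw [← hη] at hVdeg
  have hVne : V.Nonempty := by
    rw [← Finset.card_pos]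
    have : (0 : ℝ) < V.card := lt_of_lt_of_le (by positivity) hVcard
    exact_mod_cast this
  have hτe : ∀ x : ℝ, 0 ≤ x → (x.toNNReal : ℝ) = x := fun x hx => Real.coe_toNNReal x hx
  have hquarter : ENNReal.ofReal θ / 4 = ENNReal.ofReal (θ / 4) := by
    rw [ENNReal.ofReal_div_of_pos (by norm_num), ENNReal.ofReal_ofNat]
  have hhalf : ENNReal.ofReal θ / 2 = ENNReal.ofReal (θ / 2) := by
    rw [ENNReal.ofReal_div_of_pos (by norm_num), ENNReal.ofReal_ofNat]
  obtain ⟨s, S, lam, -, ⟨y, hy⟩, -, -, hblam, hlamt, -, hst⟩ := exists_chainState (v := v)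
    (ρ := ρ) (L := L) (σ := σ) (V := V)
    hcov.measurable hcov.matching hcov.stretch (η := η) (θ := θ.toNNReal) (ε := ε.toNNReal)
    (β := β.toNNReal) (h₀ := (η / 4 * β ^ R).toNNReal)
    (a := ENNReal.ofReal (Real.exp (-(C₀ * R)))) (b := ENNReal.ofReal b)
    (κ := ENNReal.ofReal (θ / 4 * b ^ R)) hR hρ hσ hL0 hcov.sum_edgeProb_left_le hVdeg hη0.le
    (Real.toNNReal_pos.2 hβ0) (by rwa [Real.toNNReal_lt_one]) (Real.toNNReal_pos.2 hθ0)
    (Real.toNNReal_le_one.2 hθ1) (by rw [hτe _ hβ0.le]; linarith)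
    (by rw [hτe _ hβ0.le, hτe _ hθ0.le]; linarith)
    (by
      rw [← NNReal.coe_le_coe]
      push_cast
      rw [hτe _ hβ0.le, hτe _ hθ0.le, hτe _ hε0.le]
      linarith)
    (by rw [hτe _ hβ0.le, hτe _ (by positivity)]) (Real.toNNReal_pos.2 (by positivity))
    ENNReal.ofReal_ne_top (by simpa using hb0) (by simpa using hb1)
    (by
      refine ENNReal.ofReal_le_ofReal ?_
      calc b ≤ Real.exp (-|Real.log (η / 4)|) * (Real.exp (-|Real.log β|)) ^ R := by
            rw [← Real.exp_nat_mul, ← Real.exp_add, hb, Real.exp_le_exp, hC₃]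
            have h1 : |Real.log (η / 4)| ≤ |Real.log (η / 4)| * R :=
              le_mul_of_one_le_right (abs_nonneg _) hR1
            have h2 : 0 ≤ C₀ * R := by positivity
            linarith
        _ ≤ _ := by
            gcongr
            · exact exp_neg_abs_log_le (by positivity)
            · exact exp_neg_abs_log_le hβ0)
    (by
      rw [← ENNReal.ofReal_ofNat, ← ENNReal.ofReal_div_of_pos (by norm_num)]
      refine ENNReal.ofReal_le_ofReal ?_
      rw [le_div_iff₀ (by norm_num)]
      have h4 := four_le_exp_two
      calc b * 4 ≤ b * Real.exp 2 := by gcongr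
        _ = Real.exp (-(C₃ * R) + 2) := by rw [hb, Real.exp_add]
        _ ≤ _ := by
            rw [Real.exp_le_exp, hC₃]
            have h1 : 0 ≤ |Real.log (η / 4)| * R := by positivity
            have h2 : 0 ≤ |Real.log β| * R := by positivity
            linarith)
    (by
      intro F hF hF1 hFi
      refine hboost d R ρ hR1 hρ2 hρR F hF hF1 (le_trans ?_ hFi)
      exact hhalf.ge)
    (by
      intro w hw
      refine (measure_mono fun u hu => ?_).trans ((stdGaussian_tail w (V := 4 * L) (t := σ / 4)
        (by positivity) hw (by positivity)).trans ?_)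
      · simp only [Set.mem_ofPred_eq] at hu ⊢
        exact hu.le
      · refine le_trans ?_ hquarter.ge
        refine ENNReal.ofReal_le_ofReal (le_trans (Real.exp_le_exp.2 ?_)
          (exp_neg_abs_log_le (by positivity)))
        have h1 : L ≤ σ ^ 2 / (128 * (|Real.log (θ / 4)| + 1)) :=
          hLc.trans hc₂2
        rw [le_div_iff₀ (by positivity)] at h1
        rw [neg_div, neg_le_neg_iff, le_div_iff₀ (by positivity)]
        linarith)
    (by
      intro w hw
      have hnorm : ‖Real.sqrt (1 - ρ ^ 2) • w‖ ^ 2 ≤ 2 / R * L := by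
        rw [norm_smul, mul_pow, Real.norm_eq_abs, sq_abs, Real.sq_sqrt (by linarith)]
        exact mul_le_mul hρR2 hw (sq_nonneg _) (by positivity)
      refine (measure_mono fun u hu => ?_).trans ((stdGaussian_tail (Real.sqrt (1 - ρ ^ 2) • w)
        (V := 2 / R * L) (t := σ / 4) (by positivity) hnorm (by positivity)).trans ?_)
      · simp only [Set.mem_ofPred_eq, real_inner_smul_left] at hu ⊢
        exact hu.le
      · change _ ≤ ENNReal.ofReal (Real.exp (-(C₀ * R))) / 2 * ENNReal.ofReal ε
        rw [← ENNReal.ofReal_ofNat, ← ENNReal.ofReal_div_of_pos (by norm_num),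
          ← ENNReal.ofReal_mul (by positivity)]
        refine ENNReal.ofReal_le_ofReal ?_
        calc _ ≤ Real.exp (-(C₀ * R)) * Real.exp (-|Real.log (ε / 2)|) := by
              rw [← Real.exp_add, Real.exp_le_exp, ← neg_add, neg_div, neg_le_neg_iff,
                le_div_iff₀ (by positivity)]
              have h1 : L ≤ σ ^ 2 / (64 * (C₀ + |Real.log (ε / 2)|)) :=
                hLc.trans hc₂3
              rw [le_div_iff₀ (by positivity)] at h1
              have h2 : |Real.log (ε / 2)| ≤ |Real.log (ε / 2)| * R :=
                le_mul_of_one_le_right (abs_nonneg _) hR1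
              calc (C₀ * R + |Real.log (ε / 2)|) * (2 * (2 / R * L)) ≤
                    (C₀ * R + |Real.log (ε / 2)| * R) * (2 * (2 / R * L)) := by gcongr
                _ = 4 * (L * (C₀ + |Real.log (ε / 2)|)) * (R * (1 / R)) := by ring
                _ ≤ _ := by rw [hRR]; linarith
          _ ≤ Real.exp (-(C₀ * R)) * (ε / 2) := by
              gcongr
              exact exp_neg_abs_log_le (by positivity)
          _ = _ := by ring)
    (by
      rw [ENNReal.ofReal_mul (by positivity), ENNReal.ofReal_pow hb0.le]
      gcongr
      exact hquarter.ge)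
    (fun y hy t ht => hW y (Finset.disjoint_left.1 hVW hy) t ht) hVne ((R + 1) / 2) (by omega)
  have hlam0 : lam ≠ 0 := fun h0 => pow_ne_zero s.length
    (by simpa using hb0 : ENNReal.ofReal b ≠ 0) (le_antisymm (hblam.trans_eq h0) zero_le)
  have hend := hst.le_card_mul_exp hL0 (by positivity) hlam0 hlamt hy
  -- The largest number of rounds with `2k ≤ R + 1`; it is at least `R/2`.
  set k : ℕ := (R + 1) / 2 with hk
  have hkR : (R : ℝ) / 2 ≤ k := by
    have : R ≤ 2 * k := by omega
    have : (R : ℝ) ≤ 2 * k := by exact_mod_cast this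
    linarith
  -- Stretch `Rσ/8` over squared length `c₂ R² / log n` has probability at most `n⁻²`, which
  -- survives the union bound over `n` starts.
  have hexp : -((k : ℝ) * σ / 4) ^ 2 / (2 * L) ≤ -(2 * Real.log n) := by
    rw [neg_div, neg_le_neg_iff, le_div_iff₀ (by positivity)]
    have h1 : (R : ℝ) * σ / 8 ≤ k * σ / 4 := by
      have := mul_le_mul_of_nonneg_right hkR hσ.le
      linarith
    have h2 : ((R : ℝ) * σ / 8) ^ 2 ≤ (k * σ / 4) ^ 2 := pow_le_pow_left₀ (by positivity) h1 2
    have h4 : 2 * Real.log n * (2 * L) = 4 * c₂ * (R : ℝ) ^ 2 := by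
      rw [hL]; field_simp; ring
    rw [h4]
    have h5 : 4 * c₂ * (R : ℝ) ^ 2 ≤ 4 * (σ ^ 2 / 256) * (R : ℝ) ^ 2 := by gcongr
    linarith
  change ENNReal.ofReal θ ≤ _ at hend
  rw [← ENNReal.ofReal_natCast, ← ENNReal.ofReal_mul hn0.le,
    ENNReal.ofReal_le_ofReal_iff (by positivity)] at hend
  have h1 : θ ≤ Real.exp (-Real.log n) := by
    calc θ ≤ n * Real.exp (-((k : ℝ) * σ / 4) ^ 2 / (2 * L)) := hend
      _ ≤ n * Real.exp (-(2 * Real.log n)) := by gcongr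
      _ = Real.exp (Real.log n) * Real.exp (-(2 * Real.log n)) := by rw [Real.exp_log hn0]
      _ = _ := by rw [← Real.exp_add]; congr 1; ring
  have h2 : Real.exp (-|Real.log θ|) ≤ Real.exp (-Real.log n) :=
    (exp_neg_abs_log_le hθ0).trans h1
  rw [Real.exp_le_exp] at h2
  have h3 : |Real.log θ| + 1 ≤ (|Real.log θ| + 1) * (R : ℝ) ^ 2 :=
    le_mul_of_one_le_right (by positivity) hRsq1
  linarith

/-! ### Infinite products of copies of one probability measure -/

section Product

variable {ι κ X : Type*} [MeasurableSpace X] (μ : Measure X) [IsProbabilityMeasure μ]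

/-- Resampling one coordinate preserves a product measure. -/
theorem measurePreserving_update_infinitePi [DecidableEq ι] (k : ι) :
    MeasurePreserving (fun p : (ι → X) × X => Function.update p.1 k p.2)
      ((Measure.infinitePi fun _ : ι => μ).prod μ) (Measure.infinitePi fun _ : ι => μ) := by
  have hm : Measurable (fun p : (ι → X) × X => Function.update p.1 k p.2) :=
    measurable_update'
  refine ⟨hm, Measure.eq_infinitePi _ fun s t ht => ?_⟩
  rw [Measure.map_apply hm (.pi s.countable_toSet fun i _ => ht i)]
  by_cases hk : k ∈ s
  · have : (fun p : (ι → X) × X => Function.update p.1 k p.2) ⁻¹' Set.pi s t =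
        Set.pi (s.erase k : Finset ι) t ×ˢ t k := by
      ext p
      simp only [Set.mem_preimage, Set.mem_pi, Set.mem_prod, Finset.mem_coe, Finset.mem_erase]
      constructor
      · intro h
        refine ⟨fun i hi => ?_, ?_⟩
        · simpa [Function.update_of_ne hi.1] using h i hi.2
        · simpa using h k hk
      · rintro ⟨h1, h2⟩ i hi
        by_cases hik : i = k
        · subst hik; simpa using h2
        · simpa [Function.update_of_ne hik] using h1 i ⟨hik, hi⟩
    rw [this, Measure.prod_prod, Measure.infinitePi_pi _ fun i _ => ht i,
      Finset.prod_erase_mul s (fun i => μ (t i)) hk]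
  · have : (fun p : (ι → X) × X => Function.update p.1 k p.2) ⁻¹' Set.pi s t =
        Set.pi s t ×ˢ Set.univ := by
      ext p
      simp only [Set.mem_preimage, Set.mem_pi, Set.mem_prod, Finset.mem_coe, Set.mem_univ, and_true]
      refine forall₂_congr fun i hi => ?_
      rw [Function.update_of_ne (fun h : i = k => hk (h ▸ hi))]
    rw [this, Measure.prod_prod, Measure.infinitePi_pi _ fun i _ => ht i, measure_univ, mul_one]

/-- A coordinate on which the rest of the integrand does not depend can be integrated out. -/
theorem lintegral_infinitePi_coord [DecidableEq ι] (k : ι) {H : (ι → X) → X → ℝ≥0∞}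
    (hH : Measurable (Function.uncurry H))
    (hk : ∀ g ξ ξ', H (Function.update g k ξ') ξ = H g ξ) :
    ∫⁻ g, H g (g k) ∂(Measure.infinitePi fun _ : ι => μ) =
      ∫⁻ g, (∫⁻ ξ, H g ξ ∂μ) ∂(Measure.infinitePi fun _ : ι => μ) := by
  have hm : Measurable fun g : ι → X => H g (g k) :=
    hH.comp (measurable_id.prodMk (measurable_pi_apply k))
  rw [← (measurePreserving_update_infinitePi μ k).lintegral_comp hm,
    lintegral_prod (fun p : (ι → X) × X => H (Function.update p.1 k p.2)
      (Function.update p.1 k p.2 k)) (hm.comp measurable_update').aemeasurable]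
  simp only [hk, Function.update_self]

/-- Distinct coordinates of a product measure are again distributed as a product. -/
theorem infinitePi_map_comp {φ : κ → ι} (hφ : Function.Injective φ) :
    (Measure.infinitePi fun _ : ι => μ).map (fun g k => g (φ k)) =
      Measure.infinitePi fun _ : κ => μ := by
  classical
  have hm : Measurable fun (g : ι → X) (k : κ) => g (φ k) := by fun_prop
  refine Measure.eq_infinitePi _ fun s t ht => ?_
  rw [Measure.map_apply hm (.pi s.countable_toSet fun i _ => ht i)]
  have hinv : ∀ k, Function.extend φ t (fun _ => Set.univ) (φ k) = t k := fun k =>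
    hφ.extend_apply _ _ k
  have : (fun (g : ι → X) (k : κ) => g (φ k)) ⁻¹' Set.pi s t =
      Set.pi (s.image φ : Finset ι) (Function.extend φ t fun _ => Set.univ) := by
    ext g
    simp [Set.mem_pi, hinv]
  rw [this, Measure.infinitePi_pi, Finset.prod_image hφ.injOn]
  · simp [hinv]
  · intro i hi
    obtain ⟨k, -, rfl⟩ := Finset.mem_image.1 hi
    rw [hinv]; exact ht k

end Product

/-! ### Shuffles and words -/

section Shuffles

variable {R : ℕ}

/-- The kinds of the entries of a shuffle: `true` at the positions of the first list. -/
def shuffleLetter (e : Fin R ⊕ Fin R ≃ Fin (R + R)) (i : ℕ) : Bool :=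
  if h : i < R + R then (e.symm ⟨i, h⟩).isLeft else false

theorem shuffleLetter_inl (e : Fin R ⊕ Fin R ≃ Fin (R + R)) (k : Fin R) :
    shuffleLetter e (e (Sum.inl k)) = true := by
  simp [shuffleLetter]

theorem shuffleLetter_inr (e : Fin R ⊕ Fin R ≃ Fin (R + R)) (k : Fin R) :
    shuffleLetter e (e (Sum.inr k)) = false := by
  simp [shuffleLetter]

theorem exists_inl_of_shuffleLetter {e : Fin R ⊕ Fin R ≃ Fin (R + R)} {i : Fin (R + R)}
    (h : shuffleLetter e i = true) : ∃ k, e (Sum.inl k) = i := by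
  cases hs : e.symm i with
  | inl k => exact ⟨k, by rw [← hs, Equiv.apply_symm_apply]⟩
  | inr k => simp [shuffleLetter, hs] at h

theorem exists_inr_of_shuffleLetter {e : Fin R ⊕ Fin R ≃ Fin (R + R)} {i : Fin (R + R)}
    (h : shuffleLetter e i = false) : ∃ k, e (Sum.inr k) = i := by
  cases hs : e.symm i with
  | inl k => simp [shuffleLetter, hs] at h
  | inr k => exact ⟨k, by rw [← hs, Equiv.apply_symm_apply]⟩

theorem mem_shuffles {e : Fin R ⊕ Fin R ≃ Fin (R + R)} :
    e ∈ shuffles R ↔ StrictMono (fun i : Fin R => e (Sum.inl i)) ∧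
      StrictMono (fun i : Fin R => e (Sum.inr i)) := by
  simp [shuffles]

/-- As order is preserved, the entries of the first list standing before its `k`-th entry are
exactly its predecessors. Hence letters determine indices, and with them the whole shuffle. -/
theorem count_shuffleLetter_inl {e : Fin R ⊕ Fin R ≃ Fin (R + R)} (he : e ∈ shuffles R)
    (k : Fin R) : Nat.count (fun j => shuffleLetter e j = true) (e (Sum.inl k)) = k := by
  have hmono := (mem_shuffles.1 he).1
  rw [Nat.count_eq_card_filter_range, ← Fin.card_Iio k]
  symm
  refine Finset.card_bij (fun k' _ => (e (Sum.inl k') : ℕ)) (fun k' hk' => ?_)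
    (fun a _ b _ hab => ?_) (fun j hj => ?_)
  · exact Finset.mem_filter.2 ⟨Finset.mem_range.2 (hmono (Finset.mem_Iio.1 hk')),
      shuffleLetter_inl e k'⟩
  · exact Sum.inl_injective (e.injective (Fin.ext hab))
  · obtain ⟨hj1, hj2⟩ := Finset.mem_filter.1 hj
    have hlt := Finset.mem_range.1 hj1
    obtain ⟨k', hk'⟩ := exists_inl_of_shuffleLetter (e := e) (i := ⟨j, by omega⟩) hj2
    refine ⟨k', Finset.mem_Iio.2 (hmono.lt_iff_lt.1 ?_), by rw [hk']⟩
    change e (Sum.inl k') < _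
    rw [hk']
    exact hlt

theorem count_shuffleLetter_inr {e : Fin R ⊕ Fin R ≃ Fin (R + R)} (he : e ∈ shuffles R)
    (k : Fin R) : Nat.count (fun j => shuffleLetter e j = false) (e (Sum.inr k)) = k := by
  have hmono := (mem_shuffles.1 he).2
  rw [Nat.count_eq_card_filter_range, ← Fin.card_Iio k]
  symm
  refine Finset.card_bij (fun k' _ => (e (Sum.inr k') : ℕ)) (fun k' hk' => ?_)
    (fun a _ b _ hab => ?_) (fun j hj => ?_)
  · exact Finset.mem_filter.2 ⟨Finset.mem_range.2 (hmono (Finset.mem_Iio.1 hk')),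
      shuffleLetter_inr e k'⟩
  · exact Sum.inr_injective (e.injective (Fin.ext hab))
  · obtain ⟨hj1, hj2⟩ := Finset.mem_filter.1 hj
    have hlt := Finset.mem_range.1 hj1
    obtain ⟨k', hk'⟩ := exists_inr_of_shuffleLetter (e := e) (i := ⟨j, by omega⟩) hj2
    refine ⟨k', Finset.mem_Iio.2 (hmono.lt_iff_lt.1 ?_), by rw [hk']⟩
    change e (Sum.inr k') < _
    rw [hk']
    exact hlt

theorem shuffleLetter_injOn {e f : Fin R ⊕ Fin R ≃ Fin (R + R)} (he : e ∈ shuffles R)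
    (hf : f ∈ shuffles R) (h : ∀ i < R + R, shuffleLetter e i = shuffleLetter f i) : e = f := by
  have hcount : ∀ (b : Bool) (i : ℕ), i ≤ R + R →
      Nat.count (fun j => shuffleLetter e j = b) i =
        Nat.count (fun j => shuffleLetter f j = b) i := by
    intro b i hi
    rw [Nat.count_eq_card_filter_range, Nat.count_eq_card_filter_range]
    congr 1
    refine Finset.filter_congr fun j hj => ?_
    rw [h j (by have := Finset.mem_range.1 hj; omega)]
  ext1 x
  rcases x with k | k
  · obtain ⟨k', hk'⟩ := exists_inl_of_shuffleLetter (e := f) (i := e (Sum.inl k))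
      (by rw [← h _ (e (Sum.inl k)).2, shuffleLetter_inl])
    have h1 := hcount true (e (Sum.inl k)) (e (Sum.inl k)).2.le
    rw [count_shuffleLetter_inl he, ← hk', count_shuffleLetter_inl hf] at h1
    rw [← hk', Fin.ext h1]
  · obtain ⟨k', hk'⟩ := exists_inr_of_shuffleLetter (e := f) (i := e (Sum.inr k))
      (by rw [← h _ (e (Sum.inr k)).2, shuffleLetter_inr])
    have h1 := hcount false (e (Sum.inr k)) (e (Sum.inr k)).2.le
    rw [count_shuffleLetter_inr he, ← hk', count_shuffleLetter_inr hf] at h1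
    rw [← hk', Fin.ext h1]

/-- Every set of `R` positions is the set of positions of the first list in some shuffle. -/
theorem exists_shuffle (S : Finset (Fin (R + R))) (hS : S.card = R) :
    ∃ e ∈ shuffles R, ∀ i : Fin (R + R), shuffleLetter e i = true ↔ i ∈ S := by
  have hc : Sᶜ.card = R := by rw [Finset.card_compl, hS, Fintype.card_fin]; omega
  refine ⟨finSumEquivOfFinset hS hc, mem_shuffles.2 ⟨fun a b hab => ?_, fun a b hab => ?_⟩,
    fun i => ⟨fun h => ?_, fun h => ?_⟩⟩
  · simpa using hab
  · simpa using hab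
  · obtain ⟨k, hk⟩ := exists_inl_of_shuffleLetter h
    rw [← hk, finSumEquivOfFinset_inl]
    exact Finset.orderEmbOfFin_mem _ _ _
  · by_contra hcon
    obtain ⟨k, hk⟩ := exists_inr_of_shuffleLetter (Bool.eq_false_of_not_eq_true hcon)
    rw [← hk, finSumEquivOfFinset_inr] at h
    exact Finset.mem_compl.1 (Finset.orderEmbOfFin_mem _ _ _) h

/-- A shuffle amounts to the set of positions of the first list, an arbitrary `R`-subset of the `R +
R` positions. -/
theorem card_shuffles (R : ℕ) : (shuffles R).card = (R + R).choose R := by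
  classical
  have h1 : (Finset.powersetCard R (Finset.univ : Finset (Fin (R + R)))).card =
      (R + R).choose R := by simp
  rw [← h1]
  refine Finset.card_bij (fun e _ => Finset.univ.filter fun i : Fin (R + R) =>
    shuffleLetter e i = true) (fun e he => ?_) (fun e he f hf hef => ?_) (fun S hS => ?_)
  · refine Finset.mem_powersetCard.2 ⟨Finset.subset_univ _, ?_⟩
    refine Eq.trans ?_ (Finset.card_fin R)
    symm
    refine Finset.card_bij (fun k _ => e (Sum.inl k)) (fun k _ => ?_) (fun a _ b _ hab => ?_)
      (fun i hi => ?_)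
    · simp [shuffleLetter_inl]
    · exact Sum.inl_injective (e.injective hab)
    · obtain ⟨k, hk⟩ := exists_inl_of_shuffleLetter (Finset.mem_filter.1 hi).2
      exact ⟨k, Finset.mem_univ _, hk⟩
  · refine shuffleLetter_injOn he hf fun i hi => ?_
    have := Finset.ext_iff.1 hef ⟨i, hi⟩
    simp only [Finset.mem_filter, Finset.mem_univ, true_and] at this
    exact Bool.eq_iff_iff.2 this
  · obtain ⟨e, he, h⟩ := exists_shuffle S (Finset.mem_powersetCard.1 hS).2
    exact ⟨e, he, by ext i; simp [h]⟩

/-- The first `m` letters of a sequence, the last one first. -/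
def wordOf (p : ℕ → Bool) : ℕ → List Bool
  | 0 => []
  | m + 1 => p m :: wordOf p m

theorem count_wordOf (p : ℕ → Bool) (b : Bool) (m : ℕ) :
    (wordOf p m).count b = Nat.count (fun j => p j = b) m := by
  induction m with
  | zero => rfl
  | succ m ih => rw [wordOf, List.count_cons, ih, Nat.count_succ]; simp

theorem wordOf_congr {p q : ℕ → Bool} {m : ℕ} (h : ∀ i < m, p i = q i) :
    wordOf p m = wordOf q m := by
  induction m with
  | zero => rfl
  | succ m ih => rw [wordOf, wordOf, h m (by omega), ih fun i hi => h i (by omega)]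

theorem exists_wordOf (s : List Bool) : ∃ p, wordOf p s.length = s := by
  induction s with
  | nil => exact ⟨fun _ => false, rfl⟩
  | cons b s ih =>
    obtain ⟨p, hp⟩ := ih
    refine ⟨Function.update p s.length b, ?_⟩
    rw [List.length_cons, wordOf, Function.update_self]
    congr 1
    conv_rhs => rw [← hp]
    exact wordOf_congr fun i hi => Function.update_of_ne hi.ne _ _

/-- Every word of length at most `R` is the beginning of some shuffle. -/
theorem exists_shuffle_wordOf (s : List Bool) (hs : s.length ≤ R) :
    ∃ e ∈ shuffles R, wordOf (shuffleLetter e) s.length = s := by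
  classical
  obtain ⟨p, hp⟩ := exists_wordOf s
  set m := s.length
  -- An `R`-set of positions is chosen between those where the word prescribes `true` and these
  -- together with all free positions from `m` on. Both cardinality conditions follow from `m ≤ R`.
  have hsub : (Finset.univ.filter fun i : Fin (R + R) => (i : ℕ) < m ∧ p i = true) ⊆
      Finset.univ.filter fun i : Fin (R + R) => (i : ℕ) < m → p i = true := by
    intro i hi
    simp only [Finset.mem_filter, Finset.mem_univ, true_and] at hi ⊢
    exact fun _ => hi.2
  have hlt : (Finset.univ.filter fun i : Fin (R + R) => (i : ℕ) < m).card = m := by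
    rw [Fin.card_filter_val_lt]; omega
  obtain ⟨S, hS1, hS2, hS⟩ := Finset.exists_subsuperset_card_eq hsub (n := R)
    ((Finset.card_le_card (fun i hi => by
      simp only [Finset.mem_filter, Finset.mem_univ, true_and] at hi ⊢; exact hi.1)).trans
      (hlt.trans_le hs))
    (by
      have h1 : (Finset.univ.filter fun i : Fin (R + R) => (i : ℕ) < m)ᶜ ⊆
          Finset.univ.filter fun i : Fin (R + R) => (i : ℕ) < m → p i = true := by
        intro i hi
        simp only [Finset.mem_compl, Finset.mem_filter, Finset.mem_univ, true_and] at hi ⊢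
        exact fun h => absurd h hi
      have h2 := Finset.card_le_card h1
      rw [Finset.card_compl, hlt, Fintype.card_fin] at h2
      omega)
  obtain ⟨e, he, hl⟩ := exists_shuffle S hS
  refine ⟨e, he, ?_⟩
  rw [← hp]
  refine wordOf_congr fun i hi => ?_
  have hi' : i < R + R := by omega
  refine Bool.eq_iff_iff.2 ((hl ⟨i, hi'⟩).trans ⟨fun h => ?_, fun h => hS1 ?_⟩)
  · exact (Finset.mem_filter.1 (hS2 h)).2 hi
  · exact Finset.mem_filter.2 ⟨Finset.mem_univ _, hi, h⟩

/-- The `i`-th entry of a list in which the letter `true` stands for the next vector of the first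
source, and `false` for the next vector of the second source. -/
def wordVec {d : ℕ} (p : ℕ → Bool) (u w : ℕ → Vec d) (i : ℕ) : Vec d :=
  if p i then u (Nat.count (fun j => p j = true) i) else w (Nat.count (fun j => p j = false) i)

theorem sumElim_symm_eq_wordVec {d : ℕ} {e : Fin R ⊕ Fin R ≃ Fin (R + R)} (he : e ∈ shuffles R)
    (u w : ℕ → Vec d) (i : Fin (R + R)) :
    Sum.elim (fun k : Fin R => u k) (fun k : Fin R => w k) (e.symm i) =
      wordVec (shuffleLetter e) u w i := by
  cases h : e.symm i with
  | inl k =>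
    have hi : i = e (Sum.inl k) := by rw [← h, Equiv.apply_symm_apply]
    rw [wordVec, hi, if_pos (shuffleLetter_inl e k), count_shuffleLetter_inl he]
    rfl
  | inr k =>
    have hi : i = e (Sum.inr k) := by rw [← h, Equiv.apply_symm_apply]
    rw [wordVec, hi, shuffleLetter_inr e k, if_neg (by simp), count_shuffleLetter_inr he]
    rfl

end Shuffles

/-! ### Chains along sampled vectors -/

section Sampling

variable {n d : ℕ} {M : Vec d → Set (Fin n × Fin n)} {ρ : ℝ}

/-- The law of a sequence of independent standard Gaussian vectors. -/
abbrev gaussSeq (d : ℕ) : Measure (ℕ → Vec d) :=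
  Measure.infinitePi fun _ : ℕ => stdGaussian (Vec d)

theorem measurable_seq_apply (k : ℕ) : Measurable fun g : ℕ → Vec d => g k :=
  measurable_pi_apply k

@[fun_prop]
theorem measurable_corrChain (ρ : ℝ) (k : ℕ) :
    Measurable fun g : ℕ → Vec d => corrChain ρ g k := by
  induction k with
  | zero => exact measurable_pi_apply 0
  | succ k ih =>
    have h := (measurable_seq_apply (d := d) (k + 1)).const_smul (Real.sqrt (1 - ρ ^ 2))
    exact (ih.const_smul ρ).add h

theorem corrChain_congr {g g' : ℕ → Vec d} {k : ℕ} (h : ∀ i ≤ k, g i = g' i) :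
    corrChain ρ g k = corrChain ρ g' k := by
  induction k with
  | zero => exact h 0 le_rfl
  | succ k ih => rw [corrChain, corrChain, ih fun i hi => h i (by omega), h (k + 1) le_rfl]

theorem corrChain_zero_left (g : ℕ → Vec d) (k : ℕ) : corrChain 0 g k = g k := by
  cases k <;> simp [corrChain]

/-- The number of paths from `x` to `y` along the vectors that a word prescribes, where the
correlated vectors are built from `g`, and the independent ones are the entries of `h`. -/
def pathWeight (M : Vec d → Set (Fin n × Fin n)) (ρ : ℝ) :
    List Bool → Fin n → Fin n → (ℕ → Vec d) → (ℕ → Vec d) → ℝ≥0∞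
  | [], x, y, _, _ => if x = y then 1 else 0
  | true :: s, x, y, g, h =>
      ∑ z, edgeInd M z y (corrChain ρ g (s.count true)) * pathWeight M ρ s x z g h
  | false :: s, x, y, g, h =>
      ∑ z, edgeInd M z y (h (s.count false)) * pathWeight M ρ s x z g h

theorem measurable_pathWeight (hM : ∀ x y, MeasurableSet {u | (x, y) ∈ M u}) (s : List Bool)
    (x y : Fin n) : Measurable fun p : (ℕ → Vec d) × (ℕ → Vec d) =>
      pathWeight M ρ s x y p.1 p.2 := by
  induction s generalizing x y with
  | nil => exact measurable_const
  | cons b s ih =>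
    cases b
    · exact Finset.measurable_sum _ fun z _ => ((measurable_edgeInd hM z y).comp
        ((measurable_seq_apply _).comp measurable_snd)).mul (ih x z)
    · exact Finset.measurable_sum _ fun z _ => ((measurable_edgeInd hM z y).comp
        ((measurable_corrChain ρ _).comp measurable_fst)).mul (ih x z)

theorem pathWeight_congr_left {s : List Bool} {g g' : ℕ → Vec d}
    (hg : ∀ i < s.count true, g i = g' i) (x y : Fin n) (h : ℕ → Vec d) :
    pathWeight M ρ s x y g h = pathWeight M ρ s x y g' h := by
  induction s generalizing x y with
  | nil => rfl
  | cons b s ih =>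
    cases b
    · simp only [pathWeight]
      refine Finset.sum_congr rfl fun z _ => ?_
      rw [ih (fun i hi => hg i (by simpa using hi))]
    · simp only [pathWeight]
      refine Finset.sum_congr rfl fun z _ => ?_
      rw [ih (fun i hi => hg i (by simp; omega)),
        corrChain_congr fun i hi => hg i (by simp; omega)]

theorem pathWeight_congr_right {s : List Bool} {h h' : ℕ → Vec d}
    (hh : ∀ i < s.count false, h i = h' i) (x y : Fin n) (g : ℕ → Vec d) :
    pathWeight M ρ s x y g h = pathWeight M ρ s x y g h' := by
  induction s generalizing x y with
  | nil => rfl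
  | cons b s ih =>
    cases b
    · simp only [pathWeight]
      refine Finset.sum_congr rfl fun z _ => ?_
      rw [ih (fun i hi => hh i (by simp; omega)), hh _ (by simp)]
    · simp only [pathWeight]
      refine Finset.sum_congr rfl fun z _ => ?_
      rw [ih (fun i hi => hh i (by simpa using hi))]

theorem pathWeight_le_one (hM : ∀ u, IsDirectedMatching (M u)) (s : List Bool) (x y : Fin n)
    (g h : ℕ → Vec d) : pathWeight M ρ s x y g h ≤ 1 := by
  induction s generalizing x y with
  | nil => simp only [pathWeight]; split_ifs <;> simp
  | cons b s ih =>
    cases b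
    · exact sum_edgeInd_mul_le hM y _ _ _ fun z _ _ => ih x z
    · exact sum_edgeInd_mul_le hM y _ _ _ fun z _ _ => ih x z

/-- A positive path weight comes from a path. -/
theorem exists_path_of_pathWeight_ne_zero {p : ℕ → Bool} {m : ℕ} {x y : Fin n}
    {g h : ℕ → Vec d} (hw : pathWeight M ρ (wordOf p m) x y g h ≠ 0) :
    ∃ z : ℕ → Fin n, z 0 = x ∧ z m = y ∧
      ∀ i < m, (z i, z (i + 1)) ∈ M (wordVec p (corrChain ρ g) h i) := by
  induction m generalizing y with
  | zero =>
    refine ⟨fun _ => x, rfl, ?_, fun i hi => absurd hi (by omega)⟩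
    by_contra hne
    exact hw (if_neg hne)
  | succ m ih =>
    have hsum : ∃ w, edgeInd M w y (wordVec p (corrChain ρ g) h m) *
        pathWeight M ρ (wordOf p m) x w g h ≠ 0 := by
      by_contra hcon
      push Not at hcon
      refine hw ?_
      rw [wordOf]
      cases hb : p m
      · simp only [pathWeight]
        refine Finset.sum_eq_zero fun w _ => ?_
        have := hcon w
        rwa [wordVec, hb, if_neg (by simp), ← count_wordOf] at this
      · simp only [pathWeight]
        refine Finset.sum_eq_zero fun w _ => ?_
        have := hcon w
        rwa [wordVec, hb, if_pos rfl, ← count_wordOf] at this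
    obtain ⟨w, hw'⟩ := hsum
    obtain ⟨z, hz0, hzm, hz⟩ := ih (right_ne_zero_of_mul hw')
    have hedge : (w, y) ∈ M (wordVec p (corrChain ρ g) h m) := by
      by_contra hcon
      exact left_ne_zero_of_mul hw' (edgeInd_of_notMem hcon)
    refine ⟨Function.update z (m + 1) y, ?_, by simp, fun i hi => ?_⟩
    · rw [Function.update_of_ne (by omega), hz0]
    · rw [Function.update_of_ne (by omega)]
      rcases Nat.lt_succ_iff_lt_or_eq.1 hi with hi' | rfl
      · rw [Function.update_of_ne (by omega)]
        exact hz i hi'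
      · rw [Function.update_self, hzm]
        exact hedge

/-- The expected number of paths, given the source of the correlated vectors. -/
def pathMass (M : Vec d → Set (Fin n × Fin n)) (ρ : ℝ) (s : List Bool) (x y : Fin n)
    (g : ℕ → Vec d) : ℝ≥0∞ :=
  ∫⁻ h, pathWeight M ρ s x y g h ∂(gaussSeq d)

theorem measurable_pathMass (hM : ∀ x y, MeasurableSet {u | (x, y) ∈ M u}) (s : List Bool)
    (x y : Fin n) : Measurable (pathMass M ρ s x y) :=
  (measurable_pathWeight hM s x y).lintegral_prod_right'

theorem pathMass_true (hM : ∀ x y, MeasurableSet {u | (x, y) ∈ M u}) (s : List Bool)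
    (x y : Fin n) (g : ℕ → Vec d) :
    pathMass M ρ (true :: s) x y g =
      ∑ z, edgeInd M z y (corrChain ρ g (s.count true)) * pathMass M ρ s x z g := by
  have hm : ∀ z, Measurable fun h => pathWeight M ρ s x z g h := fun z =>
    (measurable_pathWeight hM s x z).comp measurable_prodMk_left
  simp only [pathMass, pathWeight]
  rw [lintegral_finsetSum _ fun z _ => (hm z).const_mul _]
  exact Finset.sum_congr rfl fun z _ => lintegral_const_mul _ (hm z)

/-- The independent vector with index `s.count false` is not used by `s`, so it can be integrated
out. -/
theorem pathMass_false (hM : ∀ x y, MeasurableSet {u | (x, y) ∈ M u}) (s : List Bool)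
    (x y : Fin n) (g : ℕ → Vec d) :
    pathMass M ρ (false :: s) x y g = ∑ z, edgeProb M z y * pathMass M ρ s x z g := by
  have hm : ∀ z, Measurable fun h => pathWeight M ρ s x z g h := fun z =>
    (measurable_pathWeight hM s x z).comp measurable_prodMk_left
  simp only [pathMass, pathWeight]
  have hm' : ∀ z, Measurable fun h : ℕ → Vec d =>
      edgeInd M z y (h (s.count false)) * pathWeight M ρ s x z g h := fun z =>
    ((measurable_edgeInd hM z y).comp (measurable_seq_apply _)).mul (hm z)
  rw [lintegral_finsetSum _ fun z _ => hm' z]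
  refine Finset.sum_congr rfl fun z _ => ?_
  have hH : Measurable (Function.uncurry fun (h : ℕ → Vec d) (ξ : Vec d) =>
      edgeInd M z y ξ * pathWeight M ρ s x z g h) :=
    ((measurable_edgeInd hM z y).comp measurable_snd).mul ((hm z).comp measurable_fst)
  rw [lintegral_infinitePi_coord (stdGaussian (Vec d)) (s.count false)
    (H := fun h ξ => edgeInd M z y ξ * pathWeight M ρ s x z g h) hH fun h ξ ξ' => by
      rw [pathWeight_congr_right fun i hi => Function.update_of_ne hi.ne _ _]]
  rw [← lintegral_const_mul _ (hm z)]
  refine lintegral_congr fun h => ?_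
  rw [lintegral_mul_const _ (measurable_edgeInd hM z y), lintegral_edgeInd hM]

/-- The test function sees the first correlated vector that `s` does not use, a `ρ`-correlated copy
of the last one used (if any); this is the form in which the induction closes. For `true`,
integrating out the fresh Gaussian turns `φ` into `noiseOp ρ φ` at the last vector, and
exchangeability moves the noise back onto the chain weight. -/
theorem lintegral_pathMass_mul (hM : ∀ x y, MeasurableSet {u | (x, y) ∈ M u}) (hρ : ρ ^ 2 ≤ 1)
    (s : List Bool) (x y : Fin n) {φ : Vec d → ℝ≥0∞} (hφ : Measurable φ) :
    ∫⁻ g, pathMass M ρ s x y g * φ (corrChain ρ g (s.count true)) ∂(gaussSeq d) =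
      ∫⁻ u, φ u * noiseOp ρ (chainWeight M ρ s x y) u ∂(stdGaussian (Vec d)) := by
  induction s generalizing x y φ with
  | nil =>
    have h1 : ∀ g, pathMass M ρ [] x y g = if x = y then 1 else 0 := fun g => by
      simp [pathMass, pathWeight]
    have h2 : ∀ u, noiseOp ρ (chainWeight M ρ [] x y) u = if x = y then 1 else 0 :=
      fun u => noiseOp_const ρ _ u
    have h3 : Measurable fun g : ℕ → Vec d => φ (g 0) := hφ.comp (measurable_seq_apply 0)
    simp only [h1, h2, List.count_nil, corrChain]
    rw [lintegral_const_mul _ h3, lintegral_mul_const _ hφ,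
      mul_comm]
    congr 1
    have := (measurePreserving_eval_infinitePi (fun _ : ℕ => stdGaussian (Vec d)) 0).lintegral_comp
      hφ
    exact this
  | cons b s ih =>
    have hA : ∀ z, Measurable (pathMass M ρ s x z) := measurable_pathMass hM s x
    have hC : ∀ z, Measurable (chainWeight M ρ s x z) := measurable_chainWeight hM ρ s x
    have hU : Measurable fun g : ℕ → Vec d => corrChain ρ g (s.count true) :=
      measurable_corrChain ρ _
    cases b
    · have h1 : Measurable fun g : ℕ → Vec d => φ (corrChain ρ g (s.count true)) := hφ.comp hU
      have h2 : ∀ u, noiseOp ρ (chainWeight M ρ (false :: s) x y) u =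
          ∑ z, edgeProb M z y * noiseOp ρ (chainWeight M ρ s x z) u := fun u => by
        simp only [chainWeight]
        rw [noiseOp_sum _ fun z _ => (hC z).const_mul _]
        exact Finset.sum_congr rfl fun z _ => noiseOp_const_mul _ (hC z) u
      simp only [pathMass_false hM, h2, Finset.sum_mul, Finset.mul_sum]
      have hcount : (false :: s).count true = s.count true := by simp
      have h3 : ∀ z, Measurable fun g : ℕ → Vec d =>
          edgeProb M z y * pathMass M ρ s x z g * φ (corrChain ρ g (s.count true)) :=
        fun z => ((hA z).const_mul _).mul h1
      have h4 : ∀ z, Measurable fun u : Vec d =>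
          φ u * (edgeProb M z y * noiseOp ρ (chainWeight M ρ s x z) u) :=
        fun z => hφ.mul ((measurable_noiseOp ρ (hC z)).const_mul _)
      rw [hcount, lintegral_finsetSum _ fun z _ => h3 z, lintegral_finsetSum _ fun z _ => h4 z]
      refine Finset.sum_congr rfl fun z _ => ?_
      simp only [mul_assoc, mul_left_comm (φ _)]
      have h5 : Measurable fun g : ℕ → Vec d =>
          pathMass M ρ s x z g * φ (corrChain ρ g (s.count true)) := (hA z).mul h1
      have h6 : Measurable fun u : Vec d => φ u * noiseOp ρ (chainWeight M ρ s x z) u :=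
        hφ.mul (measurable_noiseOp ρ (hC z))
      rw [lintegral_const_mul _ h5, lintegral_const_mul _ h6, ih x z hφ]
    · have hE : ∀ z, Measurable (edgeInd M z y) := fun z => measurable_edgeInd hM z y
      have hT : Measurable (noiseOp ρ φ) := measurable_noiseOp ρ hφ
      have hcount : (true :: s).count true = s.count true + 1 := by simp
      rw [hcount, lintegral_mul_noiseOp hρ (measurable_chainWeight hM ρ _ x y) hφ]
      simp only [pathMass_true hM, chainWeight, Finset.sum_mul]
      have hm : ∀ z, Measurable fun g : ℕ → Vec d =>
          edgeInd M z y (corrChain ρ g (s.count true)) * pathMass M ρ s x z g *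
            φ (corrChain ρ g (s.count true + 1)) := fun z =>
        (((hE z).comp hU).mul (hA z)).mul (hφ.comp (measurable_corrChain ρ _))
      have hm' : ∀ z, Measurable fun u : Vec d =>
          edgeInd M z y u * noiseOp ρ (chainWeight M ρ s x z) u * noiseOp ρ φ u := fun z =>
        ((hE z).mul (measurable_noiseOp ρ (hC z))).mul hT
      rw [lintegral_finsetSum _ fun z _ => hm z, lintegral_finsetSum _ fun z _ => hm' z]
      refine Finset.sum_congr rfl fun z _ => ?_
      have hU2 : Measurable fun p : (ℕ → Vec d) × Vec d =>
          ρ • corrChain ρ p.1 (s.count true) + Real.sqrt (1 - ρ ^ 2) • p.2 := by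
        have h1 : Measurable fun p : (ℕ → Vec d) × Vec d => corrChain ρ p.1 (s.count true) :=
          hU.comp measurable_fst
        fun_prop
      have hH : Measurable (Function.uncurry fun (g : ℕ → Vec d) (ξ : Vec d) =>
          edgeInd M z y (corrChain ρ g (s.count true)) * pathMass M ρ s x z g *
            φ (ρ • corrChain ρ g (s.count true) + Real.sqrt (1 - ρ ^ 2) • ξ)) :=
        (((hE z).comp (hU.comp measurable_fst)).mul ((hA z).comp measurable_fst)).mul
          (hφ.comp hU2)
      have h3 := lintegral_infinitePi_coord (stdGaussian (Vec d)) (s.count true + 1)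
        (H := fun g ξ => edgeInd M z y (corrChain ρ g (s.count true)) * pathMass M ρ s x z g *
            φ (ρ • corrChain ρ g (s.count true) + Real.sqrt (1 - ρ ^ 2) • ξ)) hH
        fun g ξ ξ' => by
          have e1 : corrChain ρ (Function.update g (s.count true + 1) ξ') (s.count true) =
              corrChain ρ g (s.count true) :=
            corrChain_congr fun i hi => Function.update_of_ne (by omega) _ _
          have e2 : pathMass M ρ s x z (Function.update g (s.count true + 1) ξ') =
              pathMass M ρ s x z g := by
            refine lintegral_congr fun h => ?_
            exact pathWeight_congr_left
              (fun i (hi : i < s.count true) =>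
                Function.update_of_ne (by omega : i ≠ s.count true + 1) _ _) _ _ _
          rw [e1, e2]
      refine h3.trans ?_
      have h4 : ∀ g : ℕ → Vec d, ∫⁻ ξ, edgeInd M z y (corrChain ρ g (s.count true)) *
          pathMass M ρ s x z g *
            φ (ρ • corrChain ρ g (s.count true) + Real.sqrt (1 - ρ ^ 2) • ξ)
              ∂(stdGaussian (Vec d)) = pathMass M ρ s x z g *
            (edgeInd M z y (corrChain ρ g (s.count true)) *
              noiseOp ρ φ (corrChain ρ g (s.count true))) := fun g => by
        have h5 : Measurable fun ξ : Vec d =>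
            φ (ρ • corrChain ρ g (s.count true) + Real.sqrt (1 - ρ ^ 2) • ξ) :=
          hφ.comp (by fun_prop)
        rw [lintegral_const_mul _ h5, noiseOp,
          mul_comm (edgeInd M z y _) (pathMass M ρ s x z g), mul_assoc]
      simp only [h4]
      rw [ih x z (φ := fun u => edgeInd M z y u * noiseOp ρ φ u) ((hE z).mul hT)]
      refine lintegral_congr fun u => ?_
      ring

theorem lintegral_pathMass (hM : ∀ x y, MeasurableSet {u | (x, y) ∈ M u}) (hρ : ρ ^ 2 ≤ 1)
    (s : List Bool) (x y : Fin n) :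
    ∫⁻ g, pathMass M ρ s x y g ∂(gaussSeq d) =
      ∫⁻ u, chainWeight M ρ s x y u ∂(stdGaussian (Vec d)) := by
  have := lintegral_pathMass_mul hM hρ s x y (φ := fun _ => 1) measurable_const
  simpa [lintegral_noiseOp hρ (measurable_chainWeight hM ρ s x y)] using this

/-! ### The expected number of far edges in a sampled graph -/

theorem measurable_sigma {β : Type*} [MeasurableSpace β] {f : VecList d → β}
    (hf : ∀ r, Measurable fun g : Fin r → Vec d => f ⟨r, g⟩) : Measurable f :=
  fun _ ht => MeasurableSpace.measurableSet_iInf.2 fun r => hf r ht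

theorem measurable_sigma_mk (r : ℕ) :
    Measurable fun g : Fin r → Vec d => (⟨r, g⟩ : VecList d) :=
  fun _ ht => MeasurableSpace.measurableSet_iInf.1 ht r

theorem measurableSet_mem_chained (hM : ∀ x y, MeasurableSet {u | (x, y) ∈ M u})
    (p : Fin n × Fin n) : MeasurableSet {l : VecList d | p ∈ chained M l} := by
  refine MeasurableSpace.measurableSet_iInf.2 fun r => ?_
  have : Sigma.mk r ⁻¹' {l : VecList d | p ∈ chained M l} =
      ⋃ z : Fin (r + 1) → Fin n, {g : Fin r → Vec d | z 0 = p.1 ∧ z (Fin.last r) = p.2 ∧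
        ∀ i : Fin r, (z i.castSucc, z i.succ) ∈ M (g i)} := by
    ext g
    simp [chained]
  change MeasurableSet (Sigma.mk r ⁻¹' {l : VecList d | p ∈ chained M l})
  rw [this]
  refine MeasurableSet.iUnion fun z => ?_
  refine MeasurableSet.inter (.const _) (MeasurableSet.inter (.const _) ?_)
  have : {g : Fin r → Vec d | ∀ i : Fin r, (z i.castSucc, z i.succ) ∈ M (g i)} =
      ⋂ i, (fun g => g i) ⁻¹' {u | (z i.castSucc, z i.succ) ∈ M u} := by
    ext g
    simp
  change MeasurableSet {g : Fin r → Vec d | ∀ i : Fin r, (z i.castSucc, z i.succ) ∈ M (g i)}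
  rw [this]
  exact MeasurableSet.iInter fun i => measurable_pi_apply i (hM _ _)

theorem measurable_shufflePrefix {R : ℕ} (e : Fin R ⊕ Fin R ≃ Fin (R + R)) (r : Fin R) :
    Measurable fun p : (Fin R → Vec d) × (Fin R → Vec d) => shufflePrefix e r p.1 p.2 := by
  refine (measurable_sigma_mk (r + 1)).comp (measurable_pi_lambda _ fun i => ?_)
  cases h : e.symm ⟨i, by omega⟩ with
  | inl k => simp only [Sum.elim_inl]; fun_prop
  | inr k => simp only [Sum.elim_inr]; fun_prop

/-- A nonnegative integral with respect to the sampling distribution. -/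
theorem lintegral_sampleDist {R : ℕ} {F : VecList d → ℝ≥0∞} (hF : Measurable F) :
    ∫⁻ l, F l ∂(sampleDist d R ρ) = ((R * (shuffles R).card : ℕ) : ℝ≥0∞)⁻¹ *
      ∑ e ∈ shuffles R, ∑ r : Fin R, ∫⁻ g, ∫⁻ h, F ⟨r + 1, fun i =>
        wordVec (shuffleLetter e) (corrChain ρ g) h i⟩ ∂(gaussSeq d) ∂(gaussSeq d) := by
  rw [sampleDist, lintegral_smul_measure, lintegral_finsetSum_measure, smul_eq_mul]
  congr 1
  refine Finset.sum_congr rfl fun e he => ?_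
  rw [lintegral_finsetSum_measure]
  refine Finset.sum_congr rfl fun r _ => ?_
  have hm : ∀ ρ : ℝ, Measurable fun (g : ℕ → Vec d) (i : Fin R) => corrChain ρ g i :=
    fun ρ => measurable_pi_lambda _ fun i => measurable_corrChain ρ i
  have hF1 : Measurable fun p : (Fin R → Vec d) × (Fin R → Vec d) =>
      F (shufflePrefix e r p.1 p.2) := hF.comp (measurable_shufflePrefix e r)
  have hm2 : Measurable (Prod.map (fun (g : ℕ → Vec d) (i : Fin R) => corrChain ρ g i)
      (fun (g : ℕ → Vec d) (i : Fin R) => corrChain 0 g i)) := (hm ρ).prodMap (hm 0)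
  rw [lintegral_map hF (measurable_shufflePrefix e r), corrGaussian, corrGaussian,
    Measure.map_prod_map _ _ (hm ρ) (hm 0), lintegral_map hF1 hm2,
    lintegral_prod (fun q : (ℕ → Vec d) × (ℕ → Vec d) => F (shufflePrefix e r
      (Prod.map (fun (g : ℕ → Vec d) (i : Fin R) => corrChain ρ g i)
        (fun (g : ℕ → Vec d) (i : Fin R) => corrChain 0 g i) q).1
      (Prod.map (fun (g : ℕ → Vec d) (i : Fin R) => corrChain ρ g i)
        (fun (g : ℕ → Vec d) (i : Fin R) => corrChain 0 g i) q).2)) (hF1.comp hm2).aemeasurable]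
  refine lintegral_congr fun g => lintegral_congr fun h => ?_
  congr 1
  simp only [shufflePrefix, Prod.map, corrChain_zero_left]
  congr 1
  funext i
  exact sumElim_symm_eq_wordVec he (corrChain ρ g) h ⟨i, by omega⟩

open Classical in
-- Only one term of the average is kept: a shuffle that begins with the word `s`, cut at the length
-- of `s`. The path weight is at most one and vanishes when there is no path, so it is below the
-- edge indicator.
theorem le_lintegral_sampleDist (hM : ∀ x y, MeasurableSet {u | (x, y) ∈ M u})
    (hM' : ∀ u, IsDirectedMatching (M u)) (hρ : ρ ^ 2 ≤ 1) (v : Fin n → Vec d) (L : ℝ) {R : ℕ}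
    {s : List Bool} (hs : s ≠ []) (hsR : s.length ≤ R) :
    ((R * (shuffles R).card : ℕ) : ℝ≥0∞)⁻¹ * ∑ y, farMass M v ρ L s y ≤
      ∫⁻ l, ∑ p : Fin n × Fin n,
        (if p ∈ chained M l ∧ L ≤ ‖v p.1 - v p.2‖ ^ 2 then 1 else 0) ∂(sampleDist d R ρ) := by
  have hF : Measurable fun l : VecList d => ∑ p : Fin n × Fin n,
      (if p ∈ chained M l ∧ L ≤ ‖v p.1 - v p.2‖ ^ 2 then (1 : ℝ≥0∞) else 0) :=
    Finset.measurable_sum _ fun p _ => Measurable.ite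
      ((measurableSet_mem_chained hM p).inter (.const _)) measurable_const measurable_const
  rw [lintegral_sampleDist hF]
  gcongr
  obtain ⟨e, he, hes⟩ := exists_shuffle_wordOf s hsR
  have hpos : 0 < s.length := List.length_pos_iff.2 hs
  -- The prefix has `r + 1` entries, which is why the word must be nonempty.
  set r : Fin R := ⟨s.length - 1, by omega⟩ with hr
  have hr1 : (r : ℕ) + 1 = s.length := by simp only [hr]; omega
  refine le_trans ?_ (Finset.single_le_sum (f := fun e => ∑ r : Fin R, ∫⁻ g, ∫⁻ h,
    (fun l : VecList d => ∑ p : Fin n × Fin n,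
      (if p ∈ chained M l ∧ L ≤ ‖v p.1 - v p.2‖ ^ 2 then (1 : ℝ≥0∞) else 0)) ⟨r + 1, fun i =>
        wordVec (shuffleLetter e) (corrChain ρ g) h i⟩ ∂(gaussSeq d) ∂(gaussSeq d))
      (fun _ _ => zero_le) he)
  refine le_trans ?_ (Finset.single_le_sum (f := fun r : Fin R => ∫⁻ g, ∫⁻ h,
    (fun l : VecList d => ∑ p : Fin n × Fin n,
      (if p ∈ chained M l ∧ L ≤ ‖v p.1 - v p.2‖ ^ 2 then (1 : ℝ≥0∞) else 0)) ⟨r + 1, fun i =>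
        wordVec (shuffleLetter e) (corrChain ρ g) h i⟩ ∂(gaussSeq d) ∂(gaussSeq d))
      (fun _ _ => zero_le) (Finset.mem_univ r))
  have hfar : ∑ y, farMass M v ρ L s y = ∫⁻ g, ∫⁻ h, ∑ p : Fin n × Fin n,
      (if L ≤ ‖v p.1 - v p.2‖ ^ 2 then pathWeight M ρ s p.1 p.2 g h else 0)
        ∂(gaussSeq d) ∂(gaussSeq d) := by
    have h1 : ∀ g, ∫⁻ h, ∑ p : Fin n × Fin n,
        (if L ≤ ‖v p.1 - v p.2‖ ^ 2 then pathWeight M ρ s p.1 p.2 g h else 0) ∂(gaussSeq d) =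
        ∑ p : Fin n × Fin n,
          (if L ≤ ‖v p.1 - v p.2‖ ^ 2 then pathMass M ρ s p.1 p.2 g else 0) := fun g => by
      have hm : ∀ p : Fin n × Fin n, Measurable fun h : ℕ → Vec d =>
          (if L ≤ ‖v p.1 - v p.2‖ ^ 2 then pathWeight M ρ s p.1 p.2 g h else 0) := fun p => by
        split_ifs
        · exact (measurable_pathWeight hM s p.1 p.2).comp measurable_prodMk_left
        · exact measurable_const
      rw [lintegral_finsetSum _ fun p _ => hm p]
      refine Finset.sum_congr rfl fun p _ => ?_
      split_ifs
      · rfl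
      · simp
    have hm : ∀ p : Fin n × Fin n, Measurable fun g : ℕ → Vec d =>
        (if L ≤ ‖v p.1 - v p.2‖ ^ 2 then pathMass M ρ s p.1 p.2 g else 0) := fun p => by
      split_ifs
      · exact measurable_pathMass hM s p.1 p.2
      · exact measurable_const
    have hm' : ∀ x y : Fin n, Measurable fun u : Vec d =>
        (if L ≤ ‖v y - v x‖ ^ 2 then chainWeight M ρ s x y u else 0) := fun x y => by
      split_ifs
      · exact measurable_chainWeight hM ρ s x y
      · exact measurable_const
    simp only [h1]
    rw [lintegral_finsetSum _ fun p _ => hm p, Fintype.sum_prod_type_right]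
    refine Finset.sum_congr rfl fun y _ => ?_
    rw [farMass, lintegral_finsetSum _ fun x _ => hm' x y]
    refine Finset.sum_congr rfl fun x _ => ?_
    simp only [norm_sub_rev (v y)]
    split_ifs
    · exact (lintegral_pathMass hM hρ s x y).symm
    · simp
  rw [hfar]
  refine lintegral_mono fun g => lintegral_mono fun h => Finset.sum_le_sum fun p _ => ?_
  by_cases hL : L ≤ ‖v p.1 - v p.2‖ ^ 2
  · rw [if_pos hL]
    by_cases hw : pathWeight M ρ s p.1 p.2 g h = 0
    · rw [hw]; exact zero_le
    · rw [if_pos]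
      · exact pathWeight_le_one hM' s p.1 p.2 g h
      · refine ⟨?_, hL⟩
        rw [← hes] at hw
        obtain ⟨z, hz0, hz1, hz⟩ := exists_path_of_pathWeight_ne_zero hw
        refine ⟨fun i => z i, hz0, ?_, fun i => ?_⟩
        · simpa [hr1] using hz1
        · exact hz i (i.2.trans_eq hr1)
  · rw [if_neg hL]; exact zero_le

end Sampling

/-! ### Splitting and joining sequences of independent variables -/

theorem prod_infinitePi_map_sumElim {ι κ X : Type*} [MeasurableSpace X] (μ : Measure X)
    [IsProbabilityMeasure μ] :
    ((Measure.infinitePi fun _ : ι => μ).prod (Measure.infinitePi fun _ : κ => μ)).map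
      (fun q => Sum.elim q.1 q.2) = Measure.infinitePi fun _ : ι ⊕ κ => μ := by
  have hm : Measurable fun q : (ι → X) × (κ → X) => Sum.elim q.1 q.2 := by
    refine measurable_pi_lambda _ fun i => ?_
    cases i
    · exact (measurable_pi_apply _).comp measurable_fst
    · exact (measurable_pi_apply _).comp measurable_snd
  refine Measure.eq_infinitePi _ fun s t ht => ?_
  rw [Measure.map_apply hm (.pi s.countable_toSet fun i _ => ht i)]
  have : (fun q : (ι → X) × (κ → X) => Sum.elim q.1 q.2) ⁻¹' Set.pi s t =
      Set.pi s.toLeft (fun i => t (Sum.inl i)) ×ˢ Set.pi s.toRight (fun i => t (Sum.inr i)) := by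
    ext q
    simp only [Set.mem_preimage, Set.mem_pi, Set.mem_prod, Finset.mem_coe, Sum.forall,
      Finset.mem_toLeft, Finset.mem_toRight, Sum.elim_inl, Sum.elim_inr]
  rw [this, Measure.prod_prod, Measure.infinitePi_pi _ fun i _ => ht _,
    Measure.infinitePi_pi _ fun i _ => ht _, ← Finset.prod_disjSum _ _ fun i => μ (t i),
    Finset.toLeft_disjSum_toRight]

/-! ### Merging the two sources into one stream of fresh vectors -/

section WordLaw

variable {d : ℕ}

/-- The position in its source of the `i`-th entry of a list described by letters. -/
def wordPos (p : ℕ → Bool) (i : ℕ) : ℕ ⊕ ℕ :=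
  if p i then Sum.inl (Nat.count (fun j => p j = true) i)
  else Sum.inr (Nat.count (fun j => p j = false) i)

theorem wordPos_injective (p : ℕ → Bool) : Function.Injective (wordPos p) := by
  intro i j hij
  unfold wordPos at hij
  cases hi : p i <;> cases hj : p j <;> simp only [hi, hj, if_true, if_false, Bool.false_eq_true,
    Sum.inl.injEq, Sum.inr.injEq, reduceCtorEq] at hij
  · exact Nat.count_injective (p := fun j => p j = false) hi hj hij
  · exact Nat.count_injective (p := fun j => p j = true) hi hj hij

theorem sumElim_wordPos (p : ℕ → Bool) (g h : ℕ → Vec d) (i : ℕ) :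
    Sum.elim g h (wordPos p i) = wordVec p g h i := by
  unfold wordPos wordVec
  split_ifs <;> rfl

theorem measurable_wordVec (p : ℕ → Bool) :
    Measurable fun q : (ℕ → Vec d) × (ℕ → Vec d) => wordVec p q.1 q.2 := by
  refine measurable_pi_lambda _ fun i => ?_
  unfold wordVec
  split_ifs
  · exact (measurable_seq_apply _).comp measurable_fst
  · exact (measurable_seq_apply _).comp measurable_snd

/-- Two sequences of independent Gaussian vectors that are merged according to given letters form
a sequence of independent Gaussian vectors. -/
theorem gaussSeq_prod_map_wordVec (p : ℕ → Bool) :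
    ((gaussSeq d).prod (gaussSeq d)).map (fun q => wordVec p q.1 q.2) = gaussSeq d := by
  have h1 := prod_infinitePi_map_sumElim (ι := ℕ) (κ := ℕ) (stdGaussian (Vec d))
  have h2 := infinitePi_map_comp (stdGaussian (Vec d)) (wordPos_injective p)
  have hm : Measurable fun q : (ℕ → Vec d) × (ℕ → Vec d) => Sum.elim q.1 q.2 := by
    refine measurable_pi_lambda _ fun i => ?_
    cases i
    · exact (measurable_pi_apply _).comp measurable_fst
    · exact (measurable_pi_apply _).comp measurable_snd
  rw [← h1, Measure.map_map (by fun_prop) hm] at h2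
  refine Eq.trans ?_ h2
  congr 1
  funext q i
  exact (sumElim_wordPos p q.1 q.2 i).symm

/-- The state of the procedure that builds a list from fresh vectors: the weight of the fresh
vector in the next correlated vector, and the last correlated vector. -/
def mixState (ρ : ℝ) (p : ℕ → Bool) (G : ℕ → Vec d) : ℕ → ℝ × Vec d
  | 0 => (1, 0)
  | i + 1 => if p i then
      (Real.sqrt (1 - ρ ^ 2), ρ • (mixState ρ p G i).2 + (mixState ρ p G i).1 • G i)
    else mixState ρ p G i

/-- The list built from fresh vectors: the letter `true` stands for a correlated copy of the
previous correlated vector, the letter `false` for a fresh vector. -/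
def mixVec (ρ : ℝ) (p : ℕ → Bool) (G : ℕ → Vec d) (i : ℕ) : Vec d :=
  if p i then ρ • (mixState ρ p G i).2 + (mixState ρ p G i).1 • G i else G i

theorem mixState_congr {ρ : ℝ} {p q : ℕ → Bool} {G : ℕ → Vec d} {i : ℕ}
    (h : ∀ j < i, p j = q j) : mixState ρ p G i = mixState ρ q G i := by
  induction i with
  | zero => rfl
  | succ i ih => rw [mixState, mixState, ih fun j hj => h j (by omega), h i (by omega)]

theorem mixVec_congr {ρ : ℝ} {p q : ℕ → Bool} {G : ℕ → Vec d} {i : ℕ}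
    (h : ∀ j ≤ i, p j = q j) : mixVec ρ p G i = mixVec ρ q G i := by
  rw [mixVec, mixVec, mixState_congr fun j hj => h j (by omega), h i le_rfl]

/-- The initial weight `1` and vector `0` make the first correlated vector an unattenuated fresh
Gaussian; the weight `√(1 - ρ²)` applies only from the second one on. Hence the case distinction. -/
theorem mixState_wordVec (ρ : ℝ) (p : ℕ → Bool) (g h : ℕ → Vec d) (i : ℕ) :
    mixState ρ p (wordVec p g h) i = if Nat.count (fun j => p j = true) i = 0 then (1, 0)
      else (Real.sqrt (1 - ρ ^ 2), corrChain ρ g (Nat.count (fun j => p j = true) i - 1)) := by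
  induction i with
  | zero => simp [mixState]
  | succ i ih =>
    rw [mixState, Nat.count_succ, ih]
    cases hp : p i
    · simp
    · simp only [if_true, Nat.add_eq_zero_iff, one_ne_zero, and_false, if_false,
        Nat.add_sub_cancel]
      congr 1
      rw [wordVec, hp, if_pos rfl]
      rcases Nat.eq_zero_or_pos (Nat.count (fun j => p j = true) i) with h0 | h0
      · rw [h0]; simp [corrChain]
      · rw [if_neg h0.ne']
        obtain ⟨k, hk⟩ := Nat.exists_eq_add_of_le' h0
        rw [hk]
        rfl

/-- Only one of the two sources is read at each position, so a single stream of fresh vectors can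
replace both. -/
theorem mixVec_wordVec (ρ : ℝ) (p : ℕ → Bool) (g h : ℕ → Vec d) (i : ℕ) :
    mixVec ρ p (wordVec p g h) i = wordVec p (corrChain ρ g) h i := by
  unfold mixVec
  rw [mixState_wordVec]
  cases hp : p i
  · simp [wordVec, hp]
  · simp only [if_true, wordVec, hp]
    rcases Nat.eq_zero_or_pos (Nat.count (fun j => p j = true) i) with h0 | h0
    · rw [h0]; simp [corrChain]
    · rw [if_neg h0.ne']
      obtain ⟨k, hk⟩ := Nat.exists_eq_add_of_le' h0
      rw [hk]
      rfl

end WordLaw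

/-! ### Drawing a shuffle letter by letter -/

section Letters

/-- The law of a sequence of independent uniform numbers. -/
abbrev unifSeq : Measure (ℕ → unitInterval) :=
  Measure.infinitePi fun _ : ℕ => (volume : Measure unitInterval)

/-- The numbers of entries of the two lists that remain after `m` draws. -/
def drawCounts (R : ℕ) (U : ℕ → unitInterval) : ℕ → ℕ × ℕ
  | 0 => (R, R)
  | m + 1 =>
    if ⌊(((drawCounts R U m).1 + (drawCounts R U m).2 : ℕ) : ℝ) * (U (m + 1) : ℝ)⌋₊ <
        (drawCounts R U m).1 then
      ((drawCounts R U m).1 - 1, (drawCounts R U m).2)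
    else ((drawCounts R U m).1, (drawCounts R U m).2 - 1)

/-- The letters drawn: each remaining entry is equally likely to be the next one. -/
def drawLetter (R : ℕ) (U : ℕ → unitInterval) (m : ℕ) : Bool :=
  decide (⌊(((drawCounts R U m).1 + (drawCounts R U m).2 : ℕ) : ℝ) * (U (m + 1) : ℝ)⌋₊ <
    (drawCounts R U m).1)

theorem drawCounts_succ (R : ℕ) (U : ℕ → unitInterval) (m : ℕ) :
    drawCounts R U (m + 1) = if drawLetter R U m then
      ((drawCounts R U m).1 - 1, (drawCounts R U m).2)
    else ((drawCounts R U m).1, (drawCounts R U m).2 - 1) := by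
  rw [drawCounts]
  simp only [drawLetter, decide_eq_true_eq]

theorem drawCounts_eq {R : ℕ} {U : ℕ → unitInterval} {q : ℕ → Bool} {m : ℕ}
    (h : ∀ j < m, drawLetter R U j = q j) :
    drawCounts R U m = (R - Nat.count (fun j => q j = true) m,
      R - Nat.count (fun j => q j = false) m) := by
  induction m with
  | zero => simp [drawCounts]
  | succ m ih =>
    rw [drawCounts_succ, ih fun j hj => h j (by omega), h m (by omega), Nat.count_succ,
      Nat.count_succ]
    cases q m
    · simp [Nat.sub_sub]
    · simp [Nat.sub_sub]

theorem drawCounts_congr {R : ℕ} {U U' : ℕ → unitInterval} {m : ℕ}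
    (h : ∀ j < m, U (j + 1) = U' (j + 1)) : drawCounts R U m = drawCounts R U' m := by
  induction m with
  | zero => rfl
  | succ m ih => rw [drawCounts, drawCounts, ih fun j hj => h j (by omega), h m (by omega)]

theorem drawLetter_congr {R : ℕ} {U U' : ℕ → unitInterval} {m : ℕ}
    (h : ∀ j ≤ m, U (j + 1) = U' (j + 1)) : drawLetter R U m = drawLetter R U' m := by
  rw [drawLetter, drawLetter, drawCounts_congr fun j hj => h j (by omega), h m le_rfl]

theorem measurable_unif_apply (k : ℕ) : Measurable fun U : ℕ → unitInterval => (U k : ℝ) :=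
  measurable_subtype_coe.comp (measurable_pi_apply k)

theorem measurable_drawCounts (R m : ℕ) : Measurable fun U => drawCounts R U m := by
  induction m with
  | zero => exact measurable_const
  | succ m ih =>
    have hN : Measurable fun U => (((drawCounts R U m).1 + (drawCounts R U m).2 : ℕ) : ℝ) :=
      (Measurable.of_discrete (f := fun c : ℕ × ℕ => ((c.1 + c.2 : ℕ) : ℝ))).comp ih
    have hf := Nat.measurable_floor.comp (hN.mul (measurable_unif_apply (m + 1)))
    refine Measurable.ite (measurableSet_lt hf (measurable_fst.comp ih)) ?_ ?_
    · exact (Measurable.of_discrete (f := fun c : ℕ × ℕ => (c.1 - 1, c.2))).comp ih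
    · exact (Measurable.of_discrete (f := fun c : ℕ × ℕ => (c.1, c.2 - 1))).comp ih

theorem measurableSet_drawLetter (R m : ℕ) (b : Bool) :
    MeasurableSet {U | drawLetter R U m = b} := by
  have hN : Measurable fun U => (((drawCounts R U m).1 + (drawCounts R U m).2 : ℕ) : ℝ) :=
    (Measurable.of_discrete (f := fun c : ℕ × ℕ => ((c.1 + c.2 : ℕ) : ℝ))).comp
      (measurable_drawCounts R m)
  have hf := Nat.measurable_floor.comp (hN.mul (measurable_unif_apply (m + 1)))
  have hs : MeasurableSet {U | drawLetter R U m = true} := by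
    simp only [drawLetter, decide_eq_true_eq]
    exact measurableSet_lt hf (measurable_fst.comp (measurable_drawCounts R m))
  cases b
  · have : {U | drawLetter R U m = false} = {U | drawLetter R U m = true}ᶜ := by
      ext U; simp
    rw [this]; exact hs.compl
  · exact hs

theorem volume_floor_mul_lt {N a : ℕ} (hN : 0 < N) (ha : a ≤ N) :
    volume {u : unitInterval | ⌊(N : ℝ) * (u : ℝ)⌋₊ < a} = ENNReal.ofReal (a / N) := by
  have hN' : (0 : ℝ) < N := by exact_mod_cast hN
  have hle : (a : ℝ) / N ≤ 1 := by
    rw [div_le_one hN']; exact_mod_cast ha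
  have : {u : unitInterval | ⌊(N : ℝ) * (u : ℝ)⌋₊ < a} =
      Set.Iio (⟨a / N, by positivity, hle⟩ : unitInterval) := by
    ext u
    simp only [Set.mem_ofPred_eq, Set.mem_Iio, ← Subtype.coe_lt_coe]
    rw [Nat.floor_lt (mul_nonneg hN'.le u.2.1), lt_div_iff₀ hN', mul_comm]
  rw [this, unitInterval.volume_Iio]

theorem measurableSet_floor_mul_lt (N a : ℕ) :
    MeasurableSet {u : unitInterval | ⌊(N : ℝ) * (u : ℝ)⌋₊ < a} :=
  measurableSet_lt (Nat.measurable_floor.comp (measurable_subtype_coe.const_mul _))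
    measurable_const

theorem volume_floor_mul_eq {N r : ℕ} (hr : r < N) :
    volume {u : unitInterval | ⌊(N : ℝ) * (u : ℝ)⌋₊ = r} = ENNReal.ofReal (1 / N) := by
  have hN : 0 < N := by omega
  have hN' : (0 : ℝ) < N := by exact_mod_cast hN
  have h1 : {u : unitInterval | ⌊(N : ℝ) * (u : ℝ)⌋₊ = r} =
      {u : unitInterval | ⌊(N : ℝ) * (u : ℝ)⌋₊ < r + 1} \ {u : unitInterval | ⌊(N : ℝ) * (u : ℝ)⌋₊ < r} := by
    ext u
    simp only [Set.mem_ofPred_eq, Set.mem_sdiff]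
    omega
  rw [h1, measure_sdiff (fun u hu => by simp only [Set.mem_ofPred_eq] at hu ⊢; omega)
    (measurableSet_floor_mul_lt N r).nullMeasurableSet (measure_ne_top _ _),
    volume_floor_mul_lt hN hr, volume_floor_mul_lt hN hr.le, ← ENNReal.ofReal_sub _ (by positivity)]
  congr 1
  push_cast
  ring

/-- The event that the length and the first `m` letters drawn are given ones. -/
def drawEvent (R r : ℕ) (q : ℕ → Bool) (m : ℕ) : Set (ℕ → unitInterval) :=
  {U | ⌊(R : ℝ) * (U 0 : ℝ)⌋₊ = r ∧ ∀ j < m, drawLetter R U j = q j}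

theorem measurableSet_drawEvent (R r : ℕ) (q : ℕ → Bool) (m : ℕ) :
    MeasurableSet (drawEvent R r q m) := by
  have h1 : MeasurableSet {U : ℕ → unitInterval | ⌊(R : ℝ) * (U 0 : ℝ)⌋₊ = r} :=
    (Nat.measurable_floor.comp ((measurable_unif_apply 0).const_mul _)) (measurableSet_singleton r)
  have h2 : drawEvent R r q m = {U : ℕ → unitInterval | ⌊(R : ℝ) * (U 0 : ℝ)⌋₊ = r} ∩
      ⋂ j ∈ Finset.range m, {U | drawLetter R U j = q j} := by
    ext U
    simp [drawEvent]
  rw [h2]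
  exact h1.inter (Finset.measurableSet_biInter _ fun j _ => measurableSet_drawLetter R j _)

theorem count_true_add_count_false (q : ℕ → Bool) (m : ℕ) :
    Nat.count (fun j => q j = true) m + Nat.count (fun j => q j = false) m = m := by
  induction m with
  | zero => rfl
  | succ m ih =>
    rw [Nat.count_succ, Nat.count_succ]
    cases q m <;> simp <;> omega

/-- Drawing without replacement: after `A` and `B` letters of the two kinds, the next one is `true`
with probability `(R - A) / (2R - m)` and `false` with probability `(R - B) / (2R - m)`. The
products are falling factorials; the remaining factor `1/R` is the choice of the length. -/
theorem drawEvent_measure {R r : ℕ} (hr : r < R) (q : ℕ → Bool) {m : ℕ} (hm : m ≤ R + R)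
    (hA : Nat.count (fun j => q j = true) m ≤ R) (hB : Nat.count (fun j => q j = false) m ≤ R) :
    unifSeq (drawEvent R r q m) = ENNReal.ofReal
      ((R.descFactorial (Nat.count (fun j => q j = true) m) *
        R.descFactorial (Nat.count (fun j => q j = false) m) : ℕ) /
          (((R + R).descFactorial m : ℕ) * R)) := by
  induction m with
  | zero =>
    have h1 : drawEvent R r q 0 = (fun U : ℕ → unitInterval => U 0) ⁻¹'
        {u : unitInterval | ⌊(R : ℝ) * (u : ℝ)⌋₊ = r} := by
      ext U
      simp [drawEvent]
    have h2 : MeasurableSet {u : unitInterval | ⌊(R : ℝ) * (u : ℝ)⌋₊ = r} :=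
      (Nat.measurable_floor.comp (measurable_subtype_coe.const_mul _)) (measurableSet_singleton r)
    rw [h1, (measurePreserving_eval_infinitePi
      (fun _ : ℕ => (volume : Measure unitInterval)) 0).measure_preimage h2.nullMeasurableSet,
      volume_floor_mul_eq hr]
    simp
  | succ m ih =>
    have hAm := Nat.count_monotone (fun j => q j = true) (Nat.le_succ m)
    have hBm := Nat.count_monotone (fun j => q j = false) (Nat.le_succ m)
    have ih' := ih (by omega) (by simp only [Nat.succ_eq_add_one] at *; omega)
      (by simp only [Nat.succ_eq_add_one] at *; omega)
    have hsum := count_true_add_count_false q m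
    set A := Nat.count (fun j => q j = true) m with hAdef
    set B := Nat.count (fun j => q j = false) m with hBdef
    have hN : (R - A) + (R - B) = R + R - m := by
      simp only [Nat.succ_eq_add_one] at *; omega
    have hNpos : 0 < R + R - m := by omega
    set V : Set unitInterval :=
      {u | (⌊((R + R - m : ℕ) : ℝ) * (u : ℝ)⌋₊ < R - A) ↔ q m = true} with hV
    have hVm : MeasurableSet V := by
      cases hq : q m
      · have : V = {u : unitInterval | ⌊((R + R - m : ℕ) : ℝ) * (u : ℝ)⌋₊ < R - A}ᶜ := by
          ext u; simp [hV, hq]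
        rw [this]; exact (measurableSet_floor_mul_lt _ _).compl
      · have : V = {u : unitInterval | ⌊((R + R - m : ℕ) : ℝ) * (u : ℝ)⌋₊ < R - A} := by
          ext u; simp [hV, hq]
        rw [this]; exact measurableSet_floor_mul_lt _ _
    have hsplit : ∀ U, (drawEvent R r q (m + 1)).indicator (1 : (ℕ → unitInterval) → ℝ≥0∞) U =
        (drawEvent R r q m).indicator 1 U * V.indicator 1 (U (m + 1)) := by
      intro U
      have hiff : U ∈ drawEvent R r q (m + 1) ↔ U ∈ drawEvent R r q m ∧ U (m + 1) ∈ V := by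
        have hstep : U ∈ drawEvent R r q m → (drawLetter R U m = q m ↔ U (m + 1) ∈ V) := by
          intro hU
          have hc := drawCounts_eq hU.2
          simp only [drawLetter, hc, hV, Set.mem_ofPred_eq, ← hAdef, ← hBdef, hN]
          rw [Bool.eq_iff_iff, decide_eq_true_eq]
        constructor
        · intro hU
          have hU' : U ∈ drawEvent R r q m := ⟨hU.1, fun j hj => hU.2 j (by omega)⟩
          exact ⟨hU', (hstep hU').1 (hU.2 m (by omega))⟩
        · rintro ⟨hU, hV'⟩
          refine ⟨hU.1, fun j hj => ?_⟩
          rcases Nat.lt_succ_iff_lt_or_eq.1 hj with hj' | rfl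
          · exact hU.2 j hj'
          · exact (hstep hU).2 hV'
      by_cases h1 : U ∈ drawEvent R r q m <;> by_cases h2 : U (m + 1) ∈ V <;>
        simp [Set.indicator, hiff, h1, h2]
    have hind : Measurable ((drawEvent R r q m).indicator (1 : (ℕ → unitInterval) → ℝ≥0∞)) :=
      measurable_one.indicator (measurableSet_drawEvent R r q m)
    have hindV : Measurable (V.indicator (1 : unitInterval → ℝ≥0∞)) :=
      measurable_one.indicator hVm
    -- The number `U (m + 1)` is independent of the first `m` letters and of the length, which uses
    -- `U 0`.
    have hprod : unifSeq (drawEvent R r q (m + 1)) = unifSeq (drawEvent R r q m) * volume V := by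
      rw [← lintegral_indicator_one (measurableSet_drawEvent R r q (m + 1))]
      simp only [hsplit]
      rw [lintegral_infinitePi_coord (volume : Measure unitInterval) (m + 1)
        (H := fun U u => (drawEvent R r q m).indicator 1 U * V.indicator 1 u)
        ((hind.comp measurable_fst).mul (hindV.comp measurable_snd)) fun U ξ ξ' => by
          congr 1
          have : Function.update U (m + 1) ξ' ∈ drawEvent R r q m ↔ U ∈ drawEvent R r q m := by
            have h0 : Function.update U (m + 1) ξ' 0 = U 0 := Function.update_of_ne (by omega) _ _
            have hl : ∀ j < m, drawLetter R (Function.update U (m + 1) ξ') j =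
                drawLetter R U j := fun j hj =>
              drawLetter_congr fun i hi => Function.update_of_ne (by omega) _ _
            simp only [drawEvent, Set.mem_ofPred_eq, h0]
            refine and_congr_right fun _ => forall₂_congr fun j hj => ?_
            rw [hl j hj]
          by_cases h : U ∈ drawEvent R r q m
          · rw [Set.indicator_of_mem (this.2 h), Set.indicator_of_mem h]; rfl
          · rw [Set.indicator_of_notMem (mt this.1 h), Set.indicator_of_notMem h]]
      simp only [lintegral_const_mul _ hindV, lintegral_indicator_one hVm]
      rw [lintegral_mul_const _ hind, lintegral_indicator_one (measurableSet_drawEvent R r q m)]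
    have hRA : (R - A : ℕ) ≤ R + R - m := by omega
    have hV1 := volume_floor_mul_lt hNpos hRA
    have hNr : (0 : ℝ) < ((R + R - m : ℕ) : ℝ) := by exact_mod_cast hNpos
    have hD : (0 : ℝ) < ((R + R).descFactorial m : ℕ) := by
      exact_mod_cast Nat.descFactorial_pos.2 (by omega)
    have hR : (0 : ℝ) < R := by exact_mod_cast (by omega : 0 < R)
    rw [hprod, ih', Nat.count_succ, Nat.count_succ, ← hAdef, ← hBdef]
    cases hq : q m
    · have hVe : V = {u : unitInterval | ⌊((R + R - m : ℕ) : ℝ) * (u : ℝ)⌋₊ < R - A}ᶜ := by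
        ext u; simp [hV, hq]
      have hsub : (1 : ℝ) - ((R - A : ℕ) : ℝ) / ((R + R - m : ℕ) : ℝ) =
          ((R - B : ℕ) : ℝ) / ((R + R - m : ℕ) : ℝ) := by
        rw [eq_div_iff hNr.ne', sub_mul, div_mul_cancel₀ _ hNr.ne', one_mul, ← hN]
        push_cast; ring
      rw [hVe, prob_compl_eq_one_sub (measurableSet_floor_mul_lt _ _), hV1, ← ENNReal.ofReal_one,
        ← ENNReal.ofReal_sub _ (by positivity), hsub, ← ENNReal.ofReal_mul (by positivity)]
      congr 1
      simp only [Bool.false_eq_true, if_false, if_true, add_zero, Nat.descFactorial_succ]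
      push_cast
      field_simp
    · have hVe : V = {u : unitInterval | ⌊((R + R - m : ℕ) : ℝ) * (u : ℝ)⌋₊ < R - A} := by
        ext u; simp [hV, hq]
      rw [hVe, hV1, ← ENNReal.ofReal_mul (by positivity)]
      congr 1
      simp only [Bool.true_eq_false, if_false, if_true, add_zero, Nat.descFactorial_succ]
      push_cast
      field_simp

theorem count_shuffleLetter_total {R : ℕ} (e : Fin R ⊕ Fin R ≃ Fin (R + R)) :
    Nat.count (fun j => shuffleLetter e j = true) (R + R) = R ∧
      Nat.count (fun j => shuffleLetter e j = false) (R + R) = R := by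
  have h1 : Nat.count (fun j => shuffleLetter e j = true) (R + R) = R := by
    rw [Nat.count_eq_card_filter_range]
    refine Eq.trans ?_ (Finset.card_fin R)
    symm
    refine Finset.card_bij (fun k _ => (e (Sum.inl k) : ℕ)) (fun k _ => ?_) (fun a _ b _ hab => ?_)
      (fun i hi => ?_)
    · exact Finset.mem_filter.2 ⟨Finset.mem_range.2 (e _).2, shuffleLetter_inl e k⟩
    · exact Sum.inl_injective (e.injective (Fin.ext hab))
    · obtain ⟨hi1, hi2⟩ := Finset.mem_filter.1 hi
      obtain ⟨k, hk⟩ := exists_inl_of_shuffleLetter (e := e) (i := ⟨i, Finset.mem_range.1 hi1⟩) hi2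
      exact ⟨k, Finset.mem_univ _, by rw [hk]⟩
  have := count_true_add_count_false (shuffleLetter e) (R + R)
  exact ⟨h1, by omega⟩

/-- For a complete shuffle the falling factorials give `R! R! / (2R)!`, the same value for all
shuffles. -/
theorem drawEvent_shuffle_measure {R : ℕ} (r : Fin R) (e : Fin R ⊕ Fin R ≃ Fin (R + R)) :
    unifSeq (drawEvent R r (shuffleLetter e) (R + R)) =
      ((R * (shuffles R).card : ℕ) : ℝ≥0∞)⁻¹ := by
  obtain ⟨hA, hB⟩ := count_shuffleLetter_total e
  have hR : 0 < R := r.pos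
  rw [drawEvent_measure r.2 _ le_rfl hA.le hB.le, hA, hB, card_shuffles, Nat.descFactorial_self,
    Nat.descFactorial_self, ← ENNReal.ofReal_natCast,
    ← ENNReal.ofReal_inv_of_pos (by
      exact_mod_cast Nat.mul_pos hR (Nat.choose_pos (Nat.le_add_left R R)))]
  congr 1
  have h1 : ((R + R).choose R : ℝ) * (R.factorial * R.factorial) = ((R + R).factorial : ℝ) := by
    have := Nat.add_choose_mul_factorial_mul_factorial R R
    rw [← mul_assoc]
    exact_mod_cast this
  have h2 : (0 : ℝ) < R.factorial := by exact_mod_cast R.factorial_pos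
  have h3 : (0 : ℝ) < (R + R).choose R := by exact_mod_cast Nat.choose_pos (Nat.le_add_left R R)
  have h4 : (0 : ℝ) < R := by exact_mod_cast hR
  rw [← h1]
  push_cast
  field_simp

end Letters

/-! ### The sampling distribution as the law of an explicit construction -/

section Construction

variable {d : ℕ}

theorem measurable_vecList_mk {X : Type*} [MeasurableSpace X] {N : X → ℕ} {f : X → ℕ → Vec d}
    (hN : Measurable N) (hf : ∀ i, Measurable fun x => f x i) :
    Measurable fun x => (⟨N x, fun i => f x i⟩ : VecList d) := by
  have h : Measurable fun q : X × ℕ => (⟨q.2, fun i => f q.1 i⟩ : VecList d) :=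
    measurable_from_prod_countable_left fun r =>
      (measurable_sigma_mk r).comp (measurable_pi_lambda _ fun i => hf i)
  exact h.comp (measurable_id.prodMk hN)

/-- The list built from a sequence of vectors and a sequence of numbers in `[0, 1]`. -/
def drawnList (R : ℕ) (ρ : ℝ) (q : (ℕ → Vec d) × (ℕ → unitInterval)) : VecList d :=
  ⟨⌊(R : ℝ) * (q.2 0 : ℝ)⌋₊ + 1, fun i => mixVec ρ (drawLetter R q.2) q.1 i⟩

theorem measurable_mixState (R : ℕ) (ρ : ℝ) (i : ℕ) :
    Measurable fun q : (ℕ → Vec d) × (ℕ → unitInterval) =>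
      mixState ρ (drawLetter R q.2) q.1 i := by
  induction i with
  | zero => exact measurable_const
  | succ i ih =>
    have hG : Measurable fun q : (ℕ → Vec d) × (ℕ → unitInterval) => q.1 i :=
      (measurable_seq_apply i).comp measurable_fst
    exact Measurable.ite (measurable_snd (measurableSet_drawLetter R i true))
      (measurable_const.prodMk ((ih.snd.const_smul ρ).add (ih.fst.smul hG))) ih

theorem measurable_mixVec (R : ℕ) (ρ : ℝ) (i : ℕ) :
    Measurable fun q : (ℕ → Vec d) × (ℕ → unitInterval) =>
      mixVec ρ (drawLetter R q.2) q.1 i := by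
  have hG : Measurable fun q : (ℕ → Vec d) × (ℕ → unitInterval) => q.1 i :=
    (measurable_seq_apply i).comp measurable_fst
  have ih := measurable_mixState (d := d) R ρ i
  exact Measurable.ite (measurable_snd (measurableSet_drawLetter R i true))
    ((ih.snd.const_smul ρ).add (ih.fst.smul hG)) hG

theorem measurable_drawnList (R : ℕ) (ρ : ℝ) : Measurable (drawnList (d := d) R ρ) := by
  refine measurable_vecList_mk ?_ (measurable_mixVec R ρ)
  exact (Nat.measurable_floor.comp
    (((measurable_unif_apply 0).comp measurable_snd).const_mul _)).add_const 1

theorem pairwiseDisjoint_drawEvent (R : ℕ) :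
    Set.PairwiseDisjoint (↑(shuffles R ×ˢ (Finset.univ : Finset (Fin R))))
      fun k : (Fin R ⊕ Fin R ≃ Fin (R + R)) × Fin R =>
        drawEvent R k.2 (shuffleLetter k.1) (R + R) := by
  intro k hk k' hk' hne
  refine Set.disjoint_left.2 fun U hU hU' => hne ?_
  have h1 := (Finset.mem_product.1 (Finset.mem_coe.1 hk)).1
  have h1' := (Finset.mem_product.1 (Finset.mem_coe.1 hk')).1
  refine Prod.ext (shuffleLetter_injOn h1 h1' fun i hi => ?_) (Fin.ext ?_)
  · rw [← hU.2 i hi, hU'.2 i hi]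
  · exact hU.1.symm.trans hU'.1

/-- The draws determine a length and a shuffle almost surely, uniformly distributed. -/
theorem iUnion_drawEvent_ae {R : ℕ} (hR : 1 ≤ R) :
    (⋃ k ∈ shuffles R ×ˢ (Finset.univ : Finset (Fin R)),
      drawEvent R k.2 (shuffleLetter k.1) (R + R) : Set (ℕ → unitInterval)) =ᵐ[unifSeq]
        Set.univ := by
  have hm := fun k : (Fin R ⊕ Fin R ≃ Fin (R + R)) × Fin R =>
    measurableSet_drawEvent R k.2 (shuffleLetter k.1) (R + R)
  have hd := pairwiseDisjoint_drawEvent R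
  refine ae_eq_univ.2 ?_
  rw [prob_compl_eq_zero_iff (Finset.measurableSet_biUnion _ fun k _ => hm k),
    measure_biUnion_finset hd fun k _ => hm k]
  simp only [drawEvent_shuffle_measure]
  rw [Finset.sum_const, Finset.card_product, Finset.card_univ, Fintype.card_fin, nsmul_eq_mul,
    mul_comm (shuffles R).card]
  refine ENNReal.mul_inv_cancel ?_ (ENNReal.natCast_ne_top _)
  rw [card_shuffles]
  exact_mod_cast (Nat.mul_pos hR (Nat.choose_pos (Nat.le_add_left R R))).ne'

/-- Condition on the length and on all letters. On each such event the construction is a fixed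
function of the fresh vectors, which may be taken as a merge of two independent sources; this
recovers the corresponding term of `sampleDist`. -/
theorem sampleDist_eq_map {R : ℕ} (hR : 1 ≤ R) (ρ : ℝ) :
    sampleDist d R ρ = ((gaussSeq d).prod unifSeq).map (drawnList R ρ) := by
  refine Measure.ext_of_lintegral _ fun F hF => ?_
  have hFd : Measurable fun q => F (drawnList (d := d) R ρ q) := hF.comp (measurable_drawnList R ρ)
  rw [lintegral_sampleDist hF, lintegral_map hF (measurable_drawnList R ρ),
    lintegral_prod_symm _ hFd.aemeasurable, ← setLIntegral_univ,
    ← setLIntegral_congr (iUnion_drawEvent_ae hR)]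
  have hm := fun k : (Fin R ⊕ Fin R ≃ Fin (R + R)) × Fin R =>
    measurableSet_drawEvent R k.2 (shuffleLetter k.1) (R + R)
  have hd := pairwiseDisjoint_drawEvent R
  rw [lintegral_biUnion_finset hd fun k _ => hm k, Finset.sum_product, Finset.mul_sum]
  refine Finset.sum_congr rfl fun e he => ?_
  rw [Finset.mul_sum]
  refine Finset.sum_congr rfl fun r _ => ?_
  have hFr : Measurable fun G : ℕ → Vec d =>
      F ⟨r + 1, fun i => mixVec ρ (shuffleLetter e) G i⟩ := by
    refine hF.comp ((measurable_sigma_mk _).comp (measurable_pi_lambda _ fun i => ?_))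
    have hst : ∀ i, Measurable fun G : ℕ → Vec d => mixState ρ (shuffleLetter e) G i := by
      intro i
      induction i with
      | zero => exact measurable_const
      | succ i ih =>
        simp only [mixState]
        split_ifs
        · exact measurable_const.prodMk ((ih.snd.const_smul ρ).add
            (ih.fst.smul (measurable_seq_apply i)))
        · exact ih
    unfold mixVec
    split_ifs
    · exact ((hst i).snd.const_smul ρ).add ((hst i).fst.smul (measurable_seq_apply i))
    · exact measurable_seq_apply i
  have hconst : ∀ U ∈ drawEvent R r (shuffleLetter e) (R + R),
      ∫⁻ G, F (drawnList R ρ (G, U)) ∂(gaussSeq d) =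
        ∫⁻ g, ∫⁻ h, F ⟨r + 1, fun i => wordVec (shuffleLetter e) (corrChain ρ g) h i⟩
          ∂(gaussSeq d) ∂(gaussSeq d) := by
    intro U hU
    have h1 : ∀ G : ℕ → Vec d, drawnList R ρ (G, U) =
        ⟨r + 1, fun i => mixVec ρ (shuffleLetter e) G i⟩ := by
      intro G
      simp only [drawnList]
      rw [hU.1]
      congr 1
      funext i
      exact mixVec_congr fun j hj => hU.2 j (by omega)
    simp only [h1]
    have h2 := lintegral_map (μ := (gaussSeq d).prod (gaussSeq d)) hFr
      (measurable_wordVec (shuffleLetter e))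
    rw [gaussSeq_prod_map_wordVec] at h2
    refine h2.trans ((lintegral_prod _
      (hFr.comp (measurable_wordVec (shuffleLetter e))).aemeasurable).trans ?_)
    simp only [Function.comp_apply, mixVec_wordVec]
  rw [setLIntegral_congr_fun (hm (e, r)) hconst, setLIntegral_const,
    drawEvent_shuffle_measure r e, mul_comm]

/-- The `i`-th vector made from a sequence of numbers. -/
def gaussRow (d : ℕ) (ξ : ℕ → ℝ) (i : ℕ) : Vec d :=
  WithLp.toLp 2 fun j : Fin d => ξ (i * d + j)

theorem measurable_gaussRow : Measurable (gaussRow d) := by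
  refine measurable_pi_lambda _ fun i => ?_
  exact (WithLp.measurable_toLp 2 (Fin d → ℝ)).comp
    (measurable_pi_lambda _ fun j => measurable_pi_apply (i * d + (j : ℕ)))

/-- Rows of independent Gaussian numbers are independent Gaussian vectors. -/
theorem map_gaussRow : (Measure.infinitePi fun _ : ℕ => gaussianReal 0 1).map (gaussRow d) =
    gaussSeq d := by
  have hinj : Function.Injective fun k : ℕ × Fin d => k.1 * d + (k.2 : ℕ) := by
    rintro ⟨i, j⟩ ⟨i', j'⟩ h
    have hd : 0 < d := j.pos
    have h1 : (i * d + (j : ℕ)) / d = i := by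
      rw [mul_comm, Nat.mul_add_div hd, Nat.div_eq_of_lt j.2, add_zero]
    have h2 : (i' * d + (j' : ℕ)) / d = i' := by
      rw [mul_comm, Nat.mul_add_div hd, Nat.div_eq_of_lt j'.2, add_zero]
    simp only at h
    rw [h] at h1
    have h3 : i = i' := h1.symm.trans h2
    subst h3
    simp only [Prod.mk.injEq, true_and]
    exact Fin.ext (by omega)
  have h1 := infinitePi_map_comp (gaussianReal 0 1) hinj
  have h2 := Measure.infinitePi_map_curry (fun (_ : ℕ) (_ : Fin d) => gaussianReal 0 1)
  have h3 := Measure.infinitePi_map_pi (μ := fun _ : ℕ => Measure.infinitePi fun _ : Fin d =>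
    gaussianReal 0 1) (f := fun _ => WithLp.toLp 2) fun _ => WithLp.measurable_toLp 2 (Fin d → ℝ)
  rw [← h2, ← h1, Measure.map_map (by fun_prop) (by fun_prop),
    Measure.map_map (by fun_prop) (by fun_prop)] at h3
  simp only [Measure.infinitePi_eq_pi (ι := Fin d), map_pi_eq_stdGaussian] at h3
  exact h3

theorem sampleDist_eq_tapeLaw_map {R : ℕ} (hR : 1 ≤ R) (ρ : ℝ) :
    sampleDist d R ρ = tapeLaw.map fun ω => drawnList R ρ (gaussRow d ω.1, ω.2) := by
  have h := Measure.map_prod_map (Measure.infinitePi fun _ : ℕ => gaussianReal 0 1) unifSeq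
    (measurable_gaussRow (d := d)) measurable_id
  rw [map_gaussRow, Measure.map_id] at h
  rw [sampleDist_eq_map hR, h,
    Measure.map_map (measurable_drawnList R ρ) (measurable_gaussRow.prodMap measurable_id)]
  rfl

theorem isProbabilityMeasure_sampleDist {R : ℕ} (hR : 1 ≤ R) (ρ : ℝ) :
    IsProbabilityMeasure (sampleDist d R ρ) := by
  rw [sampleDist_eq_map hR]
  exact Measure.isProbabilityMeasure_map (measurable_drawnList R ρ).aemeasurable

theorem length_le_of_sampleDist {R : ℕ} (ρ : ℝ) : ∀ᵐ l ∂(sampleDist d R ρ), l.1 ≤ R := by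
  rw [ae_iff]
  have hm : MeasurableSet {l : VecList d | ¬ l.1 ≤ R} := by
    have : Measurable fun l : VecList d => l.1 := measurable_sigma fun r => measurable_const
    exact (measurableSet_le this measurable_const).compl
  rw [← lintegral_indicator_one hm, lintegral_sampleDist (measurable_one.indicator hm)]
  refine mul_eq_zero_of_right _ (Finset.sum_eq_zero fun e _ => Finset.sum_eq_zero fun r _ => ?_)
  simp

end Construction

/-! ### A program for the sampling distribution -/

section Machine

open Prog

/-- One coordinate of the next correlated vector, written to its row and to the work row. -/
def corrStep : Prog :=
  seq (realGaussian ⟨3, 4⟩) <| seq (realMul ⟨3, 4⟩ ⟨12, 13⟩ ⟨3, 4⟩) <|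
  seq (realMul ⟨9, 4⟩ ⟨12, 8⟩ ⟨9, 4⟩) <| seq (realAdd ⟨9, 4⟩ ⟨9, 4⟩ ⟨3, 4⟩) <|
  -- Adding the zero cell copies the new coordinate from the work row to the output row.
  seq (realAdd ⟨3, 4⟩ ⟨9, 4⟩ ⟨12, 11⟩) (natAdd 4 4 8)

/-- One coordinate of the next independent vector. -/
def freshStep : Prog :=
  seq (realGaussian ⟨3, 4⟩) (natAdd 4 4 8)

/-- Draw the next letter and the next vector. -/
def drawStep : Prog :=
  seq (natAdd 7 5 6) <| seq (natUniform 7 7) <|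
  seq (ifLt 7 5
    (seq (natSub 5 5 8) <| seq (natConst 4 0) <|
      -- Once a correlated vector exists, fresh noise enters with weight `√(1 - ρ²)`.
      seq (loop 0 corrStep) (realSqrt ⟨12, 13⟩ ⟨12, 14⟩))
    (seq (natSub 6 6 8) <| seq (natConst 4 0) (loop 0 freshStep)))
  (natAdd 3 3 8)

/-- Set up the constants, and draw the length of the list. -/
def drawInit : Prog :=
  seq (natConst 8 1) <| seq (natConst 13 2) <| seq (natConst 14 3) <|
  -- Rows `2R` (constants) and `2R + 1` (last correlated vector) lie beyond the `2R` output rows.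
  seq (natAdd 12 1 1) <| seq (natAdd 9 12 8) <|
  seq (realOfNat ⟨12, 13⟩ 8) <| seq (realOfNat ⟨12, 11⟩ 1) <|
  -- Row `2R` will hold `0`, `ρ`, the noise weight (initially `1`) and `1 - ρ²` in columns `0` to
  -- `3`; column `0` first holds `R`.
  seq (realDiv ⟨12, 8⟩ ⟨12, 13⟩ ⟨12, 11⟩) <| seq (realSub ⟨12, 8⟩ ⟨12, 13⟩ ⟨12, 8⟩) <|
  seq (realMul ⟨12, 14⟩ ⟨12, 8⟩ ⟨12, 8⟩) <| seq (realSub ⟨12, 14⟩ ⟨12, 13⟩ ⟨12, 14⟩) <|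
  seq (realSub ⟨12, 11⟩ ⟨12, 11⟩ ⟨12, 11⟩) <|
  seq (natUniform 2 1) <| seq (natAdd 2 2 8) <|
  seq (natAdd 5 1 11) (natAdd 6 1 11)

/-- The sampling program. -/
def drawProg : Prog := seq drawInit (loop 12 drawStep)

variable {d R : ℕ} {ω : Tape}

/-- Row `c` is the last correlated vector and row `w` the constants. Distinctness of `i`, `c`, `w`
rules out aliasing, so each coordinate is read before it is overwritten and no constant is damaged.
-/
theorem corrStep_run (s : MachineState) {i j c w : ℕ} (h3 : s.reg 3 = i) (h4 : s.reg 4 = j)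
    (h9 : s.reg 9 = c) (h12 : s.reg 12 = w) (h8 : s.reg 8 = 1) (h11 : s.reg 11 = 0)
    (h13 : s.reg 13 = 2) (hic : i ≠ c) (hiw : i ≠ w) (hcw : c ≠ w) (h0 : s.cell w 0 = 0) :
    corrStep.run ω s =
      { reg := Function.update s.reg 4 (j + 1)
        cell := fun m k => if (m = i ∨ m = c) ∧ k = j then
          s.cell w 1 * s.cell c j + s.cell w 2 * ω.1 s.gaussPos else s.cell m k
        gaussPos := s.gaussPos + 1
        unifPos := s.unifPos
        steps := s.steps + 6 } := by
  simp only [corrStep, Prog.run, MachineState.set, MachineState.get, MachineState.tick,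
    MachineState.setReg, h3, h4, h9, h12, h8, h11, h13]
  congr 1
  funext m k
  simp only [Function.update_apply, hic, hic.symm, hiw.symm, hcw.symm, if_true, if_false]
  by_cases hm : m = i
  · subst hm
    by_cases hk : k = j
    · subst hk; simp [hic, h0]
    · simp [hic, hk]
  · by_cases hm' : m = c
    · subst hm'
      by_cases hk : k = j
      · subst hk; simp [hm]
      · simp [hm, hk]
    · simp [hm, hm']

theorem corrStep_iterate (s : MachineState) {i c w : ℕ} (h3 : s.reg 3 = i) (h4 : s.reg 4 = 0)
    (h9 : s.reg 9 = c) (h12 : s.reg 12 = w) (h8 : s.reg 8 = 1) (h11 : s.reg 11 = 0)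
    (h13 : s.reg 13 = 2) (hic : i ≠ c) (hiw : i ≠ w) (hcw : c ≠ w) (h0 : s.cell w 0 = 0) (k : ℕ) :
    (fun t => (corrStep.run ω t).tick)^[k] s =
      { reg := Function.update s.reg 4 k
        cell := fun m j => if (m = i ∨ m = c) ∧ j < k then
          s.cell w 1 * s.cell c j + s.cell w 2 * ω.1 (s.gaussPos + j) else s.cell m j
        gaussPos := s.gaussPos + k
        unifPos := s.unifPos
        steps := s.steps + 7 * k } := by
  induction k with
  | zero =>
    have h : Function.update s.reg 4 0 = s.reg := by rw [← h4]; exact Function.update_eq_self _ _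
    simp [h]
  | succ k ih =>
    rw [Function.iterate_succ_apply', ih]
    rw [corrStep_run _ (i := i) (j := k) (c := c) (w := w) (by simpa using h3) (by simp)
      (by simpa using h9) (by simpa using h12) (by simpa using h8) (by simpa using h11)
      (by simpa using h13) hic hiw hcw (by simp [hiw.symm, hcw.symm, h0])]
    simp only [MachineState.tick, Function.update_idem, hiw.symm, hcw.symm, or_self, false_and,
      if_false, lt_irrefl, and_false, add_assoc]
    congr 1
    · funext m j
      by_cases hm : m = i ∨ m = c
      · rcases lt_trichotomy j k with hj | rfl | hj
        · simp [hm, hj, hj.ne, hj.trans (Nat.lt_succ_self k)]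
        · simp [hm]
        · simp [hm, hj.ne', not_lt.2 hj.le, not_le.2 hj]
      · simp [hm]

theorem freshStep_run (s : MachineState) {i j : ℕ} (h3 : s.reg 3 = i) (h4 : s.reg 4 = j)
    (h8 : s.reg 8 = 1) :
    freshStep.run ω s =
      { reg := Function.update s.reg 4 (j + 1)
        cell := fun m k => if m = i ∧ k = j then ω.1 s.gaussPos else s.cell m k
        gaussPos := s.gaussPos + 1
        unifPos := s.unifPos
        steps := s.steps + 2 } := by
  simp only [freshStep, Prog.run, MachineState.set, MachineState.tick, MachineState.setReg,
    h3, h4, h8]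
  congr 1
  funext m k
  simp only [Function.update_apply]
  by_cases hm : m = i <;> by_cases hk : k = j <;> simp [hm, hk]

theorem freshStep_iterate (s : MachineState) {i : ℕ} (h3 : s.reg 3 = i) (h4 : s.reg 4 = 0)
    (h8 : s.reg 8 = 1) (k : ℕ) :
    (fun t => (freshStep.run ω t).tick)^[k] s =
      { reg := Function.update s.reg 4 k
        cell := fun m j => if m = i ∧ j < k then ω.1 (s.gaussPos + j) else s.cell m j
        gaussPos := s.gaussPos + k
        unifPos := s.unifPos
        steps := s.steps + 3 * k } := by
  induction k with
  | zero =>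
    have h : Function.update s.reg 4 0 = s.reg := by rw [← h4]; exact Function.update_eq_self _ _
    simp [h]
  | succ k ih =>
    rw [Function.iterate_succ_apply', ih]
    rw [freshStep_run _ (i := i) (j := k) (by simpa using h3) (by simp) (by simpa using h8)]
    simp only [MachineState.tick, Function.update_idem, add_assoc]
    congr 1
    · funext m j
      by_cases hm : m = i
      · rcases lt_trichotomy j k with hj | rfl | hj
        · simp [hm, hj, hj.ne, hj.trans (Nat.lt_succ_self k)]
        · simp [hm]
        · simp [hm, hj.ne', not_lt.2 hj.le, not_le.2 hj]
      · simp [hm]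

theorem corrLoop_run (s : MachineState) {i c w : ℕ} (h0 : s.reg 0 = d) (h3 : s.reg 3 = i)
    (h4 : s.reg 4 = 0) (h9 : s.reg 9 = c) (h12 : s.reg 12 = w) (h8 : s.reg 8 = 1)
    (h11 : s.reg 11 = 0) (h13 : s.reg 13 = 2) (hic : i ≠ c) (hiw : i ≠ w) (hcw : c ≠ w)
    (hz : s.cell w 0 = 0) :
    (loop 0 corrStep).run ω s =
      { reg := Function.update s.reg 4 d
        cell := fun m j => if (m = i ∨ m = c) ∧ j < d then
          s.cell w 1 * s.cell c j + s.cell w 2 * ω.1 (s.gaussPos + j) else s.cell m j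
        gaussPos := s.gaussPos + d
        unifPos := s.unifPos
        steps := s.steps + 1 + 7 * d } := by
  change (fun t => (corrStep.run ω t).tick)^[s.reg 0] s.tick = _
  rw [h0]
  exact corrStep_iterate s.tick h3 h4 h9 h12 h8 h11 h13 hic hiw hcw hz d

theorem freshLoop_run (s : MachineState) {i : ℕ} (h0 : s.reg 0 = d) (h3 : s.reg 3 = i)
    (h4 : s.reg 4 = 0) (h8 : s.reg 8 = 1) :
    (loop 0 freshStep).run ω s =
      { reg := Function.update s.reg 4 d
        cell := fun m j => if m = i ∧ j < d then ω.1 (s.gaussPos + j) else s.cell m j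
        gaussPos := s.gaussPos + d
        unifPos := s.unifPos
        steps := s.steps + 1 + 3 * d } := by
  change (fun t => (freshStep.run ω t).tick)^[s.reg 0] s.tick = _
  rw [h0]
  exact freshStep_iterate s.tick h3 h4 h8 d

/-- The state of the program before the `i`-th draw. -/
structure DrawInv (d R : ℕ) (ω : Tape) (i : ℕ) (s : MachineState) : Prop where
  reg0 : s.reg 0 = d
  reg2 : s.reg 2 = ⌊(R : ℝ) * (ω.2 0 : ℝ)⌋₊ + 1
  reg3 : s.reg 3 = i
  reg5 : s.reg 5 = (drawCounts R ω.2 i).1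
  reg6 : s.reg 6 = (drawCounts R ω.2 i).2
  reg8 : s.reg 8 = 1
  reg9 : s.reg 9 = R + R + 1
  reg11 : s.reg 11 = 0
  reg12 : s.reg 12 = R + R
  reg13 : s.reg 13 = 2
  reg14 : s.reg 14 = 3
  zero : s.cell (R + R) 0 = 0
  rho : s.cell (R + R) 1 = 1 - 1 / (R : ℝ)
  weight : s.cell (R + R) 2 =
    (mixState (1 - 1 / (R : ℝ)) (drawLetter R ω.2) (gaussRow d ω.1) i).1
  var : s.cell (R + R) 3 = 1 - (1 - 1 / (R : ℝ)) ^ 2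
  last : ∀ j : Fin d, s.cell (R + R + 1) j =
    (mixState (1 - 1 / (R : ℝ)) (drawLetter R ω.2) (gaussRow d ω.1) i).2 j
  rows : ∀ m < i, ∀ j : Fin d, s.cell m j =
    mixVec (1 - 1 / (R : ℝ)) (drawLetter R ω.2) (gaussRow d ω.1) m j
  gaussPos : s.gaussPos = i * d
  unifPos : s.unifPos = i + 1
  steps : s.steps ≤ 17 + i * (10 + 7 * d)

/-- The extra step is the entry into the main loop: sixteen instructions and this one make the `17`
of the step bound. -/
theorem drawInit_inv : DrawInv d R ω 0 (drawInit.run ω (initState d R)).tick := by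
  constructor <;>
    simp [drawInit, Prog.run, initState, MachineState.set, MachineState.get, MachineState.tick,
      MachineState.setReg, Function.update_apply, drawCounts, mixState, pow_two]

theorem drawStep_run {i : ℕ} {s : MachineState} (h : DrawInv d R ω i s) (hi : i < R + R)
    {fl : ℕ} (hfl : ⌊(((drawCounts R ω.2 i).1 + (drawCounts R ω.2 i).2 : ℕ) : ℝ) *
      (ω.2 (i + 1) : ℝ)⌋₊ = fl) :
    drawStep.run ω s = if drawLetter R ω.2 i then
      { reg := Function.update (Function.update (Function.update (Function.update s.reg 7 fl) 5
          ((drawCounts R ω.2 i).1 - 1)) 4 d) 3 (i + 1)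
        cell := fun m j => if m = R + R ∧ j = 2 then Real.sqrt (s.cell (R + R) 3)
          else if (m = i ∨ m = R + R + 1) ∧ j < d then s.cell (R + R) 1 * s.cell (R + R + 1) j +
            s.cell (R + R) 2 * ω.1 (i * d + j) else s.cell m j
        gaussPos := i * d + d
        unifPos := i + 2
        steps := s.steps + 8 + 7 * d }
    else
      { reg := Function.update (Function.update (Function.update (Function.update s.reg 7 fl) 6
          ((drawCounts R ω.2 i).2 - 1)) 4 d) 3 (i + 1)
        cell := fun m j => if m = i ∧ j < d then ω.1 (i * d + j) else s.cell m j
        gaussPos := i * d + d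
        unifPos := i + 2
        steps := s.steps + 7 + 3 * d } := by
  set s' : MachineState :=
    { reg := Function.update s.reg 7 fl
      cell := s.cell
      gaussPos := i * d
      unifPos := i + 2
      steps := s.steps + 3 } with hs'
  have hrun : drawStep.run ω s = (natAdd 3 3 8).run ω
      (if drawLetter R ω.2 i then (realSqrt ⟨12, 13⟩ ⟨12, 14⟩).run ω ((loop 0 corrStep).run ω
        ((natConst 4 0).run ω ((natSub 5 5 8).run ω s')))
      else (loop 0 freshStep).run ω ((natConst 4 0).run ω ((natSub 6 6 8).run ω s'))) := by
    have hcond : fl < (drawCounts R ω.2 i).1 ↔ drawLetter R ω.2 i = true := by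
      rw [← hfl]
      simp only [drawLetter, decide_eq_true_eq]
    rw [drawStep]
    simp only [Prog.run, MachineState.tick, MachineState.setReg, Function.update_self,
      Function.update_idem, ne_eq, Nat.reduceEqDiff, not_false_eq_true, Function.update_of_ne,
      h.reg5, h.reg6, h.unifPos, h.gaussPos, hfl, hcond, hs']
  rw [hrun]
  split_ifs with hp
  · rw [corrLoop_run (d := d) (i := i) (c := R + R + 1) (w := R + R)
      ((natConst 4 0).run ω ((natSub 5 5 8).run ω s'))
      (by simp [Prog.run, MachineState.tick, MachineState.setReg, hs', h.reg0])
      (by simp [Prog.run, MachineState.tick, MachineState.setReg, hs', h.reg3])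
      (by simp [Prog.run, MachineState.tick, MachineState.setReg])
      (by simp [Prog.run, MachineState.tick, MachineState.setReg, hs', h.reg9])
      (by simp [Prog.run, MachineState.tick, MachineState.setReg, hs', h.reg12])
      (by simp [Prog.run, MachineState.tick, MachineState.setReg, hs', h.reg8])
      (by simp [Prog.run, MachineState.tick, MachineState.setReg, hs', h.reg11])
      (by simp [Prog.run, MachineState.tick, MachineState.setReg, hs', h.reg13])
      (by omega) (by omega) (by omega) h.zero]
    simp only [Prog.run, MachineState.tick, MachineState.setReg, MachineState.set,
      MachineState.get, hs', Function.update_idem, ne_eq, Nat.reduceEqDiff,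
      not_false_eq_true, Function.update_of_ne, h.reg3, h.reg5, h.reg8, h.reg12, h.reg13, h.reg14]
    congr 1
    · funext m j
      have hne : R + R ≠ i := hi.ne'
      simp only [Function.update_apply]
      by_cases hm : m = R + R
      · subst hm
        by_cases hj : j = 2
        · subst hj; simp [hne]
        · simp [hj]
      · simp [hm]
    · omega
  · rw [freshLoop_run (d := d) (i := i) ((natConst 4 0).run ω ((natSub 6 6 8).run ω s'))
      (by simp [Prog.run, MachineState.tick, MachineState.setReg, hs', h.reg0])
      (by simp [Prog.run, MachineState.tick, MachineState.setReg, hs', h.reg3])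
      (by simp [Prog.run, MachineState.tick, MachineState.setReg])
      (by simp [Prog.run, MachineState.tick, MachineState.setReg, hs', h.reg8])]
    simp only [Prog.run, MachineState.tick, MachineState.setReg, hs', Function.update_idem,
      ne_eq, Nat.reduceEqDiff,
      not_false_eq_true, Function.update_of_ne, h.reg3, h.reg6, h.reg8]
    congr 1
    omega

theorem drawStep_inv {i : ℕ} {s : MachineState} (h : DrawInv d R ω i s) (hi : i < R + R) :
    DrawInv d R ω (i + 1) (drawStep.run ω s).tick := by
  have hcounts := drawCounts_succ R ω.2 i
  have hne1 : R + R ≠ i := by omega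
  have hne2 : R + R + 1 ≠ i := by omega
  rw [drawStep_run h hi rfl]
  cases hpi : drawLetter R ω.2 i
  · rw [hpi] at hcounts
    simp only [Bool.false_eq_true, if_false, MachineState.tick] at hcounts ⊢
    constructor
    all_goals try simp [h.reg0, h.reg2, h.reg5, h.reg8, h.reg9, h.reg11, h.reg12, h.reg13,
      h.reg14, hcounts, hne1, h.zero, h.rho, h.weight, h.var, mixState, hpi]
    · intro j; simp [hne2, h.last]
    · intro m hm j
      rcases hm.lt_or_eq with hm' | rfl
      · simp [hm'.ne, h.rows m hm']
      · simp [mixVec, hpi, gaussRow]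
    · ring
    · have := h.steps
      linarith
  · rw [hpi] at hcounts
    simp only [if_true, MachineState.tick] at hcounts ⊢
    constructor
    all_goals try simp [h.reg0, h.reg2, h.reg6, h.reg8, h.reg9, h.reg11, h.reg12, h.reg13,
      h.reg14, hcounts, hne1, h.zero, h.rho, h.weight, h.var, mixState, hpi]
    · intro j; simp [h.last, gaussRow]
    · intro m hm j
      have hmR : m ≠ R + R := by omega
      have hmR1 : m ≠ R + R + 1 := by omega
      rcases hm.lt_or_eq with hm' | rfl
      · simp [hm'.ne, hmR, hmR1, h.rows m hm']
      · simp [mixVec, hpi, gaussRow, hmR, h.last]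
    · ring
    · have := h.steps
      linarith

theorem drawProg_inv : DrawInv d R ω (R + R)
    ((fun t => (drawStep.run ω t).tick)^[R + R] (drawInit.run ω (initState d R)).tick) := by
  have key : ∀ i ≤ R + R, DrawInv d R ω i
      ((fun t => (drawStep.run ω t).tick)^[i] (drawInit.run ω (initState d R)).tick) := by
    intro i hi
    induction i with
    | zero => exact drawInit_inv
    | succ i ih =>
      rw [Function.iterate_succ_apply']
      exact drawStep_inv (ih (by omega)) (by omega)
  exact key _ le_rfl

theorem drawProg_run : drawProg.run ω (initState d R) =
    (fun t => (drawStep.run ω t).tick)^[R + R] (drawInit.run ω (initState d R)).tick := by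
  have h : (drawInit.run ω (initState d R)).reg 12 = R + R :=
    (drawInit_inv (d := d) (R := R) (ω := ω)).reg12
  change (fun t => (drawStep.run ω t).tick)^[(drawInit.run ω (initState d R)).reg 12]
    (drawInit.run ω (initState d R)).tick = _
  rw [h]

theorem drawProg_output (hR : 1 ≤ R) : (drawProg.run ω (initState d R)).output d =
    drawnList R (1 - 1 / (R : ℝ)) (gaussRow d ω.1, ω.2) := by
  have h := drawProg_inv (d := d) (R := R) (ω := ω)
  rw [drawProg_run, MachineState.output, drawnList]
  generalize (fun t => (drawStep.run ω t).tick)^[R + R] (drawInit.run ω (initState d R)).tick = s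
    at h
  -- If the uniform number equals `1`, the length is `R + 1`. All `2R` rows are filled and `R + 1 ≤
  -- 2R`, so the identity holds for every tape, without an exceptional null set.
  have hlen : ⌊(R : ℝ) * (ω.2 0 : ℝ)⌋₊ ≤ R :=
    Nat.floor_le_of_le (mul_le_of_le_one_right (Nat.cast_nonneg _) (ω.2 0).2.2)
  have hrow : ∀ m < R + R, (WithLp.toLp 2 fun j : Fin d => s.cell m j : Vec d) =
      mixVec (1 - 1 / (R : ℝ)) (drawLetter R ω.2) (gaussRow d ω.1) m := by
    intro m hm
    ext j
    exact h.rows m hm j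
  rw [h.reg2]
  congr 1
  funext m
  exact hrow m (by have := m.2; omega)

theorem drawProg_steps : (drawProg.run ω (initState d R)).steps ≤ 31 * (d + R + 1) ^ 2 := by
  rw [drawProg_run]
  refine (drawProg_inv (d := d) (R := R) (ω := ω)).steps.trans ?_
  nlinarith [Nat.zero_le (d * d), Nat.zero_le (R * R), Nat.zero_le (d * R)]

theorem efficientlySamplable_sampleDist :
    EfficientlySamplable fun d R => sampleDist d R (1 - 1 / (R : ℝ)) := by
  -- Here `124 = 31 * 2²`, since `d + R + 1 ≤ 2 (d + R)` for `R ≥ 1`.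
  refine ⟨drawProg, 124, 2, fun d R hR => ⟨?_, fun ω => ?_⟩⟩
  · change sampleDist d R (1 - 1 / (R : ℝ)) = _
    rw [sampleDist_eq_tapeLaw_map hR]
    congr 1
    funext ω
    exact (drawProg_output hR).symm
  · refine drawProg_steps.trans ?_
    have : (d + R + 1) ^ 2 ≤ (2 * (d + R)) ^ 2 := Nat.pow_le_pow_left (by omega) 2
    calc 31 * (d + R + 1) ^ 2 ≤ 31 * (2 * (d + R)) ^ 2 := by gcongr
      _ = 124 * (d + R) ^ 2 := by ring

end Machine

/-! ### The expected number of far edges -/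

/-- The price of prescribing the shuffle and the length. -/
theorem mul_card_shuffles_le_exp {R : ℕ} (hR : 1 ≤ R) :
    ((R * (shuffles R).card : ℕ) : ℝ) ≤ Real.exp (3 * (R : ℝ) ^ 2) := by
  have h1 : R * (shuffles R).card ≤ 2 ^ (3 * R) := by
    rw [card_shuffles]
    calc R * (R + R).choose R ≤ 2 ^ R * 2 ^ (R + R) :=
          Nat.mul_le_mul Nat.lt_two_pow_self.le (Nat.choose_le_two_pow _ _)
      _ = 2 ^ (3 * R) := by rw [← pow_add]; congr 1; ring
  have h2 : (2 : ℝ) ≤ Real.exp 1 := by linarith [Real.add_one_le_exp 1]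
  have h3 : (1 : ℝ) ≤ R := by exact_mod_cast hR
  calc ((R * (shuffles R).card : ℕ) : ℝ) ≤ ((2 ^ (3 * R) : ℕ) : ℝ) := by exact_mod_cast h1
    _ = 2 ^ (3 * R) := by push_cast; rfl
    _ ≤ Real.exp 1 ^ (3 * R) := by gcongr
    _ = Real.exp (3 * R) := by rw [← Real.exp_nat_mul]; push_cast; ring_nf
    _ ≤ Real.exp (3 * (R : ℝ) ^ 2) := Real.exp_le_exp.2 (by nlinarith)

theorem le_integral_sampleDist {n d R : ℕ} {M : Vec d → Set (Fin n × Fin n)} {ρ : ℝ}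
    (hM : ∀ x y, MeasurableSet {u | (x, y) ∈ M u}) (hM' : ∀ u, IsDirectedMatching (M u))
    (hρ : ρ ^ 2 ≤ 1) (v : Fin n → Vec d) (L : ℝ) (hR : 1 ≤ R) {s : List Bool} (hs : s ≠ [])
    (hsR : s.length ≤ R) {a : ℝ}
    (ha : ENNReal.ofReal a ≤ ∑ y, farMass M v ρ L s y) :
    Real.exp (-(3 * (R : ℝ) ^ 2)) * a ≤
      ∫ l, (({p ∈ chained M l | L ≤ ‖v p.1 - v p.2‖ ^ 2}).ncard : ℝ) ∂(sampleDist d R ρ) := by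
  classical
  have hprob := isProbabilityMeasure_sampleDist (d := d) hR ρ
  have hF : Measurable fun l : VecList d => ∑ p : Fin n × Fin n,
      (if p ∈ chained M l ∧ L ≤ ‖v p.1 - v p.2‖ ^ 2 then (1 : ℝ≥0∞) else 0) :=
    Finset.measurable_sum _ fun p _ => Measurable.ite
      ((measurableSet_mem_chained hM p).inter (.const _)) measurable_const measurable_const
  have hbound : ∀ l : VecList d, ∑ p : Fin n × Fin n,
      (if p ∈ chained M l ∧ L ≤ ‖v p.1 - v p.2‖ ^ 2 then (1 : ℝ≥0∞) else 0) ≤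
        (Fintype.card (Fin n × Fin n) : ℝ≥0∞) := fun l => by
    rw [Finset.sum_boole]
    exact_mod_cast Finset.card_le_univ _
  have hcard : ∀ l : VecList d,
      (({p ∈ chained M l | L ≤ ‖v p.1 - v p.2‖ ^ 2}).ncard : ℝ) = (∑ p : Fin n × Fin n,
        (if p ∈ chained M l ∧ L ≤ ‖v p.1 - v p.2‖ ^ 2 then (1 : ℝ≥0∞) else 0)).toReal := by
    intro l
    rw [ncard_eq_sum_ite, ENNReal.toReal_sum fun p _ => by split_ifs <;> simp]
    refine Finset.sum_congr rfl fun p _ => ?_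
    by_cases h : p ∈ chained M l ∧ L ≤ ‖v p.1 - v p.2‖ ^ 2
    · rw [if_pos h, ENNReal.toReal_one]; exact if_pos h
    · rw [if_neg h, ENNReal.toReal_zero]; exact if_neg h
  have hlow := le_lintegral_sampleDist hM hM' hρ v L hs hsR
  simp only [hcard]
  rw [integral_toReal hF.aemeasurable
    (ae_of_all _ fun l => (hbound l).trans_lt (ENNReal.natCast_lt_top _))]
  have hfin : ∫⁻ l, ∑ p : Fin n × Fin n,
      (if p ∈ chained M l ∧ L ≤ ‖v p.1 - v p.2‖ ^ 2 then (1 : ℝ≥0∞) else 0)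
        ∂(sampleDist d R ρ) ≠ ∞ := by
    refine ((lintegral_mono hbound).trans_lt ?_).ne
    simp only [lintegral_const, measure_univ, mul_one]
    exact ENNReal.natCast_lt_top _
  refine (ENNReal.ofReal_le_iff_le_toReal hfin).1 (le_trans ?_ hlow)
  have hpos : (0 : ℝ) < ((R * (shuffles R).card : ℕ) : ℝ) := by
    rw [card_shuffles]
    exact_mod_cast Nat.mul_pos hR (Nat.choose_pos (Nat.le_add_left R R))
  rw [ENNReal.ofReal_mul (Real.exp_pos _).le]
  refine mul_le_mul' ?_ ha
  rw [← ENNReal.ofReal_natCast, ← ENNReal.ofReal_inv_of_pos hpos, Real.exp_neg]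
  exact ENNReal.ofReal_le_ofReal (inv_anti₀ hpos (mul_card_shuffles_le_exp hR))

end

theorem theorem2 :
    ∃ (K : ℕ → ℕ) (D : (d : ℕ) → ℕ → Measure (VecList d)),
      (∀ R : ℕ, 1 ≤ R → 1 ≤ K R ∧ K R ≤ R) ∧
      (∀ d R : ℕ, 1 ≤ R →
        D d R = sampleDist d R (1 - 1 / (K R : ℝ)) ∧
        IsProbabilityMeasure (D d R) ∧
        ∀ᵐ l ∂(D d R), l.1 ≤ R) ∧
      EfficientlySamplable D ∧
      ∀ σ δ : ℝ, 0 < σ → 0 < δ →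
        ∃ c₁ c₂ C : ℝ, 0 < c₁ ∧ 0 < c₂ ∧ 0 < C ∧
          ∀ n d R : ℕ, 1 ≤ R → (R : ℝ) ≤ c₁ * Real.sqrt (Real.log n) →
            ∃ L : ℝ, c₂ * ((R : ℝ) ^ 2 / Real.log n) ≤ L ∧
              ∀ (v : Fin n → Vec d) (M : Vec d → Set (Fin n × Fin n)),
                IsMatchingCover σ δ v M →
                  Real.exp (-(C * (R : ℝ) ^ 2)) * n ≤
                    ∫ l, (({p ∈ chained M l |
                      L ≤ ‖v p.1 - v p.2‖ ^ 2}).ncard : ℝ) ∂(D d R) := by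
  refine ⟨fun R => R, fun d R => sampleDist d R (1 - 1 / (R : ℝ)), fun R hR => ⟨hR, le_rfl⟩,
    fun d R hR => ⟨rfl, isProbabilityMeasure_sampleDist hR _, length_le_of_sampleDist _⟩,
    efficientlySamplable_sampleDist, fun σ δ hσ hδ => ?_⟩
  obtain ⟨c₁, c₂, C, hc₁, hc₂, hC, h⟩ := exists_word_farMass hσ hδ
  -- The extra `3` in the exponent pays for the event that the sampled word is the one found.
  refine ⟨c₁, c₂, C + 3, hc₁, hc₂, by linarith, fun n d R hR hRn =>
    ⟨c₂ * ((R : ℝ) ^ 2 / Real.log n), le_rfl, fun v M hM => ?_⟩⟩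
  obtain ⟨s, hs, hsR, hfar⟩ := h n d R hR hRn v M hM
  have hR1 : (1 : ℝ) ≤ R := by exact_mod_cast hR
  have h0 : 0 ≤ 1 / (R : ℝ) := by positivity
  have h1 : 1 / (R : ℝ) ≤ 1 := by rw [div_le_one (by linarith)]; exact hR1
  have hρ : (1 - 1 / (R : ℝ)) ^ 2 ≤ 1 := pow_le_one₀ (by linarith) (by linarith)
  refine le_trans (le_of_eq ?_) (le_integral_sampleDist hM.measurable hM.matching hρ v _ hR hs hsR
    hfar)
  rw [← mul_assoc, ← Real.exp_add]
  congr 2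
  ring
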